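/- **Setting.** Let $\Sigma$ be a finite linearly ordered alphabet with two distinct letters $0,1$, and let $W=\Sigma^*$. Fix an infinite set of variables and a set of operators; each operator has an arity $k$ and a total semantics $W^k\to W$. The operators include $=$; $<,\le$ (shortlex order); the constants $w\in W$ (arity $0$); $+1,-1$ on unary numbers $1^n$ (with $1^0-1=\varepsilon$, and value $\varepsilon$ on words that are not unary numbers); $\mathrm{not},\mathrm{and},\mathrm{or}$; first letter $\mathrm{hd}$ and rest $\mathrm{tl}$; and appending a character to a word. Besides these the operators are arbitrary. Booleans are the words $1$ and $0$; every word other than $1$ counts as false. *Programs.* Expressions are $e::=x\mid op(\bar e)\mid \mathtt{declass}(e,e)$, where $\mathtt{declass}(e_1,e_2)$ evaluates to $1^{\min(|w_1|,|w_2|)}$ if $e_i$ evaluates to $w_i$. Statements are $s::=\mathtt{skip}\mid x:=e\mid s;s\mid \mathtt{if}(e)\{s\}\mathtt{else}\{s\}\mid\mathtt{while}(e)\{s\}\mid\mathtt{break}(e)$ with the usual semantics; $\mathtt{break}(e)$ leaves the innermost enclosing loop if $e$ evaluates to $1$. A program $\mathtt{prog}(x_1,\dots,x_n)\{s\ \mathtt{return}\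 y\}$ has distinct parameters, and every break in $s$ lies inside a while loop. It computes the partial function $[\![P]\!]:W^n\rightharpoonup W$ that maps $\bar w$ to the final value of $y$ when $s$ is run from the store with $x_i=w_i$ and all other variables equal to $\varepsilon$ (undefined if $s$ does not terminate). *Types.* Levels are natural numbers. A variable environment $\Gamma$ is a finite map from variables to levels; an operator environment $\Delta$ assigns to each operator $op$ of arity $k$ and each $(l,m)\in\mathbb N^2$ a set $\Delta(op)(l,m)\subseteq\mathbb N^{k+1}$, non-empty for finitely many $(l,m)$ only. The judgements $\vdash^l_m b:\tau$ ($l$ innermost, $m$ outermost level) are given by: - $\vdash^l_m x:\Gamma(x)$; - $\vdash^l_m op(\bar e):\tau_{k+1}$ if $(\tau_1,\dots,\tau_{k+1})\in\Delta(op)(l,m)$ and $\vdash^l_m e_i:\tau_i$ for all $i\le k$; - $\vdash^l_m\mathtt{declass}(e_1,e_2):\tau$ if $\vdash^l_m e_1:\tau_1$, $\vdash^l_m e_2:m$ and $\tau_1\le\tau\le m$; - $\vdash^l_m\mathtt{skip}:0$; - $\vdash^l_m x:=e:\Gamma(x)$ if $\vdash^l_m e:\tau_2$ and ($m=0$ or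 $\Gamma(x)\le\tau_2$); - $\vdash^l_m s_1;s_2:\tau$ if $\vdash^l_m s_1:\tau$ and $\vdash^l_m s_2:\tau$; - $\vdash^l_m\mathtt{if}(e)\{s_1\}\mathtt{else}\{s_0\}:\tau$ if $e,s_1,s_0$ all have level $\tau$ under $\vdash^l_m$; - $\vdash^l_m\mathtt{while}(e)\{s\}:\tau$ if $\vdash^\tau_m e:\tau$, $\vdash^\tau_m s:\tau$ and $1\le\tau\le m$; - $\vdash^0_0\mathtt{while}(e)\{s\}:\tau$ if $\vdash^\tau_\tau e:\tau$, $\vdash^\tau_\tau s:\tau$ and $1\le\tau$; - $\vdash^l_m\mathtt{break}(e):l$ if $\vdash^l_m e:\tau$ and $l\le\tau$; - $\vdash^l_m s:\tau_2$ if $\vdash^l_m s:\tau_1$ and $\tau_1\le\tau_2$. *Safety.* A function $f:W^k\to W$ is *neutral* if it takes values in $\{0,1\}$ or if for some fixed $i$ the word $f(\bar w)$ is always a factor of $w_i$; *positive* if $|f(\bar w)|\le\max_i|w_i|+c$ for some constant $c$; *polynomial* if $|f(\bar w)|\le Q(\max_i|w_i|)$ for some $Q\in\mathbb N[X]$ (the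 maximum over no arguments is $0$). $\Delta$ is *safe* if every operator that has some type in $\Delta$ is computable in polynomial time, is neutral, positive or polynomial, and every $(\tau_1,\dots,\tau_{k+1})\in\Delta(op)(l,m)$ satisfies: if $op$ is neutral, then $\tau_{k+1}\le\tau_i$ for all $i\le k$; if $op$ is positive but not neutral, then $\tau_{k+1}\le\tau_i$ for all $i\le k$, and $\tau_{k+1}<l$ or $\tau_{k+1}=0$; if $op$ is polynomial but not positive, then $m=0$. A program is *safe* ($P\in\mathrm{SAFE}$) if its body has some level under $\vdash^0_0$ for some safe $\Delta$ and some $\Gamma$. *For-programs.* Let $B$ be any set of expressions that contains the constant $1$ and none of whose elements evaluates to the empty word in any store (for instance $\{1\}$, all non-empty constants, or all expressions that never evaluate to $\varepsilon$). The loop $\mathtt{for}\ x=e\ \mathtt{to}\ d\ \{s\}$ with $e\in B$, where $x$ does not occur in $s$, stands for $x:=d;\ \mathtt{while}(x\ge e)\{s;\ x:=x-1\}$. Let $\mathrm{FOR}$ be the set of programs all of whose while loops come from such for loops; this is a syntactic condition, decidable as soon as membership in $B$ is. *Aperiodicity.* $P$ is *aperiodic* if in no evaluation tree of its body, from any store,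 a node $(\mu',\mathtt{while}(e)\{s\})$ has a strict descendant $(\mu'',\mathtt{while}(e)\{s\})$, with the same loop, such that $\mu',\mu''$ agree on all undeclassified variables of $e$ (those occurring in $e$ outside first arguments of $\mathtt{declass}$). **Theorem (Decidable criterion).** $[\![\mathrm{SAFE}\cap\mathrm{FOR}]\!]=\mathrm{FP}$: for every $n$, a partial function $W^n\rightharpoonup W$ is computed by a safe for-program if and only if it is total and computable in polynomial time by a Turing machine. Moreover every for-program is aperiodic. -/

import Mathlib

/-! ## Words, polynomial time, operators -/

/-- A finite alphabet with two distinguished distinct letters `0` and `1`; the linear order on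
letters is the one underlying the shortlex order on words. -/
class Alphabet (A : Type) extends Fintype A, LinearOrder A where
  zero : A
  one : A
  zero_ne_one : zero ≠ one

/-- The set of words (values) over the alphabet `A`. -/
abbrev Word (A : Type) : Type := List A

/-- The encoding of a tuple of words on the input of a Turing machine: every word is followed by
the end marker `none`. -/
def encodeTuple {A : Type} {n : ℕ} (w : Fin n → Word A) : List (Option A) :=
  (List.ofFn w).flatMap fun u => u.map some ++ [none]

/-- `f` is computable in polynomial time by a (multi-stack) Turing machine. -/
def PolyTime {A : Type} {n : ℕ} (f : (Fin n → Word A) → Word A) : Prop :=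
  Nonempty (Turing.TM2ComputableInPolyTime encodeTuple (id : Word A → List A) f)

/-- The functions in `FP` of arity `n`, regarded as (everywhere defined) partial functions. -/
def FP (A : Type) (n : ℕ) : Set ((Fin n → Word A) →. Word A) :=
  {f | ∃ g : (Fin n → Word A) → Word A, PolyTime g ∧ f = (g : (Fin n → Word A) →. Word A)}

section Words

variable {A : Type} [Alphabet A]

/-- The Boolean value true, that is the one-letter word `1`. -/
def tt1 : Word A := [Alphabet.one]

/-- The Boolean value false, that is the one-letter word `0`. -/
def ff0 : Word A := [Alphabet.zero]

/-- The unary number `1 ^ n`. -/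
def unary (n : ℕ) : Word A := List.replicate n Alphabet.one

/-- The word representing the truth value of a proposition. -/
noncomputable def ofProp (p : Prop) : Word A := by
  classical exact if p then tt1 else ff0

/-- The strict shortlex order on words. -/
def ShortlexLT (v w : Word A) : Prop := List.Shortlex (· < ·) v w

/-- The shortlex order on words. -/
def ShortlexLE (v w : Word A) : Prop := v = w ∨ ShortlexLT v w

/-- Increment of unary numbers, `ε` on words that are not unary numbers. -/
noncomputable def incr (w : Word A) : Word A := by
  classical exact if w = unary w.length then unary (w.length + 1) else []

/-- Decrement of unary numbers, `ε` on words that are not unary numbers. -/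
noncomputable def decr (w : Word A) : Word A := by
  classical exact if w = unary w.length then unary (w.length - 1) else []

/-- The word `w` followed by the character `a`; `ε` if `a` is not a single character. -/
def appendChar (w a : Word A) : Word A := if a.length = 1 then w ++ a else []

end Words

/-- The basic operators. Constants are operators of arity `0`; `0` is the constant `[0]`. -/
inductive BasicOp (A : Type) : Type
  | eq
  | lt
  | le
  | const (w : Word A)
  | incr
  | decr
  | not
  | and
  | or
  | hd
  | tl
  | app

/-- Arities of the basic operators. -/
def BasicOp.ar {A : Type} : BasicOp A → ℕ
  | .eq => 2
  | .lt => 2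
  | .le => 2
  | .const _ => 0
  | .incr => 1
  | .decr => 1
  | .not => 1
  | .and => 2
  | .or => 2
  | .hd => 1
  | .tl => 1
  | .app => 2

/-- The functions computed by the basic operators. A word different from `1` counts as false. -/
noncomputable def BasicOp.sem {A : Type} [Alphabet A] :
    (o : BasicOp A) → (Fin o.ar → Word A) → Word A
  | .eq => fun (w : Fin 2 → Word A) => ofProp (w 0 = w 1)
  | .lt => fun (w : Fin 2 → Word A) => ofProp (ShortlexLT (w 0) (w 1))
  | .le => fun (w : Fin 2 → Word A) => ofProp (ShortlexLE (w 0) (w 1))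
  | .const u => fun _ => u
  | .incr => fun (w : Fin 1 → Word A) => _root_.incr (w 0)
  | .decr => fun (w : Fin 1 → Word A) => _root_.decr (w 0)
  | .not => fun (w : Fin 1 → Word A) => ofProp (¬ w 0 = tt1)
  | .and => fun (w : Fin 2 → Word A) => ofProp (w 0 = tt1 ∧ w 1 = tt1)
  | .or => fun (w : Fin 2 → Word A) => ofProp (w 0 = tt1 ∨ w 1 = tt1)
  | .hd => fun (w : Fin 1 → Word A) => (w 0).take 1
  | .tl => fun (w : Fin 1 → Word A) => (w 0).tail
  | .app => fun (w : Fin 2 → Word A) => appendChar (w 0) (w 1)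

/-- The operators of a language beyond the basic ones: an arbitrary family of operators, each
with an arity and a total semantics. -/
structure ExtraOps (A : Type) where
  Sym : Type
  ar : Sym → ℕ
  sem : (o : Sym) → (Fin (ar o) → Word A) → Word A

namespace ExtraOps

variable {A : Type} (O : ExtraOps A)

/-- The set of all operators of the language: the basic ones and the additional ones. -/
abbrev Op : Type := BasicOp A ⊕ O.Sym

/-- Arity of an operator. -/
def arity : O.Op → ℕ
  | .inl o => o.ar
  | .inr o => O.ar o

/-- Semantics of an operator. -/
noncomputable def denote [Alphabet A] : (o : O.Op) → (Fin (O.arity o) → Word A) → Word A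
  | .inl o => o.sem
  | .inr o => O.sem o

end ExtraOps

/-- Neutral functions: predicates, and functions whose value is always a sub-word of one fixed
argument. -/
def IsNeutral {A : Type} [Alphabet A] {k : ℕ} (f : (Fin k → Word A) → Word A) : Prop :=
  (∀ w, f w = ff0 ∨ f w = tt1) ∨ ∃ i, ∀ w, f w <:+: w i

/-- Positive functions: the size exceeds the maximal size of the arguments by a constant at most.
(The supremum over no arguments is `0`.) -/
def IsPositive {A : Type} {k : ℕ} (f : (Fin k → Word A) → Word A) : Prop :=
  ∃ c : ℕ, ∀ w, (f w).length ≤ (Finset.univ.sup fun i => (w i).length) + c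

/-- Polynomial functions: the size is bounded by a polynomial in the maximal size of the
arguments. -/
def IsPolynomial {A : Type} {k : ℕ} (f : (Fin k → Word A) → Word A) : Prop :=
  ∃ P : Polynomial ℕ, ∀ w, (f w).length ≤ P.eval (Finset.univ.sup fun i => (w i).length)

/-! ## Programs -/

/-- Expressions. -/
inductive Expr {A : Type} (O : ExtraOps A) (V : Type) : Type
  | var (x : V)
  | op (o : O.Op) (args : Fin (O.arity o) → Expr O V)
  | declass (e₁ e₂ : Expr O V)

/-- Statements. -/
inductive Stmt {A : Type} (O : ExtraOps A) (V : Type) : Type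
  | skip
  | assign (x : V) (e : Expr O V)
  | seq (s₁ s₂ : Stmt O V)
  | ite (e : Expr O V) (s₁ s₀ : Stmt O V)
  | loop (e : Expr O V) (s : Stmt O V)
  | brk (e : Expr O V)

/-- Every break occurs inside a while loop. -/
def Stmt.BreaksInLoops {A : Type} {O : ExtraOps A} {V : Type} : Stmt O V → Prop
  | .skip => True
  | .assign _ _ => True
  | .seq s₁ s₂ => s₁.BreaksInLoops ∧ s₂.BreaksInLoops
  | .ite _ s₁ s₀ => s₁.BreaksInLoops ∧ s₀.BreaksInLoops
  | .loop _ _ => True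
  | .brk _ => False

/-- Programs `prog(x₁, …, xₙ){ s return y }` with `n` distinct parameters. -/
structure Program {A : Type} (O : ExtraOps A) (V : Type) (n : ℕ) where
  params : Fin n → V
  params_injective : Function.Injective params
  body : Stmt O V
  body_breaks : body.BreaksInLoops
  ret : V

section Language

variable {A : Type} {O : ExtraOps A} {V : Type} [DecidableEq V]

/-- The variables of an expression. -/
def Expr.vars : Expr O V → Finset V
  | .var x => {x}
  | .op _ args => Finset.univ.biUnion fun i => (args i).vars
  | .declass e₁ e₂ => e₁.vars ∪ e₂.vars

/-- The undeclassified variables of an expression. -/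
def Expr.undeclassified : Expr O V → Finset V
  | .var x => {x}
  | .op _ args => Finset.univ.biUnion fun i => (args i).undeclassified
  | .declass _ e₂ => e₂.undeclassified

/-- The variables occurring in a statement (read or assigned). -/
def Stmt.vars : Stmt O V → Finset V
  | .skip => ∅
  | .assign x e => {x} ∪ e.vars
  | .seq s₁ s₂ => s₁.vars ∪ s₂.vars
  | .ite e s₁ s₀ => e.vars ∪ s₁.vars ∪ s₀.vars
  | .loop e s => e.vars ∪ s.vars
  | .brk e => e.vars

end Language

/-! ## Semantics -/

/-- Memory stores. -/
abbrev Store (A V : Type) : Type := V → Word A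

/-- The flag of an evaluation: `go` if the flow continues, `broken` if a break was taken. -/
inductive ExitFlag : Type
  | go
  | broken

section Semantics

variable {A : Type} [Alphabet A] {O : ExtraOps A} {V : Type}

/-- Evaluation of expressions. -/
noncomputable def Expr.eval (μ : Store A V) : Expr O V → Word A
  | .var x => μ x
  | .op o args => O.denote o fun i => (args i).eval μ
  | .declass e₁ e₂ => unary (min (e₁.eval μ).length (e₂.eval μ).length)

variable [DecidableEq V]

/-- Big-step semantics of statements: `Exec μ s b μ'` means `(μ, s) → (b, μ')`. -/
inductive Exec : Store A V → Stmt O V → ExitFlag → Store A V → Prop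
  | skip (μ : Store A V) : Exec μ .skip .go μ
  | assign (μ : Store A V) (x : V) (e : Expr O V) :
      Exec μ (.assign x e) .go (Function.update μ x (e.eval μ))
  | seq_go {μ μ' μ'' : Store A V} {s₁ s₂ : Stmt O V} {b : ExitFlag} :
      Exec μ s₁ .go μ' → Exec μ' s₂ b μ'' → Exec μ (.seq s₁ s₂) b μ''
  | seq_broken {μ μ' : Store A V} {s₁ s₂ : Stmt O V} :
      Exec μ s₁ .broken μ' → Exec μ (.seq s₁ s₂) .broken μ'
  | ite_true {μ μ' : Store A V} {e : Expr O V} {s₁ s₀ : Stmt O V} {b : ExitFlag} :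
      e.eval μ = tt1 → Exec μ s₁ b μ' → Exec μ (.ite e s₁ s₀) b μ'
  | ite_false {μ μ' : Store A V} {e : Expr O V} {s₁ s₀ : Stmt O V} {b : ExitFlag} :
      e.eval μ ≠ tt1 → Exec μ s₀ b μ' → Exec μ (.ite e s₁ s₀) b μ'
  | loop_false {μ : Store A V} {e : Expr O V} {s : Stmt O V} :
      e.eval μ ≠ tt1 → Exec μ (.loop e s) .go μ
  | loop_true {μ μ' : Store A V} {e : Expr O V} {s : Stmt O V} {b : ExitFlag} :
      e.eval μ = tt1 → Exec μ (.seq s (.loop e s)) b μ' → Exec μ (.loop e s) .go μ'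
  | brk_false {μ : Store A V} {e : Expr O V} :
      e.eval μ ≠ tt1 → Exec μ (.brk e) .go μ
  | brk_true {μ : Store A V} {e : Expr O V} :
      e.eval μ = tt1 → Exec μ (.brk e) .broken μ

/-- `Child c c'`: in the (possibly infinite) evaluation tree with root `c`, the configuration `c'`
is the root of one of the immediate subtrees. -/
inductive Child : Store A V × Stmt O V → Store A V × Stmt O V → Prop
  | seq_left (μ : Store A V) (s₁ s₂ : Stmt O V) : Child (μ, .seq s₁ s₂) (μ, s₁)
  | seq_right {μ μ' : Store A V} {s₁ : Stmt O V} (s₂ : Stmt O V) :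
      Exec μ s₁ .go μ' → Child (μ, .seq s₁ s₂) (μ', s₂)
  | ite_true {μ : Store A V} {e : Expr O V} (s₁ s₀ : Stmt O V) :
      e.eval μ = tt1 → Child (μ, .ite e s₁ s₀) (μ, s₁)
  | ite_false {μ : Store A V} {e : Expr O V} (s₁ s₀ : Stmt O V) :
      e.eval μ ≠ tt1 → Child (μ, .ite e s₁ s₀) (μ, s₀)
  | loop {μ : Store A V} {e : Expr O V} (s : Stmt O V) :
      e.eval μ = tt1 → Child (μ, .loop e s) (μ, .seq s (.loop e s))

namespace Program

variable {n : ℕ}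

/-- The store that maps the parameters to the inputs and all other variables to `ε`. -/
noncomputable def initStore (P : Program O V n) (w : Fin n → Word A) : Store A V :=
  Function.extend P.params w fun _ => []

/-- `P` computes the partial function `f`: `f w` is defined with value `v` iff the body, started
on the input `w`, terminates normally with `v` in the return variable. -/
def Computes (P : Program O V n) (f : (Fin n → Word A) →. Word A) : Prop :=
  ∀ w v, v ∈ f w ↔ ∃ μ', Exec (P.initStore w) P.body .go μ' ∧ μ' P.ret = v

/-- Aperiodicity: no while loop is reached again below itself in an evaluation tree with a store
that agrees on the undeclassified variables of its guard. -/
def Aperiodic (P : Program O V n) : Prop :=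
  ∀ μ : Store A V, ¬ ∃ (μ' μ'' : Store A V) (e : Expr O V) (s : Stmt O V),
    Relation.ReflTransGen Child (μ, P.body) (μ', .loop e s) ∧
    Relation.TransGen Child (μ', .loop e s) (μ'', .loop e s) ∧
    ∀ x ∈ e.undeclassified, μ' x = μ'' x

end Program

end Semantics

/-! ## Type system -/

/-- Variable typing environments: finite maps from variables to levels. -/
structure VarEnv (V : Type) where
  level : V → Option ℕ
  finite_dom : {x | level x ≠ none}.Finite

/-- Operator typing environments: `typ o l m` is the set of functional levels admissible for `o`
under innermost level `l` and outermost level `m`; `(a, r)` in it stands for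
`a 0 → ⋯ → a (k - 1) → r`. It is a finite map: non-empty for finitely many `(l, m)` only. -/
structure OpEnv {A : Type} (O : ExtraOps A) where
  typ : (o : O.Op) → ℕ → ℕ → Set ((Fin (O.arity o) → ℕ) × ℕ)
  finite_map : ∀ o, {p : ℕ × ℕ | (typ o p.1 p.2).Nonempty}.Finite

/-- The operators in the domain of an operator typing environment: those with some type. -/
def OpEnv.dom {A : Type} {O : ExtraOps A} (Δ : OpEnv O) : Set O.Op :=
  {o | ∃ l m, (Δ.typ o l m).Nonempty}

/-- Safe operator typing environments. -/
def OpEnv.Safe {A : Type} [Alphabet A] {O : ExtraOps A} (Δ : OpEnv O) : Prop :=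
  ∀ o ∈ Δ.dom,
    (IsNeutral (O.denote o) ∨ IsPositive (O.denote o) ∨ IsPolynomial (O.denote o)) ∧
    PolyTime (O.denote o) ∧
    ∀ l m a r, (a, r) ∈ Δ.typ o l m →
      (IsNeutral (O.denote o) → ∀ i, r ≤ a i) ∧
      (IsPositive (O.denote o) → ¬ IsNeutral (O.denote o) →
        (∀ i, r ≤ a i) ∧ (r < l ∨ r = 0)) ∧
      (IsPolynomial (O.denote o) → ¬ IsPositive (O.denote o) → m = 0)

section Typing

variable {A : Type} {O : ExtraOps A} {V : Type}

/-- `ExprTy Γ Δ l m e τ`: under innermost level `l` and outermost level `m`, `e` has level `τ`. -/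
inductive ExprTy (Γ : VarEnv V) (Δ : OpEnv O) (l m : ℕ) : Expr O V → ℕ → Prop
  | var {x : V} {τ : ℕ} : Γ.level x = some τ → ExprTy Γ Δ l m (.var x) τ
  | op {o : O.Op} {args : Fin (O.arity o) → Expr O V} {a : Fin (O.arity o) → ℕ} {r : ℕ} :
      (a, r) ∈ Δ.typ o l m → (∀ i, ExprTy Γ Δ l m (args i) (a i)) →
      ExprTy Γ Δ l m (.op o args) r
  | declass {e₁ e₂ : Expr O V} {τ₁ τ : ℕ} :
      ExprTy Γ Δ l m e₁ τ₁ → ExprTy Γ Δ l m e₂ m → τ₁ ≤ τ → τ ≤ m →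
      ExprTy Γ Δ l m (.declass e₁ e₂) τ

/-- `StmtTy Γ Δ l m s τ`: under innermost level `l` and outermost level `m`, `s` has level `τ`. -/
inductive StmtTy (Γ : VarEnv V) (Δ : OpEnv O) : ℕ → ℕ → Stmt O V → ℕ → Prop
  | sub {l m : ℕ} {s : Stmt O V} {τ₁ τ₂ : ℕ} :
      StmtTy Γ Δ l m s τ₁ → τ₁ ≤ τ₂ → StmtTy Γ Δ l m s τ₂
  | skip {l m : ℕ} : StmtTy Γ Δ l m .skip 0
  | assign {l m : ℕ} {x : V} {e : Expr O V} {τ₁ τ₂ : ℕ} :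
      Γ.level x = some τ₁ → ExprTy Γ Δ l m e τ₂ → (m = 0 ∨ τ₁ ≤ τ₂) →
      StmtTy Γ Δ l m (.assign x e) τ₁
  | seq {l m : ℕ} {s₁ s₂ : Stmt O V} {τ : ℕ} :
      StmtTy Γ Δ l m s₁ τ → StmtTy Γ Δ l m s₂ τ → StmtTy Γ Δ l m (.seq s₁ s₂) τ
  | ite {l m : ℕ} {e : Expr O V} {s₁ s₀ : Stmt O V} {τ : ℕ} :
      ExprTy Γ Δ l m e τ → StmtTy Γ Δ l m s₁ τ → StmtTy Γ Δ l m s₀ τ →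
      StmtTy Γ Δ l m (.ite e s₁ s₀) τ
  | inner_loop {l m : ℕ} {e : Expr O V} {s : Stmt O V} {τ : ℕ} :
      ExprTy Γ Δ τ m e τ → StmtTy Γ Δ τ m s τ → 1 ≤ τ → τ ≤ m →
      StmtTy Γ Δ l m (.loop e s) τ
  | outer_loop {e : Expr O V} {s : Stmt O V} {τ : ℕ} :
      ExprTy Γ Δ τ τ e τ → StmtTy Γ Δ τ τ s τ → 1 ≤ τ →
      StmtTy Γ Δ 0 0 (.loop e s) τ
  | brk {l m : ℕ} {e : Expr O V} {τ : ℕ} :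
      ExprTy Γ Δ l m e τ → l ≤ τ → StmtTy Γ Δ l m (.brk e) l

end Typing

/-- Safe programs. -/
def Program.Safe {A : Type} [Alphabet A] {O : ExtraOps A} {V : Type} {n : ℕ}
    (P : Program O V n) : Prop :=
  ∃ Δ : OpEnv O, Δ.Safe ∧ ∃ (τ : ℕ) (Γ : VarEnv V), StmtTy Γ Δ 0 0 P.body τ

/-! ## For-programs -/

section ForPrograms

variable {A : Type} {O : ExtraOps A} {V : Type}

/-- The constant expression with value `w`. -/
def constExpr (w : Word A) : Expr O V := .op (.inl (.const w)) Fin.elim0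

/-- The guard `x ≥ e`. -/
def geExpr (x : V) (e : Expr O V) : Expr O V :=
  .op (.inl .le) (![e, .var x] : Fin 2 → Expr O V)

/-- The assignment `x := x - 1`. -/
def decrStmt (x : V) : Stmt O V :=
  .assign x (.op (.inl .decr) (![.var x] : Fin 1 → Expr O V))

/-- The loop `for x = e to d { s }`, that is `x := d; while (x ≥ e) { s; x := x - 1 }`. -/
def forStmt (x : V) (e d : Expr O V) (s : Stmt O V) : Stmt O V :=
  .seq (.assign x d) (.loop (geExpr x e) (.seq s (decrStmt x)))

/-- If the expression is `x ≥ e`, the pair `(e, x)`. -/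
def Expr.geParts : Expr O V → Option (Expr O V × V)
  | .op (.inl .le) args =>
      match args (1 : Fin 2) with
      | .var x => some (args (0 : Fin 2), x)
      | _ => none
  | _ => none

theorem Expr.geParts_eq_some {g e : Expr O V} {x : V} :
    g.geParts = some (e, x) ↔ g = geExpr x e := by
  constructor
  · intro h
    unfold Expr.geParts at h
    split at h
    · rename_i args
      split at h
      · rename_i y hy
        simp only [Option.some.injEq, Prod.mk.injEq] at h
        obtain ⟨h0, rfl⟩ := h
        unfold geExpr
        congr 1
        funext (i : Fin 2)
        fin_cases i
        · exact h0
        · exact hy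
      · exact absurd h (by simp)
    · exact absurd h (by simp)
  · rintro rfl
    rfl

variable [DecidableEq V]

/-- Statements all of whose while loops come from for loops with lower bounds in `B`. -/
inductive Stmt.IsFor (B : Set (Expr O V)) : Stmt O V → Prop
  | skip : IsFor B .skip
  | assign (x : V) (e : Expr O V) : IsFor B (.assign x e)
  | seq {s₁ s₂ : Stmt O V} : IsFor B s₁ → IsFor B s₂ → IsFor B (.seq s₁ s₂)
  | ite (e : Expr O V) {s₁ s₀ : Stmt O V} : IsFor B s₁ → IsFor B s₀ → IsFor B (.ite e s₁ s₀)
  | brk (e : Expr O V) : IsFor B (.brk e)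
  | for_loop {x : V} {e d : Expr O V} {s : Stmt O V} :
      e ∈ B → x ∉ s.vars → IsFor B s → IsFor B (forStmt x e d s)

/-- For-programs with lower bounds of for loops in `B`. -/
def Program.IsFor {n : ℕ} (B : Set (Expr O V)) (P : Program O V n) : Prop :=
  P.body.IsFor B

/-- If the statement is `x := x - 1`, the variable `x`. -/
def Stmt.decrVar : Stmt O V → Option V
  | .assign x (.op (.inl .decr) args) =>
      match args (0 : Fin 1) with
      | .var y => if y = x then some x else none
      | _ => none
  | _ => none

theorem Stmt.decrVar_eq_some {t : Stmt O V} {x : V} : t.decrVar = some x ↔ t = decrStmt x := by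
  constructor
  · intro h
    unfold Stmt.decrVar at h
    split at h
    · rename_i z args
      split at h
      · rename_i y hy
        split at h
        · rename_i hyz
          simp only [Option.some.injEq] at h
          subst h
          subst hyz
          unfold decrStmt
          congr 2
          funext (i : Fin 1)
          fin_cases i
          exact hy
        · exact absurd h (by simp)
      · exact absurd h (by simp)
    · exact absurd h (by simp)
  · rintro rfl
    simp [decrStmt, Stmt.decrVar]

/-- The check that a statement contains no while loop except those coming from for loops with
lower bounds in `B`. -/
def Stmt.checkFor (B : Set (Expr O V)) [DecidablePred (· ∈ B)] : Stmt O V → Bool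
  | .skip => true
  | .assign _ _ => true
  | .seq (.assign x _) (.loop g (.seq s t)) =>
      (match g.geParts with
        | some (e, y) => decide (e ∈ B ∧ y = x)
        | none => false) && decide (t.decrVar = some x) && decide (x ∉ s.vars) && s.checkFor B
  | .seq s₁ s₂ => s₁.checkFor B && s₂.checkFor B
  | .ite _ s₁ s₀ => s₁.checkFor B && s₀.checkFor B
  | .loop _ _ => false
  | .brk _ => true

/-- Being a for-program is decided by the check, as soon as the membership of an expression in `B`
is decidable. -/
theorem Stmt.checkFor_iff (B : Set (Expr O V)) [DecidablePred (· ∈ B)] (s : Stmt O V) :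
    s.checkFor B = true ↔ s.IsFor B := by
  constructor
  · intro h
    induction s using Stmt.checkFor.induct with
    | case1 => exact .skip
    | case2 x e => exact .assign x e
    | case3 x d g s t ih =>
      simp only [Stmt.checkFor, Bool.and_eq_true, decide_eq_true_eq] at h
      obtain ⟨⟨⟨h1, h2⟩, h3⟩, h4⟩ := h
      split at h1
      · rename_i e y hg
        simp only [decide_eq_true_eq] at h1
        obtain ⟨he, rfl⟩ := h1
        rw [Expr.geParts_eq_some.1 hg, Stmt.decrVar_eq_some.1 h2]
        exact .for_loop he h3 (ih h4)
      · exact absurd h1 (by simp)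
    | case4 s₁ s₂ hn ih₁ ih₂ =>
      rw [Stmt.checkFor] at h
      · simp only [Bool.and_eq_true] at h
        exact .seq (ih₁ h.1) (ih₂ h.2)
      · exact hn
    | case5 e s₁ s₀ ih₁ ih₂ =>
      simp only [Stmt.checkFor, Bool.and_eq_true] at h
      exact .ite e (ih₁ h.1) (ih₂ h.2)
    | case6 e s => exact absurd h (by simp [Stmt.checkFor])
    | case7 e => exact .brk e
  · intro h
    induction h with
    | skip => rfl
    | assign x e => rfl
    | @seq s₁ s₂ h₁ h₂ ih₁ ih₂ =>
      rw [Stmt.checkFor]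
      · simp [ih₁, ih₂]
      · rintro x d g s t - rfl
        cases h₂
    | ite e h₁ h₂ ih₁ ih₂ => simp [Stmt.checkFor, ih₁, ih₂]
    | brk e => rfl
    | @for_loop x e d s he hx hs ih =>
      simp [forStmt, Stmt.checkFor, Expr.geParts_eq_some.2 (rfl : geExpr x e = geExpr x e),
        Stmt.decrVar_eq_some.2 (rfl : decrStmt (O := O) x = decrStmt x), he, hx, ih]

instance Program.decidableIsFor {n : ℕ} (B : Set (Expr O V)) [DecidablePred (· ∈ B)]
    (P : Program O V n) : Decidable (P.IsFor B) :=
  decidable_of_iff _ (Stmt.checkFor_iff B P.body)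

end ForPrograms

/-!
Aperiodicity and the polynomial time bound rest on one observation, `length_lt_of_forStep`: as the
lower bound `e` of a for loop never evaluates to the empty word, the guard `x ≥ e` forces the
counter `x` to be non-empty, and `x := x - 1` then makes it strictly shorter, since `x` is not
touched otherwise.

*Aperiodicity* (`Program.IsFor.aperiodic`). Below a loop of an evaluation tree, the same loop
occurs only as a later round of itself, hence with a shorter counter. The counter is an
undeclassified variable of the guard, so the two stores differ there.

*Safe for-programs compute functions in `FP`* (`Program.Safe.mem_FP`). Fix the level `r`, and let
`Γ.size r μ` be the maximal length of the variables of level at least `r`. Inside a loop of level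
`τ`, values of level at least `τ` come from neutral operators, so `Γ.size r` does not grow for
`τ ≤ r` (`StmtTy.size_le`); below that, operators are positive, and every statement increases
`Γ.size r` by a polynomial in `Γ.size (r + 1)` at most (`StmtTy.exists_size_le`). For a loop this
holds because the counter has level at least `τ`, so that the number of rounds is bounded by
`Γ.size (r + 1)` whenever `r < τ` (`exists_size_le_of_loop`). With `r = 0`, all stores met in a
loop have polynomial size, and the number of rounds is at most the length of the counter. Hence
execution terminates, and it is carried out in polynomial time by a multi-stack machine that has
the machines of the operators as subroutines (`StmtTy.goodStmt`). Such machines are written in a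
small language of structured programs, `Cmd`, which is compiled to Mathlib's model once and for all
(`Cmd.Runs.tmReach`).

*Functions in `FP` are computed by safe for-programs* (`exists_program_of_mem_FP`). The simulating
program uses two levels. Clocks and counters have level `1`; the control state and the stacks,
encoded by words over the alphabet, have level `0`, where words may be built letter by letter.
Outside all loops, variables of level `0` may be copied to variables of level `1` and lengths may
be declassified, so that a clock of length `(∑ i, |w i| + D) ^ D` can be computed
(`does_setClock`). A for loop governed by the clock then executes one instruction of the machine
per round (`does_round`). Pushing a symbol means writing letters to the left end of a word, whereas
the operators append to the right end only; therefore the code of the symbol is put into an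
auxiliary variable, and the stack is appended to it letter by letter in an inner for loop governed
by the same clock (`does_drain`). Machine programs are split into single instructions
(`Elementary.step`), so that a configuration that has halted stays unchanged until the clock
expires.
-/

/-! ### Structured programs for multi-stack machines -/

/-- Structured programs over the stacks `K` with alphabets `Γ` and a control state in `σ`. They
compile to multi-stack Turing machines, but come with compositional rules for running times. -/
inductive Cmd {K : Type} (Γ : K → Type) (σ : Type) : Type 1
  | push (k : K) (f : σ → Γ k)
  | peek (k : K) (f : σ → Option (Γ k) → σ)
  | pop (k : K) (f : σ → Option (Γ k) → σ)
  | load (f : σ → σ)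
  | seq (p q : Cmd Γ σ)
  | switch (ι : Type) (hι : Finite ι) (c : σ → ι) (p : ι → Cmd Γ σ)
  | loop (c : σ → Bool) (p : Cmd Γ σ)

namespace Cmd

variable {K : Type} {Γ : K → Type} {σ : Type}

/-- Two-way branching. -/
def ite (c : σ → Bool) (p q : Cmd Γ σ) : Cmd Γ σ :=
  .switch Bool inferInstance c fun b => if b then p else q

/-- Program points, which become the labels of the machine. -/
def Lab : Cmd Γ σ → Type
  | .push _ _ => Unit
  | .peek _ _ => Unit
  | .pop _ _ => Unit
  | .load _ => Unit
  | .seq p q => p.Lab ⊕ q.Lab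
  | .switch ι _ _ p => Option (Σ i : ι, (p i).Lab)
  | .loop _ p => Option p.Lab

/-- The program point at which a program starts. -/
def entry : (p : Cmd Γ σ) → p.Lab
  | .push _ _ => ()
  | .peek _ _ => ()
  | .pop _ _ => ()
  | .load _ => ()
  | .seq p _ => Sum.inl p.entry
  | .switch _ _ _ _ => none
  | .loop _ _ => none

theorem finite_lab (p : Cmd Γ σ) : Finite p.Lab := by
  induction p with
  | push k f => exact inferInstanceAs (Finite Unit)
  | peek k f => exact inferInstanceAs (Finite Unit)
  | pop k f => exact inferInstanceAs (Finite Unit)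
  | load f => exact inferInstanceAs (Finite Unit)
  | seq p q hp hq => exact inferInstanceAs (Finite (p.Lab ⊕ q.Lab))
  | switch ι hι c p hp => exact inferInstanceAs (Finite (Option (Σ i : ι, (p i).Lab)))
  | loop c p hp => exact inferInstanceAs (Finite (Option p.Lab))

/-- The machine code at each program point, where the points of the program are embedded into the
labels `Λ` of the machine by `j` and control is passed to `exit` at the end. -/
def code {Λ : Type} : (p : Cmd Γ σ) → (j : p.Lab → Λ) → (exit : Λ) → p.Lab →
    Turing.TM2.Stmt Γ Λ σ
  | .push k f, _, exit, _ => .push k f (.goto fun _ => exit)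
  | .peek k f, _, exit, _ => .peek k f (.goto fun _ => exit)
  | .pop k f, _, exit, _ => .pop k f (.goto fun _ => exit)
  | .load f, _, exit, _ => .load f (.goto fun _ => exit)
  | .seq p q, j, exit, x =>
      match x with
      | .inl a => p.code (fun a => j (.inl a)) (j (.inr q.entry)) a
      | .inr b => q.code (fun b => j (.inr b)) exit b
  | .switch _ _ c p, j, exit, x =>
      match x with
      | none => .goto fun s => j (some ⟨c s, (p (c s)).entry⟩)
      | some ⟨i, a⟩ => (p i).code (fun a => j (some ⟨i, a⟩)) exit a
  | .loop c p, j, exit, x =>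
      match x with
      | none => .branch c (.goto fun _ => j (some p.entry)) (.goto fun _ => exit)
      | some a => p.code (fun a => j (some a)) (j none) a

variable [DecidableEq K]

/-- `Runs p t s S s' S'`: started with control state `s` and stacks `S`, the program `p` ends with
`s'` and `S'` after at most `t` steps. -/
inductive Runs : Cmd Γ σ → ℕ → σ → (∀ k, List (Γ k)) → σ → (∀ k, List (Γ k)) → Prop
  | push (k : K) (f : σ → Γ k) (s S) :
      Runs (.push k f) 1 s S s (Function.update S k (f s :: S k))
  | peek (k : K) (f : σ → Option (Γ k) → σ) (s S) :
      Runs (.peek k f) 1 s S (f s (S k).head?) S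
  | pop (k : K) (f : σ → Option (Γ k) → σ) (s S) :
      Runs (.pop k f) 1 s S (f s (S k).head?) (Function.update S k (S k).tail)
  | load (f : σ → σ) (s S) : Runs (.load f) 1 s S (f s) S
  | seq {p q : Cmd Γ σ} {t t' s S s' S' s'' S''} :
      Runs p t s S s' S' → Runs q t' s' S' s'' S'' → Runs (.seq p q) (t + t') s S s'' S''
  | switch {ι : Type} {hι : Finite ι} {c : σ → ι} {p : ι → Cmd Γ σ} {t s S s' S'} :
      Runs (p (c s)) t s S s' S' → Runs (.switch ι hι c p) (t + 1) s S s' S'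
  | loop_done {c : σ → Bool} (p : Cmd Γ σ) {s} (S) : c s = false → Runs (.loop c p) 1 s S s S
  | loop_step {c : σ → Bool} {p : Cmd Γ σ} {t t' s S s' S' s'' S''} :
      c s = true → Runs p t s S s' S' → Runs (.loop c p) t' s' S' s'' S'' →
      Runs (.loop c p) (t + t' + 1) s S s'' S''
  | mono {p : Cmd Γ σ} {t t' s S s' S'} : Runs p t s S s' S' → t ≤ t' → Runs p t' s S s' S'

theorem Runs.ite {c : σ → Bool} {p q : Cmd Γ σ} {t s S s' S'}
    (h : Runs (if c s then p else q) t s S s' S') : Runs (Cmd.ite c p q) (t + 1) s S s' S' :=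
  .switch h

end Cmd

/-- `TMReach M t c c'`: the machine gets from `c` to `c'` in at most `t` steps. -/
def TMReach {K Λ σ : Type} {Γ : K → Type} [DecidableEq K] (M : Λ → Turing.TM2.Stmt Γ Λ σ) (t : ℕ)
    (c c' : Turing.TM2.Cfg Γ Λ σ) : Prop :=
  ∃ n ≤ t, (flip bind (Turing.TM2.step M))^[n] (some c) = some c'

namespace TMReach

variable {K Λ σ : Type} {Γ : K → Type} [DecidableEq K] {M : Λ → Turing.TM2.Stmt Γ Λ σ}

theorem single {c c' : Turing.TM2.Cfg Γ Λ σ} (h : Turing.TM2.step M c = some c') :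
    TMReach M 1 c c' :=
  ⟨1, le_rfl, by simp [flip, h]⟩

theorem trans {t t' : ℕ} {c c' c'' : Turing.TM2.Cfg Γ Λ σ} (h : TMReach M t c c')
    (h' : TMReach M t' c' c'') : TMReach M (t + t') c c'' := by
  obtain ⟨n, hn, e⟩ := h
  obtain ⟨n', hn', e'⟩ := h'
  exact ⟨n' + n, by omega, by rw [Function.iterate_add_apply, e, e']⟩

theorem mono {t t' : ℕ} {c c' : Turing.TM2.Cfg Γ Λ σ} (h : TMReach M t c c') (ht : t ≤ t') :
    TMReach M t' c c' := by
  obtain ⟨n, hn, e⟩ := h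
  exact ⟨n, hn.trans ht, e⟩

end TMReach

namespace Cmd

variable {K : Type} {Γ : K → Type} {σ : Type} [DecidableEq K]

/-- The compiled code is correct, in whichever machine it is embedded. -/
theorem Runs.tmReach {Λ : Type} {M : Λ → Turing.TM2.Stmt Γ Λ σ} {p : Cmd Γ σ} {t s S s' S'}
    (h : Runs p t s S s' S') (j : p.Lab → Λ) (exit : Λ)
    (hM : ∀ a, M (j a) = p.code j exit a) :
    TMReach M t ⟨some (j p.entry), s, S⟩ ⟨some exit, s', S'⟩ := by
  induction h generalizing exit with
  | push k f s S => exact .single (by simp [hM, code])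
  | peek k f s S => exact .single (by simp [hM, code])
  | pop k f s S => exact .single (by simp [hM, code])
  | load f s S => exact .single (by simp [hM, code])
  | @seq p q t t' s S s' S' s'' S'' h h' ih ih' =>
    exact (ih (fun a => j (.inl a)) (j (.inr q.entry)) fun a => hM (.inl a)).trans
      (ih' (fun a => j (.inr a)) exit fun a => hM (.inr a))
  | @switch ι hι c p t s S s' S' h ih =>
    rw [add_comm]
    refine TMReach.trans (.single ?_)
      (ih (fun a => j (some ⟨c s, a⟩)) exit fun a => hM (some ⟨c s, a⟩))
    have h0 : M (j (entry (.switch ι hι c p))) = .goto fun s => j (some ⟨c s, (p (c s)).entry⟩) :=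
      hM none
    rw [Turing.TM2.step, h0]
    rfl
  | @loop_done c p s S h =>
    have h0 : M (j (entry (.loop c p))) =
      .branch c (.goto fun _ => j (some p.entry)) (.goto fun _ => exit) := hM none
    exact .single (by rw [Turing.TM2.step, h0]; simp [h])
  | @loop_step c p t t' s S s' S' s'' S'' hc h h' ih ih' =>
    have h0 : M (j (entry (.loop c p))) =
      .branch c (.goto fun _ => j (some p.entry)) (.goto fun _ => exit) := hM none
    have h1 : TMReach M 1 ⟨some (j (entry (.loop c p))), s, S⟩ ⟨some (j (some p.entry)), s, S⟩ :=
      .single (by rw [Turing.TM2.step, h0]; simp [hc])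
    have h2 := ih (fun a => j (some a)) (j none) fun a => hM (some a)
    exact ((h1.trans h2).trans (ih' j exit hM)).mono (by omega)
  | mono h ht ih => exact (ih j exit hM).mono ht

end Cmd

theorem initList_eq_update (tm : Turing.FinTM2) (s : List (tm.Γ tm.k₀)) :
    Turing.initList tm s =
      ⟨some tm.main, tm.initialState, Function.update (fun _ => []) tm.k₀ s⟩ := by
  unfold Turing.initList
  congr 1
  funext k
  by_cases h : k = tm.k₀
  · subst h; simp
  · simp [h]

theorem haltList_eq_update (tm : Turing.FinTM2) (s : List (tm.Γ tm.k₁)) :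
    Turing.haltList tm s =
      ⟨none, tm.initialState, Function.update (fun _ => []) tm.k₁ s⟩ := by
  unfold Turing.haltList
  congr 1
  funext k
  by_cases h : k = tm.k₁
  · subst h; simp
  · simp [h]

/-- A function computed by a structured program in polynomial time is computable in polynomial
time by a Turing machine. -/
theorem polyTime_of_cmd {A : Type} [Finite A] {n : ℕ} (f : (Fin n → Word A) → Word A)
    {K : Type} [DecidableEq K] [Finite K] {Γ : K → Type} {σ : Type} [Finite σ] (p : Cmd Γ σ)
        (s₀ : σ)
    (k₀ k₁ : K) (e₀ : Γ k₀ ≃ Option A) (e₁ : Γ k₁ ≃ A) (T : Polynomial ℕ)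
    (h : ∀ w, p.Runs (T.eval (encodeTuple w).length) s₀
      (Function.update (fun _ => []) k₀ ((encodeTuple w).map e₀.symm)) s₀
      (Function.update (fun _ => []) k₁ ((f w).map e₁.symm))) : PolyTime f := by
  have := p.finite_lab
  let := Fintype.ofFinite K
  let := Fintype.ofFinite σ
  let := Fintype.ofFinite A
  let := Fintype.ofFinite p.Lab
  let : Fintype (Γ k₀) := Fintype.ofEquiv _ e₀.symm
  let M : Option p.Lab → Turing.TM2.Stmt Γ (Option p.Lab) σ := fun x =>
    x.elim .halt (p.code some none)
  let tm : Turing.FinTM2 :=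
    { K := K, k₀ := k₀, k₁ := k₁, Γ := Γ, Λ := Option p.Lab, main := some p.entry, σ := σ,
      initialState := s₀, m := M }
  have key : ∀ w, ∃ n ≤ T.eval (encodeTuple w).length + 1,
      (flip bind tm.step)^[n] (some (Turing.initList tm ((encodeTuple w).map e₀.symm))) =
        some (Turing.haltList tm ((f w).map e₁.symm)) := by
    intro w
    have h1 : TMReach M _ _ _ := (h w).tmReach some none fun a => rfl
    have h2 : TMReach M 1 ⟨some none, s₀, Function.update (fun _ => []) k₁ ((f w).map e₁.symm)⟩
      ⟨none, s₀, Function.update (fun _ => []) k₁ ((f w).map e₁.symm)⟩ := .single (by simp [M])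
    rw [initList_eq_update, haltList_eq_update]
    exact h1.trans h2
  exact ⟨⟨⟨tm, e₀, e₁⟩, T + 1, fun w => ⟨⟨(key w).choose, (key w).choose_spec.2⟩, by
    simpa using (key w).choose_spec.1⟩⟩⟩

/-! ### Word machines with subroutines -/

namespace WordMachine

open Turing (FinTM2 TM2ComputableAux)

/-- The stacks of a word machine: one for the output, word stacks `X`, and the stacks of the
machines used as subroutines. -/
inductive Stk {A : Type} (X : Type) {I : Type} (M : I → TM2ComputableAux (Option A) A) : Type
  | out
  | word (x : X)
  | sub (i : I) (k : (M i).tm.K)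

variable {A X I : Type} {M : I → TM2ComputableAux (Option A) A}

noncomputable instance : DecidableEq (Stk X M) := Classical.decEq _

instance [Finite X] [Finite I] : Finite (Stk X M) := by
  have (i : I) : Finite (M i).tm.K := have := (M i).tm.kFin; inferInstance
  refine Finite.of_injective
    (β := Option (X ⊕ Σ i, (M i).tm.K))
    (fun | .out => none | .word x => some (.inl x) | .sub i k => some (.inr ⟨i, k⟩)) ?_
  rintro (_ | _ | _) (_ | _ | _) h <;> simp_all

/-- The alphabets: word stacks hold letters and the end marker `none`. -/
@[reducible] def alph : Stk X M → Type
  | .out => A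
  | .word _ => Option A
  | .sub i k => (M i).tm.Γ k

/-- The control state of a word machine: two registers for symbols read, some flags, and the
control states and labels of the subroutines. -/
@[ext] structure Ctl {A I : Type} (M : I → TM2ComputableAux (Option A) A) where
  reg : Option (Option A)
  reg2 : Option (Option A)
  bit : Bool
  brk : Bool
  ord : Ordering
  sub : ∀ i, (M i).tm.σ × Option (M i).tm.Λ

instance : Finite Ordering :=
  Finite.of_surjective (fun n : Fin 3 => (![.lt, .eq, .gt] : Fin 3 → Ordering) n) <| by
    rintro (_ | _ | _)
    exacts [⟨0, rfl⟩, ⟨1, rfl⟩, ⟨2, rfl⟩]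

instance [Finite A] [Finite I] : Finite (Ctl M) := by
  have (i : I) : Finite (M i).tm.σ := have := (M i).tm.σFin; inferInstance
  have (i : I) : Finite (M i).tm.Λ := have := (M i).tm.ΛFin; inferInstance
  refine Finite.of_injective (fun s : Ctl M => (s.reg, s.reg2, s.bit, s.brk, s.ord, s.sub)) ?_
  intro s s' h
  simp only [Prod.mk.injEq] at h
  ext1
  exacts [h.1, h.2.1, h.2.2.1, h.2.2.2.1, h.2.2.2.2.1, h.2.2.2.2.2]

/-- Programs of a word machine. -/
abbrev WCmd (X : Type) (M : I → TM2ComputableAux (Option A) A) : Type 1 :=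
  Cmd (alph (X := X) (M := M)) (Ctl M)

/-- The contents of all stacks. -/
def stks (o : List A) (W : X → List (Option A)) (U : ∀ i k, List ((M i).tm.Γ k)) :
    ∀ k : Stk X M, List (alph k)
  | .out => o
  | .word x => W x
  | .sub i k => U i k

section

variable {o : List A} {W : X → List (Option A)} {U : ∀ i k, List ((M i).tm.Γ k)}

@[simp] theorem stks_out : stks o W U (.out : Stk X M) = o := rfl

@[simp] theorem stks_word (x : X) : stks o W U (.word x : Stk X M) = W x := rfl

@[simp] theorem stks_sub (i k) : stks o W U (.sub i k : Stk X M) = U i k := rfl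

theorem update_stks_out (v : List A) :
    Function.update (stks o W U) (.out : Stk X M) v = stks v W U := by
  funext k
  rcases k with _ | x | ⟨i, k⟩ <;> simp

theorem update_stks_word [DecidableEq X] (x : X) (v : List (Option A)) :
    Function.update (stks o W U) (.word x : Stk X M) v = stks o (Function.update W x v) U := by
  funext k
  rcases k with _ | y | ⟨i, k⟩
  · simp
  · by_cases h : y = x
    · subst h; simp
    · simp [h]
  · simp

theorem update_stks_sub [DecidableEq I] (i : I) (k : (M i).tm.K) (v : List ((M i).tm.Γ k)) :
    Function.update (stks o W U) (.sub i k : Stk X M) v =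
      stks o W (Function.update U i (Function.update (U i) k v)) := by
  funext k'
  rcases k' with _ | y | ⟨i', k'⟩
  · simp
  · simp
  · by_cases h : i' = i
    · subst h
      by_cases h : k' = k
      · subst h; simp
      · simp [h]
    · have : (Stk.sub i' k' : Stk X M) ≠ .sub i k := fun e => h (by cases e; rfl)
      simp [h, this]

end

open Cmd

/-! ### Scanning a stack -/

/-- Pop a symbol into the register. -/
def pull (k : Stk X M) (rd : alph k → Option A) : WCmd X M :=
  .pop k fun s o => { s with reg := o.map rd }

/-- Pop symbols from the stack `k` and run `body` on each of them, as long as `cont` holds of the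
symbol in the register. The symbol that ends the scan is removed as well. -/
def scan (k : Stk X M) (rd : alph k → Option A) (cont : Option (Option A) → Bool)
    (body : WCmd X M) : WCmd X M :=
  .seq (pull k rd) (.seq (.loop (fun s => cont s.reg) (.seq body (pull k rd)))
    (.load fun s => { s with reg := none }))

theorem runs_pull (k : Stk X M) (rd : alph k → Option A) (s : Ctl M) (S : ∀ k, List (alph k))
    (l : List (alph k)) :
    (pull k rd).Runs 1 s (Function.update S k l) { s with reg := l.head?.map rd }
      (Function.update S k l.tail) := by
  have := Runs.pop k (fun (s : Ctl M) o => { s with reg := o.map rd }) s (Function.update S k l)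
  simpa [pull] using this

/-- The rule for scans: `C l` and `F l` are the control state and the stacks once the symbols in `l`
are processed. -/
theorem runs_scan {k : Stk X M} {rd : alph k → Option A} {cont : Option (Option A) → Bool}
    {body : WCmd X M} {c : ℕ} (C : List (alph k) → Ctl M)
    (F : List (alph k) → ∀ k : Stk X M, List (alph k))
    (u rest : List (alph k))
    (hbody : ∀ l a r, a ∈ u → body.Runs c { C l with reg := some (rd a) }
      (Function.update (F l) k r) { C (l ++ [a]) with reg := some (rd a) }
      (Function.update (F (l ++ [a])) k r))
    (hu : ∀ a ∈ u, cont (some (rd a)) = true) (hrest : cont (rest.head?.map rd) = false) :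
    (scan k rd cont body).Runs ((c + 2) * u.length + 3) (C [])
      (Function.update (F []) k (u ++ rest)) { C u with reg := none }
      (Function.update (F u) k rest.tail) := by
  have key : ∀ v l, (∀ a ∈ v, a ∈ u) →
      (Cmd.loop (fun s : Ctl M => cont s.reg) (.seq body (pull k rd))).Runs ((c + 2) * v.length + 1)
      { C l with reg := (v ++ rest).head?.map rd } (Function.update (F l) k (v ++ rest).tail)
      { C (l ++ v) with reg := rest.head?.map rd } (Function.update (F (l ++ v)) k rest.tail) := by
    intro v
    induction v with
    | nil =>
      intro l hv
      simpa using Runs.loop_done (c := fun s : Ctl M => cont s.reg) (.seq body (pull k rd))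
        (Function.update (F l) k rest.tail) (s := { C l with reg := rest.head?.map rd }) hrest
    | cons a v ih =>
      intro l hv
      have h1 := hbody l a (v ++ rest) (hv a (by simp))
      have h2 := runs_pull k rd { C (l ++ [a]) with reg := some (rd a) } (F (l ++ [a])) (v ++ rest)
      have h3 := ih (l ++ [a]) fun b hb => hv b (by simp [hb])
      rw [List.append_assoc] at h3
      refine Runs.mono (Runs.loop_step ?_ (Runs.seq h1 h2) h3) ?_
      · exact hu a (hv a (by simp))
      · simp only [List.length_cons]; ring_nf; omega
  refine Runs.mono (Runs.seq (runs_pull k rd _ _ _) (Runs.seq (key u [] fun a h => h)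
    (Runs.load _ _ _))) ?_
  omega

/-- Is there a letter in the register? -/
def isLetter (r : Option (Option A)) : Bool := r.join.isSome

variable [DecidableEq X]

/-- Move the word on top of the stack `x` to the stack `y`, removing its end marker. This reverses
the word. -/
def xfer (x y : X) : WCmd X M :=
  scan (.word x) id isLetter (.push (.word y) fun s => s.reg.join)

theorem runs_xfer {x y : X} (hxy : x ≠ y) (s : Ctl M) (o W U) (w : Word A)
    (rest : List (Option A)) (hrest : rest.head?.join = none) (hx : W x = w.map some ++ rest) :
    (xfer x y).Runs (3 * w.length + 3) s (stks o W U) { s with reg := none }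
      (stks o (Function.update (Function.update W x rest.tail) y
          (w.reverse.map some ++ W y)) U) := by
  have := runs_scan (M := M) (X := X) (k := .word x) (rd := id) (cont := isLetter)
    (body := .push (.word y) fun s => s.reg.join) (c := 1) (fun _ => s)
    (fun l => stks o (Function.update W y (l.reverse ++ W y)) U) (w.map some) rest ?_ ?_ ?_
  · simp only [List.reverse_nil, List.nil_append, Function.update_eq_self, update_stks_word,
      List.length_map, ← hx] at this
    rw [Function.update_comm hxy, List.map_reverse]
    exact this
  · intro l a r ha
    obtain ⟨b, -, rfl⟩ := List.mem_map.1 ha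
    have := Runs.push (.word y : Stk X M) (fun s : Ctl M => s.reg.join)
      { s with reg := some (some b) }
      (Function.update (stks o (Function.update W y (l.reverse ++ W y)) U) (.word x) r)
    simp only [update_stks_word, stks_word, id_eq] at this ⊢
    convert this using 2
    rw [Function.update_comm hxy]
    simp [Function.update_of_ne hxy.symm]
  · simp [isLetter]
  · simp [isLetter, hrest]

/-- Move the word on top of the stack `x` to the stacks `y` and `z`, removing its end marker. -/
def xferTwo (x y z : X) : WCmd X M :=
  scan (.word x) id isLetter
    (.seq (.push (.word y) fun s => s.reg.join) (.push (.word z) fun s => s.reg.join))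

theorem runs_xferTwo {x y z : X} (hxy : x ≠ y) (hxz : x ≠ z) (hyz : y ≠ z) (s : Ctl M) (o W U)
    (w : Word A) (rest : List (Option A)) (hrest : rest.head?.join = none)
    (hx : W x = w.map some ++ rest) :
    (xferTwo x y z).Runs (4 * w.length + 3) s (stks o W U) { s with reg := none }
      (stks o (Function.update (Function.update (Function.update W x rest.tail) y
        (w.reverse.map some ++ W y)) z (w.reverse.map some ++ W z)) U) := by
  have := runs_scan (M := M) (X := X) (k := .word x) (rd := id) (cont := isLetter)
    (body := .seq (.push (.word y) fun s => s.reg.join) (.push (.word z) fun s => s.reg.join))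
    (c := 2) (fun _ => s) (fun l => stks o (Function.update
      (Function.update W y (l.reverse ++ W y)) z (l.reverse ++ W z)) U) (w.map some) rest ?_ ?_ ?_
  · simp only [List.reverse_nil, List.nil_append, Function.update_eq_self, update_stks_word,
      List.length_map, ← hx] at this
    rw [Function.update_comm hxy, Function.update_comm hxz, List.map_reverse]
    exact this
  · intro l a r ha
    obtain ⟨b, -, rfl⟩ := List.mem_map.1 ha
    have h1 := Runs.push (.word y : Stk X M) (fun s : Ctl M => s.reg.join)
      { s with reg := some (some b) }
      (Function.update (stks o (Function.update
        (Function.update W y (l.reverse ++ W y)) z (l.reverse ++ W z)) U) (.word x) r)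
    have h2 := Runs.seq h1 (Runs.push (.word z : Stk X M) (fun s : Ctl M => s.reg.join) _ _)
    simp only [update_stks_word, stks_word, id_eq] at h2 ⊢
    convert h2 using 2
    funext v
    by_cases hv : v = x
    · subst hv; simp [hxy, hxz]
    by_cases hv' : v = y
    · subst hv'; simp [hyz, hxy.symm]
    by_cases hv'' : v = z
    · subst hv''; simp [hyz.symm, hxz.symm]
    · simp [hv, hv', hv'']
  · simp [isLetter]
  · simp [isLetter, hrest]

/-- Remove the word on top of the stack `x` and its end marker. -/
def clear (x : X) : WCmd X M := scan (.word x) id isLetter (.load id)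

theorem runs_clear (x : X) (s : Ctl M) (o W U) (w : Word A) (rest : List (Option A))
    (hrest : rest.head?.join = none) (hx : W x = w.map some ++ rest) :
    (clear x).Runs (3 * w.length + 3) s (stks o W U) { s with reg := none }
      (stks o (Function.update W x rest.tail) U) := by
  have := runs_scan (M := M) (X := X) (k := .word x) (rd := id) (cont := isLetter)
    (body := .load id) (c := 1) (fun _ => s)
    (fun _ => stks o W U) (w.map some) rest (fun _ _ _ _ => Runs.load _ _ _) ?_ ?_
  · simp only [Function.update_eq_self, update_stks_word, List.length_map, ← hx] at this
    exact this
  · simp [isLetter]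
  · simp [isLetter, hrest]

/-- Move the word on the stack `x` to the output. -/
def emit [Alphabet A] (x : X) : WCmd X M :=
  scan (.word x) id isLetter (.push .out fun s => s.reg.join.getD Alphabet.zero)

theorem runs_emit [Alphabet A] (x : X) (s : Ctl M) (o W U) (w : Word A) (hx : W x = w.map some) :
    (emit x).Runs (3 * w.length + 3) s (stks o W U) { s with reg := none }
      (stks (w.reverse ++ o) (Function.update W x []) U) := by
  have := runs_scan (M := M) (X := X) (k := .word x) (rd := id) (cont := isLetter)
    (body := .push .out fun s => s.reg.join.getD Alphabet.zero) (c := 1) (fun _ => s)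
    (fun l => stks (l.reverse.map (fun a => a.getD Alphabet.zero) ++ o) W U) (w.map some) []
    ?_ ?_ ?_
  · simp only [update_stks_word, List.append_nil, ← hx] at this
    have e₁ : (W x).length = w.length := by simp [hx]
    have e₂ : (W x).reverse.map (fun a => a.getD Alphabet.zero) = w.reverse := by
      simp [hx, ← List.map_reverse, Function.comp_def]
    rw [e₁, e₂] at this
    simpa [emit] using this
  · intro l a r ha
    have := Runs.push (.out : Stk X M) (fun s : Ctl M => s.reg.join.getD Alphabet.zero)
      { s with reg := some a }
      (Function.update (stks (l.reverse.map (fun a => a.getD Alphabet.zero) ++ o) W U) (.word x) r)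
    simpa only [update_stks_word, update_stks_out, stks_out, id, Option.join_some,
      List.reverse_append, List.reverse_cons, List.reverse_nil, List.nil_append,
      List.singleton_append, List.map_cons, List.cons_append] using this
  · simp [isLetter]
  · simp [isLetter]

/-! ### Running a machine as a subroutine -/

section Subroutine

open Classical in
/-- Change the control state and label of the subroutine `i`. -/
noncomputable def Ctl.setSub (s : Ctl M) (i : I) (v : (M i).tm.σ × Option (M i).tm.Λ) : Ctl M :=
  { s with sub := Function.update s.sub i v }

@[simp] theorem Ctl.setSub_sub (s : Ctl M) (i : I) (v) : (s.setSub i v).sub i = v := by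
  simp [setSub]

@[simp] theorem Ctl.setSub_setSub (s : Ctl M) (i : I) (v v') :
    (s.setSub i v).setSub i v' = s.setSub i v' := by
  simp [setSub]

theorem Ctl.setSub_eq_self (s : Ctl M) (i : I) : s.setSub i (s.sub i) = s := by
  simp [setSub]

/-- The statement of a subroutine as a program. -/
noncomputable def subStmt (i : I) : Turing.TM2.Stmt (M i).tm.Γ (M i).tm.Λ (M i).tm.σ → WCmd X M
  | .push k f q => .seq (.push (.sub i k) fun s => f (s.sub i).1) (subStmt i q)
  | .peek k f q =>
      .seq (.peek (.sub i k) fun s o => s.setSub i (f (s.sub i).1 o, (s.sub i).2)) (subStmt i q)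
  | .pop k f q =>
      .seq (.pop (.sub i k) fun s o => s.setSub i (f (s.sub i).1 o, (s.sub i).2)) (subStmt i q)
  | .load f q => .seq (.load fun s => s.setSub i (f (s.sub i).1, (s.sub i).2)) (subStmt i q)
  | .branch f q q' => .ite (fun s => f (s.sub i).1) (subStmt i q) (subStmt i q')
  | .goto f => .load fun s => s.setSub i ((s.sub i).1, some (f (s.sub i).1))
  | .halt => .load fun s => s.setSub i ((s.sub i).1, none)

/-- A bound for the running time of `subStmt`. -/
def stmtCost {K Λ σ : Type} {Γ : K → Type} : Turing.TM2.Stmt Γ Λ σ → ℕ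
  | .push _ _ q => stmtCost q + 1
  | .peek _ _ q => stmtCost q + 1
  | .pop _ _ q => stmtCost q + 1
  | .load _ q => stmtCost q + 1
  | .branch _ q q' => stmtCost q + stmtCost q' + 1
  | .goto _ => 1
  | .halt => 1

omit [DecidableEq X] in
open Classical in
theorem runs_subStmt (i : I) (q : Turing.TM2.Stmt (M i).tm.Γ (M i).tm.Λ (M i).tm.σ) (s : Ctl M)
    (o : List A) (W : X → List (Option A)) (U : ∀ i k, List ((M i).tm.Γ k)) :
    (subStmt i q).Runs (stmtCost q) s (stks o W U)
      (s.setSub i ((Turing.TM2.stepAux q (s.sub i).1 (U i)).var,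
        (Turing.TM2.stepAux q (s.sub i).1 (U i)).l))
      (stks o W (Function.update U i (Turing.TM2.stepAux q (s.sub i).1 (U i)).stk)) := by
  induction q generalizing s U with
  | push k f q ih =>
    have h1 := Runs.push (.sub i k : Stk X M) (fun s : Ctl M => f (s.sub i).1) s (stks o W U)
    rw [update_stks_sub] at h1
    have h2 := Runs.seq h1 (ih s _)
    rw [add_comm] at h2
    simpa [subStmt, stmtCost] using h2
  | peek k f q ih =>
    have h1 := Runs.peek (.sub i k : Stk X M)
      (fun (s : Ctl M) o => s.setSub i (f (s.sub i).1 o, (s.sub i).2)) s (stks o W U)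
    have h2 := Runs.seq h1 (ih _ U)
    rw [add_comm] at h2
    simpa [subStmt, stmtCost] using h2
  | pop k f q ih =>
    have h1 := Runs.pop (.sub i k : Stk X M)
      (fun (s : Ctl M) o => s.setSub i (f (s.sub i).1 o, (s.sub i).2)) s (stks o W U)
    rw [update_stks_sub] at h1
    have h2 := Runs.seq h1 (ih _ _)
    rw [add_comm] at h2
    simpa [subStmt, stmtCost] using h2
  | load f q ih =>
    have h2 := Runs.seq (Runs.load (fun s : Ctl M => s.setSub i (f (s.sub i).1, (s.sub i).2)) s
      (stks o W U)) (ih _ U)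
    rw [add_comm] at h2
    simpa [subStmt, stmtCost] using h2
  | branch f q q' ih ih' =>
    refine Runs.ite ?_
    cases h : f (s.sub i).1
    · simpa [h] using (ih' s U).mono (Nat.le_add_left _ _)
    · simpa [h] using (ih s U).mono (Nat.le_add_right _ _)
  | goto f =>
    have h1 := Runs.load (fun s : Ctl M => s.setSub i ((s.sub i).1, some (f (s.sub i).1))) s
      (stks o W U)
    simpa [subStmt, stmtCost] using h1
  | halt =>
    have h1 := Runs.load (fun s : Ctl M => s.setSub i ((s.sub i).1, none)) s (stks o W U)
    simpa [subStmt, stmtCost] using h1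

/-- Run the subroutine `i` until it halts. -/
noncomputable def subLoop (i : I) : WCmd X M :=
  .loop (fun s => (s.sub i).2.isSome)
    (.switch (Option (M i).tm.Λ) (have := (M i).tm.ΛFin; inferInstance) (fun s => (s.sub i).2)
      fun l => l.elim (.load id) fun l => subStmt i ((M i).tm.m l))

/-- A bound for the time that one step of the subroutine `i` takes. -/
def stepCost (M : I → TM2ComputableAux (Option A) A) (i : I) : ℕ :=
  have := (M i).tm.ΛFin
  ∑ l, stmtCost ((M i).tm.m l)

omit [DecidableEq X] in
open Classical in
theorem runs_subLoop (i : I) (n : ℕ) (c c' : (M i).tm.Cfg)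
    (h : (flip bind (M i).tm.step)^[n] (some c) = some c') (hc' : c'.l = none) (s : Ctl M)
    (o : List A) (W : X → List (Option A)) (U : ∀ i k, List ((M i).tm.Γ k))
    (hs : s.sub i = (c.var, c.l)) (hU : U i = c.stk) :
    (subLoop i).Runs ((stepCost M i + 2) * n + 1) s (stks o W U) (s.setSub i (c'.var, none))
      (stks o W (Function.update U i c'.stk)) := by
  induction n generalizing c s U with
  | zero =>
    simp only [Function.iterate_zero, id_eq, Option.some.injEq] at h
    subst h
    rw [← hU, Function.update_eq_self, ← hc', ← hs, Ctl.setSub_eq_self]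
    exact Runs.loop_done _ _ (by simp [hs, hc'])
  | succ n ih =>
    rw [Function.iterate_succ_apply] at h
    obtain ⟨l, v, T⟩ := c
    rcases l with _ | l
    · have h0 : flip bind (M i).tm.step (some ⟨none, v, T⟩) = none := rfl
      rw [h0, Function.iterate_fixed rfl] at h
      exact absurd h (by simp)
    · have h0 : flip bind (M i).tm.step (some ⟨some l, v, T⟩) =
        some (Turing.TM2.stepAux ((M i).tm.m l) v T) := rfl
      rw [h0] at h
      simp only at hs hU
      have h1 := runs_subStmt i ((M i).tm.m l) s o W U
      rw [hs, hU] at h1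
      have h2 := ih _ h (s.setSub i ((Turing.TM2.stepAux ((M i).tm.m l) v T).var,
        (Turing.TM2.stepAux ((M i).tm.m l) v T).l)) (Function.update U i _) (by simp) (by simp; rfl)
      simp only [Ctl.setSub_setSub, Function.update_idem] at h2
      have h3 : (Cmd.switch (Option (M i).tm.Λ) (have := (M i).tm.ΛFin; inferInstance)
          (fun s : Ctl M => (s.sub i).2)
          fun l => l.elim (.load id) fun l => subStmt (X := X) i ((M i).tm.m l)).Runs
          (stmtCost ((M i).tm.m l) + 1) s (stks o W U) _ _ := Runs.switch (by
        simpa [hs] using h1)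
      refine Runs.mono (Runs.loop_step (by simp [hs]) h3 h2) ?_
      have h4 : stmtCost ((M i).tm.m l) ≤ stepCost M i := by
        let := (M i).tm.ΛFin
        exact Finset.single_le_sum (f := fun l => stmtCost ((M i).tm.m l))
            (fun _ _ => Nat.zero_le _)
          (Finset.mem_univ l)
      ring_nf
      omega

/-- The encoding of a list of words on a stack: every word is followed by the marker `none`. -/
def encWords (ws : List (Word A)) : List (Option A) := ws.flatMap fun u => u.map some ++ [none]

theorem encodeTuple_eq {n : ℕ} (w : Fin n → Word A) : encodeTuple w = encWords (List.ofFn w) := rfl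

@[simp] theorem encWords_nil : encWords ([] : List (Word A)) = [] := rfl

@[simp] theorem encWords_cons (u : Word A) (ws : List (Word A)) :
    encWords (u :: ws) = u.map some ++ none :: encWords ws := by
  simp [encWords]

/-- Move `k` words from the stack `x` to the stack `y`, reversing the stack content. -/
def xferWords (x y : X) : ℕ → WCmd X M
  | 0 => .load id
  | k + 1 => .seq (.seq (xfer x y) (.push (.word y) fun _ => none)) (xferWords x y k)

theorem runs_xferWords {x y : X} (hxy : x ≠ y) (ws : List (Word A)) (s : Ctl M) (hs : s.reg = none)
    (o W U) (rest : List (Option A)) (hx : W x = encWords ws ++ rest) :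
    (xferWords x y ws.length).Runs (4 * (encWords ws).length + 1) s (stks o W U) s
      (stks o (Function.update (Function.update W x rest) y ((encWords ws).reverse ++ W y)) U) := by
  induction ws generalizing W with
  | nil =>
    simp only [encWords_nil, List.nil_append] at hx
    subst hx
    simpa [xferWords] using Runs.load id s (stks (M := M) o W U)
  | cons u ws ih =>
    have hs' : ({ s with reg := none } : Ctl M) = s := by ext1 <;> simp [hs]
    have h1 := runs_xfer hxy s o W U u (none :: (encWords ws ++ rest)) (by simp) (by simp [hx])
    rw [hs'] at h1
    have h2 := Runs.seq h1 (Runs.push (.word y) (fun _ => none) s _)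
    rw [update_stks_word] at h2
    have h3 := Runs.seq h2 (ih _ (by simp [hxy]))
    refine Runs.mono ?_ (t := _) (?_ : 3 * u.length + 3 + 1 + (4 * (encWords ws).length + 1) ≤ _)
    · simp only [xferWords, List.length_cons]
      convert h3 using 2
      funext z
      by_cases hz : z = y
      · subst hz; simp
      by_cases hz' : z = x
      · subst hz'; simp [hxy]
      · simp [hz, hz']
    · simp only [encWords_cons, List.length_append, List.length_map, List.length_cons]
      omega

/-- Apply the function computed by the subroutine `i` to the `k` words on top of the stack `x`.
The stack `y` is used as intermediate storage. -/
noncomputable def call (k : ℕ) (i : I) (x y : X) : WCmd X M :=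
  .seq (xferWords x y k) <|
  .seq (scan (.word y) id Option.isSome
    (.push (.sub i (M i).tm.k₀) fun s => (M i).inputAlphabet.symm (s.reg.getD none))) <|
  .seq (.load fun s => s.setSub i ((M i).tm.initialState, some (M i).tm.main)) <|
  .seq (subLoop i) <|
  .seq (.push (.word x) fun _ => none) <|
  .seq (scan (.sub i (M i).tm.k₁) (fun a => some ((M i).outputAlphabet a)) isLetter
    (.push (.word y) fun s => s.reg.join)) <|
  xfer y x

/-- All subroutines are at rest. -/
def Ctl.Idle (s : Ctl M) : Prop :=
  s.reg = none ∧ ∀ i, s.sub i = ((M i).tm.initialState, none)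

theorem runs_call {x y : X} (hxy : x ≠ y) (i : I) (ws : List (Word A)) (v : Word A) (T : ℕ)
    (hT : Nonempty (Turing.TM2OutputsInTime (M i).tm ((encWords ws).map (M i).inputAlphabet.symm)
      (some (v.map (M i).outputAlphabet.symm)) T)) (s : Ctl M) (hs : s.Idle) (o : List A)
    (W : X → List (Option A)) (rest : List (Option A)) (hx : W x = encWords ws ++ rest)
    (hy : W y = []) :
    (call ws.length i x y).Runs
      (7 * (encWords ws).length + (stepCost M i + 2) * T + 6 * v.length + 20) s
      (stks o W fun _ _ => []) s
      (stks o (Function.update W x (v.map some ++ none :: rest)) fun _ _ => []) := by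
  classical
  obtain ⟨⟨⟨n, hn⟩, hnT⟩⟩ := hT
  have hs' : ({ s with reg := none } : Ctl M) = s := by ext1 <;> simp [hs.1]
  have h1 := runs_xferWords hxy ws s hs.1 o W (fun _ _ => []) rest hx
  rw [hy, List.append_nil] at h1
  -- feed the input
  have h2 := runs_scan (M := M) (X := X) (k := .word y) (rd := id) (cont := Option.isSome)
    (body := .push (.sub i (M i).tm.k₀) fun s => (M i).inputAlphabet.symm (s.reg.getD none))
    (c := 1) (fun _ => s) (fun l => stks o (Function.update W x rest) (Function.update
      (fun _ _ => []) i (Function.update (fun _ => []) (M i).tm.k₀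
        (l.reverse.map (M i).inputAlphabet.symm)))) (encWords ws).reverse [] ?_ ?_ ?_
  rotate_left
  · intro l a r ha
    have := Runs.push (.sub i (M i).tm.k₀ : Stk X M)
      (fun s : Ctl M => (M i).inputAlphabet.symm (s.reg.getD none)) { s with reg := some a }
      (Function.update (stks o (Function.update W x rest) (Function.update
      (fun _ _ => []) i (Function.update (fun _ => []) (M i).tm.k₀
        (l.reverse.map (M i).inputAlphabet.symm)))) (.word y) r)
    simpa [update_stks_word, update_stks_sub] using this
  · simp
  · simp
  simp only [update_stks_word, List.append_nil, hs', List.reverse_reverse, List.length_reverse,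
    List.tail_nil, List.reverse_nil, List.map_nil, Function.update_eq_self] at h2
  rw [initList_eq_update, Option.map_some, haltList_eq_update] at hn
  have h3 := Runs.load (fun s : Ctl M => s.setSub i ((M i).tm.initialState, some (M i).tm.main)) s
    (stks (X := X) (M := M) o (Function.update (Function.update W x rest) y [])
      (Function.update (fun _ _ => []) i
        (Function.update (fun _ => []) (M i).tm.k₀ ((encWords ws).map (M i).inputAlphabet.symm))))
  have h4 := runs_subLoop (X := X) i n _ _ hn rfl
    (s.setSub i ((M i).tm.initialState, some (M i).tm.main)) o
    (Function.update (Function.update W x rest) y []) (Function.update (fun _ _ => []) i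
        (Function.update (fun _ => []) (M i).tm.k₀ ((encWords ws).map (M i).inputAlphabet.symm)))
    (by simp) (by simp)
  simp only [Ctl.setSub_setSub, Function.update_idem] at h4
  rw [← hs.2 i, Ctl.setSub_eq_self] at h4
  have h5 := Runs.push (.word x : Stk X M) (fun _ => none) s (stks o
    (Function.update (Function.update W x rest) y [])
    (Function.update (fun _ _ => []) i (Function.update (fun _ => []) (M i).tm.k₁
      (v.map (M i).outputAlphabet.symm))))
  rw [update_stks_word] at h5
  -- fetch the output
  have h6 := runs_scan (M := M) (X := X) (k := .sub i (M i).tm.k₁)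
    (rd := fun a => some ((M i).outputAlphabet a)) (cont := isLetter)
    (body := .push (.word y) fun s => s.reg.join)
    (c := 1) (fun _ => s) (fun l => stks o (Function.update (Function.update W x (none :: rest)) y
      (l.reverse.map fun a => some ((M i).outputAlphabet a))) (fun _ _ => []))
    (v.map (M i).outputAlphabet.symm) [] ?_ ?_ ?_
  rotate_left
  · intro l a r ha
    have := Runs.push (.word y : Stk X M)
      (fun s : Ctl M => s.reg.join) { s with reg := some (some ((M i).outputAlphabet a)) }
      (Function.update (stks o (Function.update (Function.update W x (none :: rest)) y
      (l.reverse.map fun a => some ((M i).outputAlphabet a))) (fun _ _ => []))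
      (.sub i (M i).tm.k₁) r)
    simpa [update_stks_word, update_stks_sub] using this
  · simp [isLetter]
  · simp [isLetter]
  have h7 := runs_xfer hxy.symm s o (Function.update (Function.update W x (none :: rest)) y
      (v.reverse.map some)) (fun _ _ => []) v.reverse [] (by simp) (by simp)
  rw [hs'] at h7
  simp only [update_stks_sub, List.append_nil, hs', List.tail_nil, List.reverse_nil, List.map_nil,
    List.length_map] at h6
  have e₀ (k : (M i).tm.K) : Function.update (fun k => ([] : List ((M i).tm.Γ k))) k [] =
      fun _ => [] := Function.update_eq_self k _
  have e₁ (k : (M i).tm.K) : Function.update (fun i k => ([] : List ((M i).tm.Γ k))) i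
      (Function.update (fun _ => []) k []) = fun _ _ => [] := by
    rw [e₀]
    exact Function.update_eq_self i _
  rw [e₁] at h6
  have e₂ : (Function.update (Function.update (Function.update W x rest) y []) x (none :: rest)) =
      Function.update (Function.update W x (none :: rest)) y [] := by
    rw [Function.update_comm hxy.symm, Function.update_idem]
  have e₃ : (List.map (fun a => some ((M i).outputAlphabet a))
      (List.map (M i).outputAlphabet.symm v).reverse) = v.reverse.map some := by
    simp [← List.map_reverse]
  rw [stks_word, Function.update_of_ne hxy, Function.update_self, e₂] at h5
  rw [e₃] at h6
  have e₄ : Function.update W x (v.map some ++ none :: rest) =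
      (Function.update (Function.update (Function.update (Function.update W x (none :: rest)) y
        (v.reverse.map some)) y []) x (v.map some ++ none :: rest)) := by
    funext z
    by_cases hz : z = x
    · subst hz; simp
    by_cases hz' : z = y
    · subst hz'; simp [hz, hy]
    · simp [hz, hz']
  rw [List.reverse_reverse, Function.update_of_ne hxy, Function.update_self, List.tail_nil,
    ← e₄] at h7
  refine Runs.mono (Runs.seq h1 (Runs.seq h2 (Runs.seq h3 (Runs.seq h4 (Runs.seq h5
    (Runs.seq h6 h7)))))) ?_
  have h8 : (stepCost M i + 2) * n ≤ (stepCost M i + 2) * T := Nat.mul_le_mul_left _ hnT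
  simp only [List.length_reverse]
  omega

end Subroutine

end WordMachine

/-! ### The basic operators are computable in polynomial time -/

namespace WordMachine

open Cmd Turing

/-- A function computed by a word machine in polynomial time is computable in polynomial time by a
Turing machine. -/
theorem polyTime_of_wordMachine {A X I : Type} [Finite A] [Finite X] [Finite I] [DecidableEq X]
    {M : I → TM2ComputableAux (Option A) A} {n : ℕ} (f : (Fin n → Word A) → Word A) (p : WCmd X M)
    (s : Ctl M) (x : X) (T : Polynomial ℕ)
    (h : ∀ w, p.Runs (T.eval (encodeTuple w).length) s
      (stks [] (Function.update (fun _ => []) x (encodeTuple w)) fun _ _ => []) s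
      (stks (f w) (fun _ => []) fun _ _ => [])) : PolyTime f := by
  have e : stks (X := X) (M := M) [] (fun _ => []) (fun _ _ => []) = fun _ => [] := by
    funext k
    rcases k with _ | _ | _ <;> rfl
  refine polyTime_of_cmd f p s (.word x) .out (Equiv.refl _) (Equiv.refl _) T fun w => ?_
  rw [← e, update_stks_word, update_stks_out]
  simpa using h w

section Basic

variable {A : Type}

/-- No subroutines. -/
def noSub (A : Type) : Empty → TM2ComputableAux (Option A) A := Empty.elim

/-- A control state of a machine without subroutines. -/
def ct (r r' : Option (Option A)) (b : Bool) (c : Ordering) : Ctl (noSub A) :=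
  ⟨r, r', b, false, c, fun i => i.elim⟩

/-- The control state at rest. -/
def rest₀ (A : Type) : Ctl (noSub A) := ct none none false .eq

/-- The stacks of a machine for a basic operator. -/
def st3 (o : List A) (a b c : List (Option A)) : ∀ k : Stk (Fin 3) (noSub A), List (alph k) :=
  stks o ![a, b, c] fun _ _ => []

theorem update_vec0 {β : Type} (a b c v : β) : Function.update ![a, b, c] 0 v = ![v, b, c] := by
  funext i; fin_cases i <;> rfl

theorem update_vec1 {β : Type} (a b c v : β) : Function.update ![a, b, c] 1 v = ![a, v, c] := by
  funext i; fin_cases i <;> rfl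

theorem update_vec2 {β : Type} (a b c v : β) : Function.update ![a, b, c] 2 v = ![a, b, v] := by
  funext i; fin_cases i <;> rfl

/-- Programs of a machine for a basic operator. -/
abbrev Cmd3 (A : Type) : Type 1 := WCmd (Fin 3) (noSub A)

section Rules

variable {r r' : Option (Option A)} {b : Bool} {c : Ordering} {o : List A}
  {x y z : List (Option A)}

/-- Pop a symbol of a word stack into the first register. -/
def pullW (i : Fin 3) : Cmd3 A := pull (.word i) id

theorem runs_pull0 : (pullW 0).Runs 1 (ct r r' b c) (st3 o x y z) (ct x.head? r' b c)
    (st3 o x.tail y z) := by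
  have := runs_pull (.word 0 : Stk (Fin 3) (noSub A)) id (ct r r' b c) (st3 o x y z) x
  simp only [st3, update_stks_word, update_vec0, Option.map_id] at this
  exact this

theorem runs_pull1 : (pullW 1).Runs 1 (ct r r' b c) (st3 o x y z) (ct y.head? r' b c)
    (st3 o x y.tail z) := by
  have := runs_pull (.word 1 : Stk (Fin 3) (noSub A)) id (ct r r' b c) (st3 o x y z) y
  simp only [st3, update_stks_word, update_vec1, Option.map_id] at this
  exact this

theorem runs_pull2 : (pullW 2).Runs 1 (ct r r' b c) (st3 o x y z) (ct z.head? r' b c)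
    (st3 o x y z.tail) := by
  have := runs_pull (.word 2 : Stk (Fin 3) (noSub A)) id (ct r r' b c) (st3 o x y z) z
  simp only [st3, update_stks_word, update_vec2, Option.map_id] at this
  exact this

theorem runs_xfer01 {w : Word A} {v y' : List (Option A)} (hv : v.head?.join = none)
    (h : w.reverse.map some ++ y = y') :
    (xfer 0 1).Runs (3 * w.length + 3) (ct r r' b c) (st3 o (w.map some ++ v) y z)
      (ct none r' b c) (st3 o v.tail y' z) := by
  subst h
  have := runs_xfer (x := (0 : Fin 3)) (y := 1) (by decide) (ct r r' b c) o
    ![w.map some ++ v, y, z] (fun _ _ => []) w v hv rfl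
  rw [update_vec0, update_vec1] at this
  exact this

theorem runs_xfer02 {w : Word A} {v z' : List (Option A)} (hv : v.head?.join = none)
    (h : w.reverse.map some ++ z = z') :
    (xfer 0 2).Runs (3 * w.length + 3) (ct r r' b c) (st3 o (w.map some ++ v) y z)
      (ct none r' b c) (st3 o v.tail y z') := by
  subst h
  have := runs_xfer (x := (0 : Fin 3)) (y := 2) (by decide) (ct r r' b c) o
    ![w.map some ++ v, y, z] (fun _ _ => []) w v hv rfl
  rw [update_vec0, update_vec2] at this
  exact this

theorem runs_clear0 {w : Word A} {v : List (Option A)} (hv : v.head?.join = none) :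
    (clear 0).Runs (3 * w.length + 3) (ct r r' b c) (st3 o (w.map some ++ v) y z)
      (ct none r' b c) (st3 o v.tail y z) := by
  have := runs_clear (0 : Fin 3) (ct r r' b c) o ![w.map some ++ v, y, z] (fun _ _ => []) w v hv rfl
  rw [update_vec0] at this
  exact this

theorem runs_clear1 {w : Word A} : (clear 1).Runs (3 * w.length + 3) (ct r r' b c)
    (st3 o x (w.map some) z) (ct none r' b c) (st3 o x [] z) := by
  have := runs_clear (1 : Fin 3) (ct r r' b c) o ![x, w.map some, z] (fun _ _ => []) w [] rfl
    (List.append_nil _).symm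
  rw [update_vec1] at this
  exact this

theorem runs_clear2 {w : Word A} : (clear 2).Runs (3 * w.length + 3) (ct r r' b c)
    (st3 o x y (w.map some)) (ct none r' b c) (st3 o x y []) := by
  have := runs_clear (2 : Fin 3) (ct r r' b c) o ![x, y, w.map some] (fun _ _ => []) w [] rfl
    (List.append_nil _).symm
  rw [update_vec2] at this
  exact this

theorem runs_ite_true {d : Ctl (noSub A) → Bool} {p q : Cmd3 A} {t s S s' S'} (h : d s = true)
    (hp : p.Runs t s S s' S') : (Cmd.ite d p q).Runs (t + 1) s S s' S' :=
  Runs.ite (by simpa [h] using hp)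

theorem runs_ite_false {d : Ctl (noSub A) → Bool} {p q : Cmd3 A} {t s S s' S'} (h : d s = false)
    (hq : q.Runs t s S s' S') : (Cmd.ite d p q).Runs (t + 1) s S s' S' :=
  Runs.ite (by simpa [h] using hq)

theorem runs_out {f : Ctl (noSub A) → A} : (Cmd.push .out f).Runs 1 (ct r r' b c) (st3 o x y z)
    (ct r r' b c) (st3 (f (ct r r' b c) :: o) x y z) := by
  have := Runs.push (.out : Stk (Fin 3) (noSub A)) f (ct r r' b c) (st3 o x y z)
  simpa only [st3, update_stks_out, stks_out] using this

theorem runs_push1 {f : Ctl (noSub A) → Option A} : (Cmd.push (.word 1) f).Runs 1 (ct r r' b c)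
    (st3 o x y z) (ct r r' b c) (st3 o x (f (ct r r' b c) :: y) z) := by
  have := Runs.push (.word 1 : Stk (Fin 3) (noSub A)) f (ct r r' b c) (st3 o x y z)
  simp only [st3, update_stks_word, update_vec1] at this
  exact this

end Rules

/-- Write a fixed word to the output. -/
def writeOut : Word A → Cmd3 A
  | [] => .load id
  | a :: u => .seq (writeOut u) (.push .out fun _ => a)

theorem runs_writeOut (u : Word A) :
    (writeOut u).Runs (u.length + 1) (rest₀ A) (st3 [] [] [] []) (rest₀ A) (st3 u [] [] []) := by
  induction u with
  | nil => exact Runs.load _ _ _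
  | cons a u ih => exact Runs.seq ih runs_out

theorem encodeTuple_one (w : Fin 1 → Word A) : encodeTuple w = (w 0).map some ++ [none] := by
  simp [encodeTuple]

theorem encodeTuple_two (w : Fin 2 → Word A) :
    encodeTuple w = (w 0).map some ++ none :: ((w 1).map some ++ [none]) := by
  simp [encodeTuple, List.ofFn_succ]

variable [Alphabet A]

section Rules

variable {r r' : Option (Option A)} {b : Bool} {c : Ordering} {o : List A}
  {x y z : List (Option A)}

theorem runs_emit1 {w : Word A} : (emit 1).Runs (3 * w.length + 3) (ct r r' b c)
    (st3 o x (w.map some) z) (ct none r' b c) (st3 (w.reverse ++ o) x [] z) := by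
  have := runs_emit (1 : Fin 3) (ct r r' b c) o ![x, w.map some, z] (fun _ _ => []) w rfl
  rw [update_vec1] at this
  exact this

theorem runs_emit2 {w : Word A} : (emit 2).Runs (3 * w.length + 3) (ct r r' b c)
    (st3 o x y (w.map some)) (ct none r' b c) (st3 (w.reverse ++ o) x y []) := by
  have := runs_emit (2 : Fin 3) (ct r r' b c) o ![x, y, w.map some] (fun _ _ => []) w rfl
  rw [update_vec2] at this
  exact this

end Rules

/-- Word machines with a linear time bound. -/
theorem polyTime_of_linear {n : ℕ} (f : (Fin n → Word A) → Word A) (p : Cmd3 A)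
    (b c : ℕ) (h : ∀ w, p.Runs (b * (encodeTuple w).length + c) (rest₀ A)
      (st3 [] (encodeTuple w) [] []) (rest₀ A) (st3 (f w) [] [] [])) : PolyTime f := by
  refine polyTime_of_wordMachine f p (rest₀ A) (0 : Fin 3)
    (Polynomial.C b * Polynomial.X + Polynomial.C c) fun w => ?_
  have e : (fun _ => [] : Fin 3 → List (Option A)) = ![[], [], []] := by
    funext i; fin_cases i <;> rfl
  rw [e, update_vec0]
  simpa [st3] using h w

theorem polyTime_const (u : Word A) : PolyTime (fun _ : Fin 0 → Word A => u) :=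
  polyTime_of_linear _ (writeOut u) 0 (u.length + 1) fun w => (runs_writeOut u).mono (by simp)

theorem polyTime_hd : PolyTime (fun w : Fin 1 → Word A => (w 0).take 1) := by
  refine polyTime_of_linear _
    (.seq (pullW 0) (.seq (Cmd.ite (fun s => isLetter s.reg)
      (.push .out fun s => s.reg.join.getD Alphabet.zero) (.load id)) (clear 0))) 3 10 fun w => ?_
  rw [encodeTuple_one]
  rcases w 0 with _ | ⟨a, u⟩
  · exact (Runs.seq runs_pull0 (Runs.seq (runs_ite_false rfl (.load _ _ _))
      (runs_clear0 (w := []) (v := []) rfl))).mono (by simp)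
  · exact (Runs.seq runs_pull0 (Runs.seq (runs_ite_true rfl runs_out)
      (runs_clear0 (w := u) (v := [none]) rfl))).mono (by simp; omega)

theorem polyTime_tl : PolyTime (fun w : Fin 1 → Word A => (w 0).tail) := by
  refine polyTime_of_linear _ (.seq (pullW 0) (.seq (xfer 0 1) (emit 1))) 6 10 fun w => ?_
  rw [encodeTuple_one]
  rcases w 0 with _ | ⟨a, u⟩
  · exact (Runs.seq runs_pull0 (Runs.seq (runs_xfer01 (w := []) (v := []) rfl rfl)
      (runs_emit1 (w := [])))).mono (by simp)
  · have h := Runs.seq (runs_pull0 (c := .eq) (r := none) (r' := none) (b := false) (o := [])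
      (x := (a :: u).map some ++ [none]) (y := []) (z := [])) (Runs.seq
      (runs_xfer01 (w := u) (v := [none]) rfl (List.append_nil _)) (runs_emit1 (w := u.reverse)))
    rw [List.reverse_reverse, List.append_nil] at h
    exact h.mono (by simp; omega)

theorem polyTime_app : PolyTime (fun w : Fin 2 → Word A => appendChar (w 0) (w 1)) := by
  let letter : Ctl (noSub A) → Bool := fun s => isLetter s.reg
  refine polyTime_of_linear _ (.seq (xfer 0 1) <| .seq (xfer 0 2) <| .seq (pullW 2) <|
    Cmd.ite letter (.seq (.push (.word 1) fun s => s.reg.join) <| .seq (pullW 2) <|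
      Cmd.ite letter (.seq (clear 2) (clear 1)) (emit 1)) (clear 1)) 6 40 fun w => ?_
  rw [encodeTuple_two]
  generalize w 0 = u, w 1 = v
  have h := runs_xfer01 (r := none) (r' := none) (b := false) (c := .eq) (o := [])
      (w := u) (v := none :: (v.map some ++ [none])) (y := []) (z := []) rfl (List.append_nil _)
  have h' := runs_xfer02 (r := none) (r' := none) (b := false) (c := .eq) (o := [])
      (w := v) (v := [none]) (y := u.reverse.map some) (z := []) rfl (List.append_nil _)
  rcases hv : v.reverse with _ | ⟨a, _ | ⟨a', v'⟩⟩
  · obtain rfl : v = [] := by simpa using hv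
    exact (h.seq (h'.seq (runs_pull2.seq (runs_ite_false rfl runs_clear1)))).mono (by simp; omega)
  · rw [hv] at h'
    have h1 : (emit (1 : Fin 3)).Runs _ (ct none none false .eq) _ _ _ := runs_emit1
        (w := a :: u.reverse)
      (r := none) (r' := none) (b := false) (c := .eq) (o := []) (x := []) (z := [])
    have h2 := (h.seq (h'.seq (runs_pull2.seq (runs_ite_true (d := letter) (q := clear 1) rfl
        ((runs_push1 (f := fun s => s.reg.join)).seq (runs_pull2.seq
      (runs_ite_false (d := letter) (p := (.seq (clear 2) (clear 1))) rfl h1)))))))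
    obtain rfl : v = [a] := by simpa using hv
    have e : appendChar u [a] = (a :: u.reverse).reverse ++ [] := by simp [appendChar]
    rw [e]
    exact h2.mono (by simp; omega)
  · rw [hv] at h'
    have h2 := (h.seq (h'.seq (runs_pull2.seq (runs_ite_true (d := letter) (q := clear 1) rfl
        ((runs_push1 (f := fun s => s.reg.join)).seq (runs_pull2.seq
      (runs_ite_true (d := letter) (q := emit 1) rfl ((runs_clear2 (w := v')).seq (runs_clear1
          (w := a :: u.reverse))))))))))
    have hl : v.length = v'.length + 2 := by rw [← List.length_reverse, hv]; rfl
    have e : appendChar u v = [] := by simp [appendChar, hl]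
    rw [e]
    exact h2.mono (by simp; omega)

/-- The comparison of two words from right to left, where `c` is the result so far. -/
def scanCmp : Word A → Word A → Ordering → Ordering
  | [], [], c => c
  | [], _ :: _, _ => .lt
  | _ :: _, [], _ => .gt
  | a :: u, b :: v, c => scanCmp u v (if a < b then .lt else if b < a then .gt else c)

theorem scanCmp_of_lt {u v : Word A} (h : u.length < v.length) (c : Ordering) :
    scanCmp u v c = .lt := by
  induction u generalizing v c with
  | nil => cases v with
    | nil => simp at h
    | cons b v => rfl
  | cons a u ih => cases v with
    | nil => simp at h
    | cons b v => exact ih (by simpa using h) _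

theorem scanCmp_of_gt {u v : Word A} (h : v.length < u.length) (c : Ordering) :
    scanCmp u v c = .gt := by
  induction u generalizing v c with
  | nil => simp at h
  | cons a u ih => cases v with
    | nil => rfl
    | cons b v => exact ih (by simpa using h) _

theorem lex_concat {u v : Word A} (h : u.length = v.length) (a b : A) :
    List.Lex (· < ·) (u ++ [a]) (v ++ [b]) ↔ List.Lex (· < ·) u v ∨ u = v ∧ a < b := by
  induction u generalizing v with
  | nil => cases v with
    | nil => simp [List.lex_singleton_iff]
    | cons b v => simp at h
  | cons c u ih => cases v with
    | nil => simp at h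
    | cons d v =>
      have := ih (v := v) (by simpa using h)
      simp only [List.cons_append, List.cons_lex_cons_iff, this, List.cons.injEq]
      tauto

theorem scanCmp_of_eq {u v : Word A} (h : u.length = v.length) (c : Ordering) :
    (scanCmp u v c = .lt ↔ List.Lex (· < ·) u.reverse v.reverse ∨ u = v ∧ c = .lt) ∧
      (scanCmp u v c = .eq ↔ u = v ∧ c = .eq) := by
  induction u generalizing v c with
  | nil => cases v with
    | nil => simp [scanCmp]
    | cons b v => simp at h
  | cons a u ih => cases v with
    | nil => simp at h
    | cons b v =>
      have h' : u.length = v.length := by simpa using h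
      obtain ⟨h1, h2⟩ := ih h' (if a < b then .lt else if b < a then .gt else c)
      simp only [scanCmp, h1, h2, List.reverse_cons, List.cons.injEq]
      rw [lex_concat (by simpa using h')]
      rcases lt_trichotomy a b with hab | rfl | hab
      · simp [hab, hab.ne]
      · simp
      · simp [hab, hab.ne', hab.not_gt]

theorem scanCmp_reverse (u v : Word A) :
    (scanCmp u.reverse v.reverse .eq = .lt ↔ ShortlexLT u v) ∧
      (scanCmp u.reverse v.reverse .eq = .eq ↔ u = v) := by
  rcases lt_trichotomy u.length v.length with h | h | h
  · rw [scanCmp_of_lt (by simpa using h)]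
    simp only [ShortlexLT, List.shortlex_def, h]
    simp
    rintro rfl; simp at h
  · have := scanCmp_of_eq (u := u.reverse) (v := v.reverse) (by simpa using h) .eq
    simpa [ShortlexLT, List.shortlex_def, h] using this
  · rw [scanCmp_of_gt (by simpa using h)]
    simp only [ShortlexLT, List.shortlex_def]
    constructor
    · simp; omega
    · simp; rintro rfl; simp at h

/-- Take the letters in the two registers into account. -/
def cmpStep (s : Ctl (noSub A)) : Ordering :=
  let a := s.reg.join.getD Alphabet.zero
  let b := s.reg2.join.getD Alphabet.zero
  if a < b then .lt else if b < a then .gt else s.ord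

/-- The loop that compares two reversed words. -/
def cmpLoop : Cmd3 A :=
  .loop (fun s => isLetter s.reg && isLetter s.reg2)
    (.seq (.load fun s => { s with ord := cmpStep s })
      (.seq (pullW 1) (.pop (.word 2) fun s o => { s with reg2 := o })))

omit [Alphabet A] in
theorem runs_pull2' {r r' : Option (Option A)} {b : Bool} {c : Ordering} {o : List A}
    {x y z : List (Option A)} :
    (Cmd.pop (.word 2) fun s o => { s with reg2 := o } : Cmd3 A).Runs 1 (ct r r' b c) (st3 o x y z)
      (ct r z.head? b c) (st3 o x y z.tail) := by
  have := Runs.pop (.word 2 : Stk (Fin 3) (noSub A)) (fun s o => { s with reg2 := o })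
    (ct r r' b c) (st3 o x y z)
  simp only [st3, update_stks_word, update_vec2] at this
  exact this

theorem runs_cmpLoop (u v : Word A) (c : Ordering) :
    ∃ (r r' : Option (Option A)) (c' : Ordering) (u' v' : Word A),
    cmpLoop.Runs (4 * u.length + 1)
      (ct (u.map some).head? (v.map some).head? false c)
      (st3 [] [] (u.map some).tail (v.map some).tail) (ct r r' false c')
      (st3 [] [] (u'.map some) (v'.map some)) ∧ u'.length ≤ u.length ∧ v'.length ≤ v.length ∧
      (if isLetter r then .gt else if isLetter r' then .lt else c') = scanCmp u v c := by
  induction u generalizing v c with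
  | nil =>
    refine ⟨none, (v.map some).head?, c, [], v.tail, ?_, by simp, by simp, ?_⟩
    · rw [List.map_tail]
      exact Runs.loop_done _ _ (by simp [ct, isLetter])
    · cases v <;> simp [isLetter, scanCmp]
  | cons a u ih =>
    cases v with
    | nil =>
      refine ⟨some (some a), none, c, u, [], ?_, by simp, by simp, ?_⟩
      · exact Runs.mono (Runs.loop_done _ _ (by simp [ct, isLetter])) (Nat.le_add_left _ _)
      · simp [isLetter, scanCmp]
    | cons b v =>
      obtain ⟨r, r', c', u', v', h, hu, hv, hc⟩ := ih v (if a < b then .lt else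
        if b < a then .gt else c)
      refine ⟨r, r', c', u', v', Runs.mono (Runs.loop_step rfl
        (Runs.seq (Runs.load _ _ _) (Runs.seq runs_pull1 runs_pull2')) h) ?_, ?_, ?_, hc⟩
      · simp; omega
      · simp; omega
      · simp; omega

/-- The relations on words that are determined by the comparison of words. -/
theorem polyTime_cmp (P : Ordering → Bool) : PolyTime (fun w : Fin 2 → Word A =>
    if P (scanCmp (w 0).reverse (w 1).reverse .eq) then tt1 else ff0) := by
  refine polyTime_of_linear _ (.seq (xfer 0 1) <| .seq (xfer 0 2) <| .seq (pullW 1) <|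
    .seq (.pop (.word 2) fun s o => { s with reg2 := o }) <| .seq cmpLoop <|
    .seq (.push .out fun s => if P (if isLetter s.reg then .gt else if isLetter s.reg2 then .lt else
      s.ord) then Alphabet.one else Alphabet.zero) <|
    .seq (clear 1) <| .seq (clear 2) (.load fun _ => rest₀ A)) 20 40 fun w => ?_
  rw [encodeTuple_two]
  generalize w 0 = u, w 1 = v
  have h := runs_xfer01 (r := none) (r' := none) (b := false) (c := .eq) (o := [])
      (w := u) (v := none :: (v.map some ++ [none])) (y := []) (z := []) rfl (List.append_nil _)
  have h' := runs_xfer02 (r := none) (r' := none) (b := false) (c := .eq) (o := [])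
      (w := v) (v := [none]) (y := u.reverse.map some) (z := []) rfl (List.append_nil _)
  obtain ⟨r, r', c', u', v', h2, hu, hv, hc⟩ := runs_cmpLoop u.reverse v.reverse .eq
  have h3 := h.seq (h'.seq (runs_pull1.seq (runs_pull2'.seq (h2.seq ((runs_out
    (f := fun s => if P (if isLetter s.reg then .gt else if isLetter s.reg2 then .lt else
      s.ord) then Alphabet.one else Alphabet.zero)).seq
    ((runs_clear1 (w := u')).seq ((runs_clear2 (w := v')).seq (Runs.load
        (fun _ => rest₀ A) _ _))))))))
  have e : (if P (scanCmp u.reverse v.reverse .eq) then tt1 else ff0) =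
    [if P (if isLetter r then .gt else if isLetter r' then .lt else c') then Alphabet.one else
      (Alphabet.zero : A)] := by
    rw [hc]
    split_ifs <;> rfl
  rw [e]
  refine h3.mono ?_
  simp only [List.length_reverse] at hu hv
  simp
  omega

theorem ofProp_eq_ite {p : Prop} {b : Bool} (h : p ↔ b = true) :
    (ofProp p : Word A) = if b then tt1 else ff0 := by
  cases b <;> simp_all [ofProp]

theorem polyTime_eq : PolyTime (fun w : Fin 2 → Word A => ofProp (w 0 = w 1)) := by
  convert polyTime_cmp (A := A) (fun c => c == .eq) using 2 with w
  exact ofProp_eq_ite (by rw [beq_iff_eq, (scanCmp_reverse (w 0) (w 1)).2])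

theorem polyTime_le : PolyTime (fun w : Fin 2 → Word A => ofProp (ShortlexLE (w 0) (w 1))) := by
  convert polyTime_cmp (A := A) (fun c => c == .eq || c == .lt) using 2 with w
  exact ofProp_eq_ite (by rw [Bool.or_eq_true, beq_iff_eq, beq_iff_eq,
    (scanCmp_reverse (w 0) (w 1)).2, (scanCmp_reverse (w 0) (w 1)).1, ShortlexLE])

theorem eq_unary_iff {w : Word A} : w = unary w.length ↔ w.all (· = Alphabet.one) = true := by
  rw [unary, List.eq_replicate_length]
  simp

/-- Reverse the input and check that it is a unary number. -/
theorem polyTime_decr : PolyTime (fun w : Fin 1 → Word A => decr (w 0)) := by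
  refine polyTime_of_linear _ (.seq (.load fun s => { s with bit := true }) <|
    .seq (scan (.word 0) id isLetter (.seq (.push (.word 2) fun s => s.reg.join)
      (.load fun s => { s with bit := s.bit && decide (s.reg.join = some Alphabet.one) }))) <|
    .seq (Cmd.ite (fun s => s.bit) (.seq (pullW 2) (emit 2)) (clear 2))
      (.load fun _ => rest₀ A)) 10 40 fun w => ?_
  rw [encodeTuple_one]
  generalize w 0 = u
  have h := runs_scan (M := noSub A) (X := Fin 3) (k := .word 0) (rd := id) (cont := isLetter)
    (body := .seq (.push (.word 2) fun s => s.reg.join)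
      (.load fun s => { s with bit := s.bit && decide (s.reg.join = some Alphabet.one) }))
    (c := 2) (fun l => ct none none (l.all (· = some Alphabet.one)) .eq)
    (fun l => st3 [] [] [] l.reverse) (u.map some) [none] ?_ ?_ ?_
  rotate_left
  · intro l a r ha
    obtain ⟨b, -, rfl⟩ := List.mem_map.1 ha
    have h1 := Runs.push (.word 2 : Stk (Fin 3) (noSub A)) (fun s => s.reg.join)
      (ct (some (some b)) none (l.all (· = some Alphabet.one)) .eq) (st3 [] r [] l.reverse)
    have h2 := h1.seq (Runs.load
      (fun s => { s with bit := s.bit && decide (s.reg.join = some Alphabet.one) }) _ _)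
    simp only [st3, update_stks_word, update_vec2, update_vec0, id_eq] at h2 ⊢
    have e : (l ++ [some b]).all (· = some Alphabet.one) =
      (l.all (· = some Alphabet.one) && decide (some b = some Alphabet.one)) := by simp
    rw [e, List.reverse_append]
    exact h2
  · simp [isLetter]
  · simp [isLetter]
  simp only [st3, update_stks_word, update_vec0, List.length_map, ← List.map_reverse] at h
  have h0 := Runs.load (fun s : Ctl (noSub A) => { s with bit := true }) (rest₀ A)
    (st3 [] (u.map some ++ [none]) [] [])
  by_cases hu : u = unary u.length
  · have e : (u.map some).all (· = some Alphabet.one) = true := by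
      have := eq_unary_iff.1 hu
      simpa using this
    rw [e] at h
    have h3 := runs_emit2 (r := (u.reverse.map some).head?) (r' := none) (b := true) (c := .eq)
      (o := []) (x := []) (y := []) (w := u.reverse.tail)
    rw [List.map_tail] at h3
    have h2 := h0.seq (h.seq ((runs_ite_true (d := fun s => s.bit) (q := clear 2) rfl
      (runs_pull2.seq h3)).seq (Runs.load (fun _ => rest₀ A) _ _)))
    have e' : decr u = u.reverse.tail.reverse ++ [] := by
      rw [decr, if_pos hu]
      conv_rhs => rw [hu]
      simp [unary]
    rw [e']
    exact h2.mono (by simp; omega)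
  · have e : (u.map some).all (· = some Alphabet.one) = false := by
      have := mt eq_unary_iff.2 hu
      simpa using this
    rw [e] at h
    have h2 := h0.seq (h.seq ((runs_ite_false (d := fun s => s.bit)
      (p := .seq (pullW 2) (emit 2)) rfl
      (runs_clear2 (w := u.reverse))).seq (Runs.load (fun _ => rest₀ A) _ _)))
    have e' : decr u = [] := by rw [decr, if_neg hu]
    rw [e']
    exact h2.mono (by simp; omega)

end Basic

end WordMachine

/-! ### Evaluation -/

section Evaluation

variable {A : Type} [Alphabet A] {O : ExtraOps A} {V : Type} [DecidableEq V]

theorem Exec.det {μ μ₁ μ₂ : Store A V} {s : Stmt O V} {b₁ b₂ : ExitFlag} (h₁ : Exec μ s b₁ μ₁)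
    (h₂ : Exec μ s b₂ μ₂) : b₁ = b₂ ∧ μ₁ = μ₂ := by
  induction h₁ generalizing b₂ μ₂ with
  | skip μ => cases h₂; exact ⟨rfl, rfl⟩
  | assign μ x e => cases h₂; exact ⟨rfl, rfl⟩
  | seq_go h h' ih ih' =>
    cases h₂ with
    | seq_go k k' => obtain ⟨-, rfl⟩ := ih k; exact ih' k'
    | seq_broken k => exact absurd (ih k).1 (by simp)
  | seq_broken h ih =>
    cases h₂ with
    | seq_go k k' => exact absurd (ih k).1 (by simp)
    | seq_broken k => exact ih k
  | ite_true h h' ih =>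
    cases h₂ with
    | ite_true k k' => exact ih k'
    | ite_false k k' => exact absurd h k
  | ite_false h h' ih =>
    cases h₂ with
    | ite_true k k' => exact absurd k h
    | ite_false k k' => exact ih k'
  | loop_false h =>
    cases h₂ with
    | loop_false k => exact ⟨rfl, rfl⟩
    | loop_true k k' => exact absurd k h
  | loop_true h h' ih =>
    cases h₂ with
    | loop_false k => exact absurd h k
    | loop_true k k' => exact ⟨rfl, (ih k').2⟩
  | brk_false h =>
    cases h₂ with
    | brk_false k => exact ⟨rfl, rfl⟩
    | brk_true k => exact absurd k h
  | brk_true h =>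
    cases h₂ with
    | brk_false k => exact absurd h k
    | brk_true k => exact ⟨rfl, rfl⟩

theorem Exec.eq_of_notMem_vars {μ μ' : Store A V} {s : Stmt O V} {b : ExitFlag} {x : V}
    (h : Exec μ s b μ') (hx : x ∉ s.vars) : μ' x = μ x := by
  induction h with
  | skip μ => rfl
  | assign μ y e =>
    simp only [Stmt.vars, Finset.mem_union, Finset.mem_singleton, not_or] at hx
    exact Function.update_of_ne hx.1 _ _
  | seq_go h h' ih ih' =>
    simp only [Stmt.vars, Finset.mem_union, not_or] at hx
    rw [ih' hx.2, ih hx.1]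
  | seq_broken h ih =>
    simp only [Stmt.vars, Finset.mem_union, not_or] at hx
    exact ih hx.1
  | ite_true h h' ih =>
    simp only [Stmt.vars, Finset.mem_union, not_or] at hx
    exact ih hx.1.2
  | ite_false h h' ih =>
    simp only [Stmt.vars, Finset.mem_union, not_or] at hx
    exact ih hx.2
  | loop_false h => rfl
  | loop_true h h' ih =>
    refine ih ?_
    simp only [Stmt.vars, Finset.mem_union, not_or] at hx ⊢
    exact ⟨hx.2, hx⟩
  | brk_false h => rfl
  | brk_true h => rfl

/-- One complete iteration of the loop with guard `e` and body `s`. -/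
def LoopStep (e : Expr O V) (s : Stmt O V) (μ ν : Store A V) : Prop :=
  e.eval μ = tt1 ∧ Exec μ s .go ν

theorem exec_loop_iff {e : Expr O V} {s : Stmt O V} {μ μ' : Store A V} {b : ExitFlag} :
    Exec μ (.loop e s) b μ' ↔ b = .go ∧ ∃ ν, Relation.ReflTransGen (LoopStep e s) μ ν ∧
      (e.eval ν ≠ tt1 ∧ μ' = ν ∨ e.eval ν = tt1 ∧ Exec ν s .broken μ') := by
  constructor
  · intro h0
    have key : ∀ t, Exec μ t b μ' →
        (t = .loop e s → b = .go ∧ ∃ ν, Relation.ReflTransGen (LoopStep e s) μ ν ∧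
          (e.eval ν ≠ tt1 ∧ μ' = ν ∨ e.eval ν = tt1 ∧ Exec ν s .broken μ')) ∧
        (e.eval μ = tt1 → t = .seq s (.loop e s) →
          ∃ ν, Relation.ReflTransGen (LoopStep e s) μ ν ∧
          (e.eval ν ≠ tt1 ∧ μ' = ν ∨ e.eval ν = tt1 ∧ Exec ν s .broken μ')) := by
      intro t ht
      clear h0
      induction ht with
      | seq_go h h' ih ih' =>
        refine ⟨by simp, fun he ht => ?_⟩
        simp only [Stmt.seq.injEq] at ht
        obtain ⟨rfl, rfl⟩ := ht
        obtain ⟨-, ν, hν, h2⟩ := ih'.1 rfl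
        exact ⟨ν, .head ⟨he, h⟩ hν, h2⟩
      | seq_broken h ih =>
        refine ⟨by simp, fun he ht => ?_⟩
        simp only [Stmt.seq.injEq] at ht
        obtain ⟨rfl, rfl⟩ := ht
        exact ⟨_, .refl, .inr ⟨he, h⟩⟩
      | loop_false h =>
        refine ⟨fun ht => ?_, by simp⟩
        simp only [Stmt.loop.injEq] at ht
        obtain ⟨rfl, rfl⟩ := ht
        exact ⟨rfl, _, .refl, .inl ⟨h, rfl⟩⟩
      | loop_true h h' ih =>
        refine ⟨fun ht => ?_, by simp⟩
        simp only [Stmt.loop.injEq] at ht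
        obtain ⟨rfl, rfl⟩ := ht
        exact ⟨rfl, ih.2 h rfl⟩
      | _ => exact ⟨by simp, by simp⟩
    exact (key _ h0).1 rfl
  · rintro ⟨rfl, ν, hν, h⟩
    induction hν using Relation.ReflTransGen.head_induction_on with
    | refl =>
      rcases h with ⟨h, rfl⟩ | ⟨h, h'⟩
      · exact .loop_false h
      · exact .loop_true h (.seq_broken h')
    | head h1 h2 ih => exact .loop_true h1.1 (.seq_go h1.2 ih)

end Evaluation

/-! ### The loops of for-programs -/

section ForLoops

variable {A : Type} [Alphabet A] {O : ExtraOps A} {V : Type} [DecidableEq V]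

/-- Every loop has the form of the while loop in `for x = e to d { s }`. In contrast to
`Stmt.IsFor`, this property is inherited by all configurations of an evaluation tree. -/
def Stmt.ForLoops (B : Set (Expr O V)) : Stmt O V → Prop
  | .skip => True
  | .assign _ _ => True
  | .seq s₁ s₂ => s₁.ForLoops B ∧ s₂.ForLoops B
  | .ite _ s₁ s₀ => s₁.ForLoops B ∧ s₀.ForLoops B
  | .loop g t => t.ForLoops B ∧
      ∃ x e s, e ∈ B ∧ x ∉ s.vars ∧ g = geExpr x e ∧ t = .seq s (decrStmt x)
  | .brk _ => True

omit [Alphabet A] in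
theorem Stmt.IsFor.forLoops {B : Set (Expr O V)} {s : Stmt O V} (h : s.IsFor B) :
    s.ForLoops B := by
  induction h with
  | skip => trivial
  | assign x e => trivial
  | seq h₁ h₂ ih₁ ih₂ => exact ⟨ih₁, ih₂⟩
  | ite e h₁ h₂ ih₁ ih₂ => exact ⟨ih₁, ih₂⟩
  | brk e => trivial
  | @for_loop x e d s he hx hs ih => exact ⟨trivial, ⟨ih, trivial⟩, x, e, s, he, hx, rfl, rfl⟩

theorem length_decr_lt {w : Word A} (h : w ≠ []) : (decr w).length < w.length := by
  have := List.length_pos_of_ne_nil h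
  unfold decr
  split_ifs
  · simp [unary]; omega
  · simpa

theorem ofProp_eq_tt1 {p : Prop} : (ofProp p : Word A) = tt1 ↔ p := by
  unfold ofProp
  split_ifs with h
  · simp [h]
  · simp [h, ff0, tt1, Alphabet.zero_ne_one]

omit [DecidableEq V] in
theorem eval_geExpr {x : V} {e : Expr O V} {μ : Store A V} :
    (geExpr x e).eval μ = tt1 ↔ ShortlexLE (e.eval μ) (μ x) :=
  ofProp_eq_tt1 (A := A)

omit [DecidableEq V] in
theorem ne_nil_of_geExpr {x : V} {e : Expr O V} {μ : Store A V} (he : e.eval μ ≠ [])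
    (h : (geExpr x e).eval μ = tt1) : μ x ≠ [] := by
  rcases eval_geExpr.1 h with h | h
  · rwa [← h]
  · intro h0
    rw [h0] at h
    exact List.not_shortlex_nil_right h

/-- Each iteration of a for loop makes the counter shorter. -/
theorem length_lt_of_forStep {x : V} {e : Expr O V} {s : Stmt O V} {μ ν : Store A V}
    (he : e.eval μ ≠ []) (hx : x ∉ s.vars)
    (h : LoopStep (geExpr x e) (.seq s (decrStmt x)) μ ν) : (ν x).length < (μ x).length := by
  obtain ⟨h1, h2⟩ := h
  cases h2 with
  | seq_go k k' =>
    have hk := k.eq_of_notMem_vars hx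
    have hν : ν x = decr (μ x) := by
      cases k'
      simp only [Function.update_self, Expr.eval]
      rw [← hk]
      rfl
    rw [hν]
    exact length_decr_lt (ne_nil_of_geExpr he h1)

end ForLoops

/-! ### For-programs are aperiodic -/

section Aperiodicity

variable {A : Type} [Alphabet A] {O : ExtraOps A} {V : Type} [DecidableEq V]

/-- The nesting depth of loops. -/
def Stmt.depth : Stmt O V → ℕ
  | .skip => 0
  | .assign _ _ => 0
  | .seq s₁ s₂ => max s₁.depth s₂.depth
  | .ite _ s₁ s₀ => max s₁.depth s₀.depth
  | .loop _ s => s.depth + 1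
  | .brk _ => 0

theorem Child.depth_le {c c' : Store A V × Stmt O V} (h : Child c c') : c'.2.depth ≤ c.2.depth := by
  cases h <;> simp [Stmt.depth]

theorem Child.forLoops {B : Set (Expr O V)} {c c' : Store A V × Stmt O V} (h : Child c c')
    (hc : c.2.ForLoops B) : c'.2.ForLoops B := by
  cases h with
  | seq_left => exact hc.1
  | seq_right => exact hc.2
  | ite_true => exact hc.1
  | ite_false => exact hc.2
  | loop => exact ⟨hc.1, hc⟩

theorem forLoops_of_child {B : Set (Expr O V)} {c c' : Store A V × Stmt O V}
    (h : Relation.ReflTransGen Child c c') (hc : c.2.ForLoops B) : c'.2.ForLoops B := by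
  induction h with
  | refl => exact hc
  | tail _ h ih => exact h.forLoops ih

/-- Below a loop of a for-program, the loop is met only with a shorter counter. -/
theorem length_lt_of_child {B : Set (Expr O V)} (hB : ∀ e ∈ B, ∀ μ : Store A V, e.eval μ ≠ [])
    {x : V} {e : Expr O V} {s : Stmt O V} (he : e ∈ B) (hx : x ∉ s.vars) {μ ν : Store A V}
    (h : Relation.TransGen Child (μ, .loop (geExpr x e) (.seq s (decrStmt x)))
      (ν, .loop (geExpr x e) (.seq s (decrStmt x)))) : (ν x).length < (μ x).length := by
  set g := geExpr x e
  set t := Stmt.seq s (decrStmt x)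
  -- the configurations below the loop: at the start of the body, at a later round of the loop, or
  -- inside the body, where the loop does not occur
  let Inv : Store A V × Stmt O V → Prop := fun c =>
    (c.2 = .seq t (.loop g t) ∧ g.eval c.1 = tt1 ∧ (c.1 x).length ≤ (μ x).length) ∨
    (c.2 = .loop g t ∧ (c.1 x).length < (μ x).length) ∨ c.2.depth < (Stmt.loop g t).depth
  have step : ∀ c c', Inv c → Child c c' → Inv c' := by
    rintro c c' (⟨h1, h2, h3⟩ | ⟨h1, h2⟩ | h1) hc
    · obtain ⟨μ', t'⟩ := c
      obtain rfl : t' = _ := h1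
      cases hc with
      | seq_left => exact .inr (.inr (by simp [Stmt.depth]))
      | seq_right _ k =>
        have := length_lt_of_forStep (hB e he μ') hx ⟨h2, k⟩
        exact .inr (.inl ⟨rfl, this.trans_le h3⟩)
    · obtain ⟨μ', t'⟩ := c
      obtain rfl : t' = _ := h1
      cases hc with
      | loop _ k => exact .inl ⟨rfl, k, h2.le⟩
    · exact .inr (.inr (hc.depth_le.trans_lt h1))
  have key : ∀ c, Relation.TransGen Child (μ, .loop g t) c → Inv c := by
    intro c hc
    induction hc with
    | single hc =>
      cases hc with
      | loop _ k => exact .inl ⟨rfl, k, le_rfl⟩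
    | tail _ hc ih => exact step _ _ ih hc
  rcases key _ h with ⟨h1, -⟩ | ⟨-, h1⟩ | h1
  · simp at h1
  · exact h1
  · exact absurd h1 (lt_irrefl _)

/-- For-programs are aperiodic: a loop met again below itself has a shorter counter, and the
counter is an undeclassified variable of the guard. -/
theorem Program.IsFor.aperiodic {B : Set (Expr O V)}
    (hB : ∀ e ∈ B, ∀ μ : Store A V, e.eval μ ≠ []) {n : ℕ} {P : Program O V n} (hP : P.IsFor B) :
    P.Aperiodic := by
  rintro μ ⟨μ', μ'', g, t, h1, h2, h3⟩
  obtain ⟨-, x, e, s, he, hx, rfl, rfl⟩ := forLoops_of_child h1 (Stmt.IsFor.forLoops hP)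
  have h4 := length_lt_of_child hB he hx h2
  have hx' : x ∈ (geExpr x e).undeclassified :=
    Finset.mem_biUnion.2 ⟨(1 : Fin 2), Finset.mem_univ _, Finset.mem_singleton_self x⟩
  rw [h3 x hx'] at h4
  exact lt_irrefl _ h4

end Aperiodicity

/-! ### Growth of stores under typed statements -/

section Growth

open Polynomial (C X)

theorem Polynomial.eval_le_eval (P : Polynomial ℕ) {a b : ℕ} (h : a ≤ b) :
    P.eval a ≤ P.eval b := by
  induction P using Polynomial.induction_on' with
  | add p q hp hq => simpa using add_le_add hp hq
  | monomial n c => simpa using Nat.mul_le_mul_left c (Nat.pow_le_pow_left h n)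

variable {A : Type} {V : Type}

/-- The maximal length of the values of the variables of level at least `r`, and at least `1` so
that it also bounds the lengths of Boolean values. -/
noncomputable def VarEnv.size (Γ : VarEnv V) (r : ℕ) (μ : Store A V) : ℕ :=
  max 1 ((Γ.finite_dom.toFinset.filter fun x => ∃ τ, Γ.level x = some τ ∧ r ≤ τ).sup
    fun x => (μ x).length)

namespace VarEnv

variable {Γ : VarEnv V} {r : ℕ} {μ : Store A V}

theorem size_le_iff {n : ℕ} : Γ.size r μ ≤ n ↔
    1 ≤ n ∧ ∀ x τ, Γ.level x = some τ → r ≤ τ → (μ x).length ≤ n := by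
  simp only [size, max_le_iff, Finset.sup_le_iff, Finset.mem_filter, Set.Finite.mem_toFinset,
    Set.mem_ofPred_eq, and_imp]
  refine and_congr_right fun _ => ⟨fun h x τ hx hr => h x (by simp [hx]) ⟨τ, hx, hr⟩, ?_⟩
  rintro h x - ⟨τ, hx, hr⟩
  exact h x τ hx hr

theorem one_le_size : 1 ≤ Γ.size r μ := le_max_left _ _

theorem length_le_size {x : V} {τ : ℕ} (hx : Γ.level x = some τ) (hr : r ≤ τ) :
    (μ x).length ≤ Γ.size r μ :=
  (size_le_iff.1 le_rfl).2 x τ hx hr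

theorem size_anti {r' : ℕ} (h : r ≤ r') : Γ.size r' μ ≤ Γ.size r μ :=
  size_le_iff.2 ⟨one_le_size, fun _ _ hx hr => length_le_size hx (h.trans hr)⟩

theorem size_update_le [DecidableEq V] {x : V} {w : Word A} {n : ℕ} (h : Γ.size r μ ≤ n)
    (hw : ∀ τ, Γ.level x = some τ → r ≤ τ → w.length ≤ n) :
    Γ.size r (Function.update μ x w) ≤ n := by
  refine size_le_iff.2 ⟨one_le_size.trans h, fun y τ hy hr => ?_⟩
  by_cases hyx : y = x
  · subst hyx
    rw [Function.update_self]
    exact hw τ hy hr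
  · rw [Function.update_of_ne hyx]
    exact (length_le_size hy hr).trans h

end VarEnv

variable [Alphabet A] {O : ExtraOps A} {Γ : VarEnv V} {Δ : OpEnv O}

omit [Alphabet A] in
theorem OpEnv.mem_dom {o : O.Op} {l m : ℕ} {p : (Fin (O.arity o) → ℕ) × ℕ}
    (h : p ∈ Δ.typ o l m) : o ∈ Δ.dom :=
  ⟨l, m, p, h⟩

theorem isNeutral_le : IsNeutral (O.denote (.inl .le)) := by
  classical
  refine .inl fun w => ?_
  change ofProp _ = ff0 ∨ ofProp _ = tt1
  unfold ofProp
  split_ifs <;> simp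

theorem IsNeutral.length_le {k : ℕ} {f : (Fin k → Word A) → Word A} (hf : IsNeutral f) :
    (∀ w, (f w).length ≤ 1) ∨ ∃ i, ∀ w, (f w).length ≤ (w i).length := by
  rcases hf with h | ⟨i, h⟩
  · refine .inl fun w => ?_
    rcases h w with h | h <;> simp [h, ff0, tt1]
  · exact .inr ⟨i, fun w => (h w).length_le⟩

/-- Values of high level are never larger than the variables of high level: only neutral operators
can be applied. -/
theorem ExprTy.length_le_size (hΔ : Δ.Safe) {l m τ : ℕ} {e : Expr O V} (he : ExprTy Γ Δ l m e τ)
    (hl : 1 ≤ l) (hlm : l ≤ m) {r : ℕ} (hr : l ≤ r) (hrτ : r ≤ τ) (μ : Store A V) :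
    (e.eval μ).length ≤ Γ.size r μ := by
  induction he with
  | var hx => exact VarEnv.length_le_size hx hrτ
  | @op o args a τ ho _ ih =>
    obtain ⟨h0, -, h⟩ := hΔ o (OpEnv.mem_dom ho)
    obtain ⟨h1, h2, h3⟩ := h l m a τ ho
    have hn : IsNeutral (O.denote o) := by
      by_contra hn
      have hp : ¬ IsPositive (O.denote o) := fun hp => by
        rcases (h2 hp hn).2 with h | h <;> omega
      rcases h0 with h0 | h0 | h0
      · exact hn h0
      · exact hp h0
      · have := h3 h0 hp
        omega
    rcases hn.length_le with h | ⟨i, h⟩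
    · exact (h _).trans VarEnv.one_le_size
    · exact (h _).trans (ih i (hrτ.trans (h1 hn i)))
  | declass _ _ _ h ih₁ ih₂ =>
    have := ih₂ (hrτ.trans h)
    simp only [Expr.eval, unary, List.length_replicate]
    exact (min_le_right _ _).trans this

/-- Inside loops, values exceed the variables of at least the same level by a constant at most. -/
theorem ExprTy.exists_length_le_size_add (hΔ : Δ.Safe) {l m τ : ℕ} {e : Expr O V}
    (he : ExprTy Γ Δ l m e τ) (hm : 1 ≤ m) :
    ∃ c, ∀ r ≤ τ, ∀ μ : Store A V, (e.eval μ).length ≤ Γ.size r μ + c := by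
  induction he with
  | var hx => exact ⟨0, fun r hr μ => VarEnv.length_le_size hx hr⟩
  | @op o args a τ ho _ ih =>
    obtain ⟨h0, -, h⟩ := hΔ o (OpEnv.mem_dom ho)
    obtain ⟨h1, h2, h3⟩ := h l m a τ ho
    choose c hc using ih
    by_cases hn : IsNeutral (O.denote o)
    · rcases hn.length_le with h | ⟨i, h⟩
      · exact ⟨0, fun r _ μ => (h _).trans VarEnv.one_le_size⟩
      · exact ⟨c i, fun r hr μ => (h _).trans (hc i r (hr.trans (h1 hn i)) μ)⟩
    · have hp : IsPositive (O.denote o) := by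
        by_contra hp
        have := h3 ((h0.resolve_left hn).resolve_left hp) hp
        omega
      have h2 := (h2 hp hn).1
      obtain ⟨d, hd⟩ := hp
      refine ⟨Finset.univ.sup c + d, fun r hr μ => (hd _).trans ?_⟩
      rw [← add_assoc]
      refine Nat.add_le_add_right (Finset.sup_le fun i _ => ?_) _
      exact (hc i r (hr.trans (h2 i)) μ).trans
        (Nat.add_le_add_left (Finset.le_sup (Finset.mem_univ i)) _)
  | declass _ _ _ h ih₁ ih₂ =>
    obtain ⟨c, hc⟩ := ih₂
    refine ⟨c, fun r hr μ => ?_⟩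
    have := hc r (hr.trans h) μ
    simp only [Expr.eval, unary, List.length_replicate]
    exact (min_le_right _ _).trans this

/-- Everywhere, also outside all loops, values have polynomial length in the size of the store. -/
theorem ExprTy.exists_length_le (hΔ : Δ.Safe) {l m τ : ℕ} {e : Expr O V}
    (he : ExprTy Γ Δ l m e τ) :
    ∃ P : Polynomial ℕ, ∀ μ : Store A V, (e.eval μ).length ≤ P.eval (Γ.size 0 μ) := by
  induction he with
  | var hx => exact ⟨X, fun μ => by
      simpa [Expr.eval] using VarEnv.length_le_size hx (Nat.zero_le _)⟩
  | @op o args a τ ho _ ih =>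
    obtain ⟨h0, -, -⟩ := hΔ o (OpEnv.mem_dom ho)
    choose P hP using ih
    have key : ∀ μ : Store A V, (Finset.univ.sup fun i => ((args i).eval μ).length) ≤
        (∑ i, P i).eval (Γ.size 0 μ) := fun μ => by
      refine Finset.sup_le fun i _ => (hP i μ).trans ?_
      rw [Polynomial.eval_finsetSum]
      exact Finset.single_le_sum (f := fun i => (P i).eval (Γ.size 0 μ))
        (fun _ _ => Nat.zero_le _) (Finset.mem_univ i)
    rcases h0 with h0 | ⟨c, h0⟩ | ⟨Q, h0⟩
    · rcases h0.length_le with h | ⟨i, h⟩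
      · exact ⟨C 1, fun μ => by simpa [Expr.eval] using h _⟩
      · exact ⟨P i, fun μ => (h _).trans (hP i μ)⟩
    · refine ⟨∑ i, P i + C c, fun μ => (h0 _).trans ?_⟩
      rw [Polynomial.eval_add, Polynomial.eval_C]
      exact Nat.add_le_add_right (key μ) _
    · refine ⟨Q.comp (∑ i, P i), fun μ => (h0 _).trans ?_⟩
      rw [Polynomial.eval_comp]
      exact Q.eval_le_eval (key μ)
  | declass _ _ _ h ih₁ ih₂ =>
    obtain ⟨P, hP⟩ := ih₂
    refine ⟨P, fun μ => ?_⟩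
    simp only [Expr.eval, unary, List.length_replicate]
    exact (min_le_right _ _).trans (hP μ)

/-- The counter of a for loop has at least the level of the loop. -/
theorem ExprTy.le_level_of_geExpr (hΔ : Δ.Safe) {l m τ : ℕ} {x : V} {e : Expr O V}
    (h : ExprTy Γ Δ l m (geExpr x e) τ) : ∃ τ', Γ.level x = some τ' ∧ τ ≤ τ' := by
  cases h with
  | @op _ _ a _ ho h =>
    have h1 := ((hΔ _ (OpEnv.mem_dom ho)).2.2 l m a τ ho).1 isNeutral_le (1 : Fin 2)
    have h2 : ExprTy Γ Δ l m (.var x) (a (1 : Fin 2)) := h (1 : Fin 2)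
    cases h2 with
    | var hx => exact ⟨_, hx, h1⟩

variable [DecidableEq V]

/-- Inside loops, statements do not increase the variables of at least their own level. -/
theorem StmtTy.size_le (hΔ : Δ.Safe) {l m τ : ℕ} {s : Stmt O V} (hs : StmtTy Γ Δ l m s τ)
    (hl : 1 ≤ l) (hlm : l ≤ m) {r : ℕ} (hr : l ≤ r) (hrτ : τ ≤ r) {μ μ' : Store A V}
    {b : ExitFlag} (h : Exec μ s b μ') : Γ.size r μ' ≤ Γ.size r μ := by
  induction hs generalizing r μ μ' b with
  | sub _ h1 ih => exact ih hl hlm hr (h1.trans hrτ) h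
  | skip => cases h; rfl
  | @assign l m x e τ₁ τ₂ hx he h1 =>
    cases h
    refine VarEnv.size_update_le le_rfl fun τ hτ hr' => ?_
    rw [hx, Option.some.injEq] at hτ
    refine he.length_le_size hΔ hl hlm hr ?_ μ
    omega
  | seq _ _ ih₁ ih₂ =>
    cases h with
    | seq_go h h' => exact (ih₂ hl hlm hr hrτ h').trans (ih₁ hl hlm hr hrτ h)
    | seq_broken h => exact ih₁ hl hlm hr hrτ h
  | ite _ _ _ ih₁ ih₂ =>
    cases h with
    | ite_true _ h => exact ih₁ hl hlm hr hrτ h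
    | ite_false _ h => exact ih₂ hl hlm hr hrτ h
  | @inner_loop l m e s τ _ _ h1 h2 ih =>
    obtain ⟨-, ν, hν, h⟩ := exec_loop_iff.1 h
    have key : Γ.size r ν ≤ Γ.size r μ := by
      clear h
      induction hν with
      | refl => rfl
      | tail _ h' ih' => exact (ih h1 h2 hrτ hrτ h'.2).trans ih'
    rcases h with ⟨-, rfl⟩ | ⟨-, h⟩
    · exact key
    · exact (ih h1 h2 hrτ hrτ h).trans key
  | outer_loop => omega
  | brk => cases h <;> rfl

/-- A for loop with a body under which variables of level `r` grow by an amount depending on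
those of level above `r` only: the iterations are bounded by a counter of level above `r`. -/
theorem exists_size_le_of_loop {B : Set (Expr O V)}
    (hB : ∀ e ∈ B, ∀ μ : Store A V, e.eval μ ≠ []) {m τ : ℕ} (hΔ : Δ.Safe) {e : Expr O V}
    {s : Stmt O V} (hL : (Stmt.loop e s).ForLoops B) (he : ExprTy Γ Δ τ m e τ)
    (hs : StmtTy Γ Δ τ m s τ) (hτ : 1 ≤ τ) (hτm : τ ≤ m)
    (hG : ∀ r, ∃ G : Polynomial ℕ, ∀ (μ μ' : Store A V) b, Exec μ s b μ' →
      Γ.size r μ' ≤ Γ.size r μ + G.eval (Γ.size (r + 1) μ)) (r : ℕ) :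
    ∃ G : Polynomial ℕ, ∀ μ ν : Store A V, Relation.ReflTransGen (LoopStep e s) μ ν →
      Γ.size r ν ≤ Γ.size r μ + G.eval (Γ.size (r + 1) μ) ∧
      ∀ μ', Exec ν s .broken μ' → Γ.size r μ' ≤ Γ.size r μ + G.eval (Γ.size (r + 1) μ) := by
  obtain ⟨x, hxs, τ', hx, hττ'⟩ : ∃ x, (∀ μ ν : Store A V, LoopStep e s μ ν →
      (ν x).length < (μ x).length) ∧ ∃ τ', Γ.level x = some τ' ∧ τ ≤ τ' := by
    obtain ⟨-, x, e', s', he', hx', rfl, rfl⟩ := hL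
    exact ⟨x, fun μ ν h => length_lt_of_forStep (hB e' he' μ) hx' h, he.le_level_of_geExpr hΔ⟩
  by_cases hr : τ ≤ r
  · have key : ∀ μ ν : Store A V, Relation.ReflTransGen (LoopStep e s) μ ν →
        Γ.size r ν ≤ Γ.size r μ := fun μ ν h => by
      induction h with
      | refl => rfl
      | tail _ h ih => exact (hs.size_le hΔ hτ hτm hr hr h.2).trans ih
    refine ⟨0, fun μ ν h => ⟨by simpa using key μ ν h, fun μ' h' => ?_⟩⟩
    simpa using (hs.size_le hΔ hτ hτm hr hr h').trans (key μ ν h)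
  -- downward induction on `r`
  · obtain ⟨H, hH⟩ := exists_size_le_of_loop hB hΔ hL he hs hτ hτm hG (r + 1)
    obtain ⟨g, hg⟩ := hG r
    refine ⟨(X + 1) * g.comp (X + H), fun μ ν h => ?_⟩
    -- `b` bounds the growth in a single iteration
    set b := (g.comp (X + H)).eval (Γ.size (r + 1) μ) with hb
    have hgb : ∀ ν, Relation.ReflTransGen (LoopStep e s) μ ν →
        g.eval (Γ.size (r + 1) ν) ≤ b := fun ν h => by
      rw [hb, Polynomial.eval_comp]
      refine g.eval_le_eval (((hH μ ν h).1).trans ?_)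
      simp only [Polynomial.eval_add, Polynomial.eval_X]
      exact Nat.add_le_add_left (H.eval_le_eval (VarEnv.size_anti (Nat.le_succ _))) _
    -- each iteration may add `b`, at the expense of a letter of the counter
    have key : Γ.size r ν + (ν x).length * b ≤ Γ.size r μ + (μ x).length * b := by
      induction h with
      | refl => rfl
      | @tail ν ν' h h' ih =>
        have h1 := hg ν ν' _ h'.2
        have h2 := hgb ν h
        have h3 := Nat.mul_le_mul_right b (hxs ν ν' h')
        rw [Nat.succ_mul] at h3
        omega
    have hμx : (μ x).length * b ≤ Γ.size (r + 1) μ * b :=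
      Nat.mul_le_mul_right _ (VarEnv.length_le_size hx (by omega))
    have hG : ((X + 1) * g.comp (X + H)).eval (Γ.size (r + 1) μ) = Γ.size (r + 1) μ * b + b := by
      rw [Polynomial.eval_mul, ← hb]
      simp only [Polynomial.eval_add, Polynomial.eval_X, Polynomial.eval_one]
      ring
    rw [hG]
    refine ⟨by omega, fun μ' h' => ?_⟩
    have h1 := hg ν μ' _ h'
    have h2 := hgb ν h
    omega
termination_by τ - r

/-- Inside loops, the variables of level `r` grow by a polynomial in those of level above `r`. -/
theorem StmtTy.exists_size_le {B : Set (Expr O V)}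
    (hB : ∀ e ∈ B, ∀ μ : Store A V, e.eval μ ≠ []) (hΔ : Δ.Safe) {l m τ : ℕ} {s : Stmt O V}
    (hs : StmtTy Γ Δ l m s τ) (hL : s.ForLoops B) (hl : 1 ≤ l) (hlm : l ≤ m) (r : ℕ) :
    ∃ G : Polynomial ℕ, ∀ (μ μ' : Store A V) b, Exec μ s b μ' →
      Γ.size r μ' ≤ Γ.size r μ + G.eval (Γ.size (r + 1) μ) := by
  induction hs generalizing r with
  | sub _ _ ih => exact ih hL hl hlm r
  | skip => exact ⟨0, fun μ μ' b h => by cases h; simp⟩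
  | @assign l m x e τ₁ τ₂ hx he h1 =>
    obtain ⟨c, hc⟩ := he.exists_length_le_size_add hΔ (hl.trans hlm)
    refine ⟨C c, fun μ μ' b h => ?_⟩
    cases h
    rw [Polynomial.eval_C]
    refine VarEnv.size_update_le (Nat.le_add_right _ _) fun τ hτ hr' => ?_
    rw [hx, Option.some.injEq] at hτ
    exact hc r (by omega) μ
  | seq _ _ ih₁ ih₂ =>
    obtain ⟨G₁, h₁⟩ := ih₁ hL.1 hl hlm r
    obtain ⟨H₁, h₁'⟩ := ih₁ hL.1 hl hlm (r + 1)
    obtain ⟨G₂, h₂⟩ := ih₂ hL.2 hl hlm r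
    refine ⟨G₁ + G₂.comp (X + H₁), fun μ μ' b h => ?_⟩
    rw [Polynomial.eval_add, Polynomial.eval_comp]
    cases h with
    | @seq_go _ ν _ _ _ _ h h' =>
      have k1 := h₁ _ _ _ h
      have k2 := h₂ _ _ _ h'
      have k3 : G₂.eval (Γ.size (r + 1) ν) ≤ G₂.eval ((X + H₁).eval (Γ.size (r + 1) μ)) := by
        refine G₂.eval_le_eval ((h₁' _ _ _ h).trans ?_)
        simp only [Polynomial.eval_add, Polynomial.eval_X]
        exact Nat.add_le_add_left (H₁.eval_le_eval (VarEnv.size_anti (Nat.le_succ _))) _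
      omega
    | seq_broken h =>
      have k1 := h₁ _ _ _ h
      omega
  | ite _ _ _ ih₁ ih₂ =>
    obtain ⟨G₁, h₁⟩ := ih₁ hL.1 hl hlm r
    obtain ⟨G₂, h₂⟩ := ih₂ hL.2 hl hlm r
    refine ⟨G₁ + G₂, fun μ μ' b h => ?_⟩
    rw [Polynomial.eval_add]
    cases h with
    | ite_true _ h => exact (h₁ _ _ _ h).trans (by omega)
    | ite_false _ h => exact (h₂ _ _ _ h).trans (by omega)
  | @inner_loop l m e s τ he hs h1 h2 ih =>
    obtain ⟨G, hG⟩ := exists_size_le_of_loop hB hΔ hL he hs h1 h2 (ih hL.1 h1 h2) r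
    refine ⟨G, fun μ μ' b h => ?_⟩
    obtain ⟨-, ν, hν, h⟩ := exec_loop_iff.1 h
    rcases h with ⟨-, rfl⟩ | ⟨-, h⟩
    · exact (hG _ _ hν).1
    · exact (hG _ _ hν).2 _ h
  | outer_loop => omega
  | brk => exact ⟨0, fun μ μ' b h => by cases h <;> simp⟩

end Growth

/-! ### Stores on the stacks of a word machine -/

namespace WordMachine

open Cmd Turing

/-- The word stacks of a compiled program: one for each variable in `Xs`, a stack for the values of
expressions, two auxiliary stacks, and the input. -/
inductive Reg {V : Type} (Xs : Finset V) : Type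
  | var (x : Xs)
  | ev
  | aux
  | aux2
  | inp
  deriving DecidableEq

instance {V : Type} (Xs : Finset V) : Finite (Reg Xs) := by
  refine Finite.of_surjective (fun p : Xs ⊕ Fin 4 => match p with
    | .inl x => Reg.var x
    | .inr n => (![.ev, .aux, .aux2, .inp] : Fin 4 → Reg Xs) n) ?_
  rintro (x | _ | _ | _ | _)
  exacts [⟨.inl x, rfl⟩, ⟨.inr 0, rfl⟩, ⟨.inr 1, rfl⟩, ⟨.inr 2, rfl⟩, ⟨.inr 3, rfl⟩]

section Layout

variable {A V : Type} {Xs : Finset V}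

/-- The word stacks that represent the store `μ`, with given contents of the other stacks. -/
def lay (μ : Store A V) (E a b R : List (Option A)) : Reg Xs → List (Option A)
  | .var x => (μ x).map some
  | .ev => E
  | .aux => a
  | .aux2 => b
  | .inp => R

variable {μ : Store A V} {E a b R v : List (Option A)}

@[simp] theorem lay_var (x : Xs) : lay μ E a b R (.var x) = (μ x).map some := rfl
@[simp] theorem lay_ev : lay μ E a b R (.ev : Reg Xs) = E := rfl
@[simp] theorem lay_aux : lay μ E a b R (.aux : Reg Xs) = a := rfl
@[simp] theorem lay_aux2 : lay μ E a b R (.aux2 : Reg Xs) = b := rfl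
@[simp] theorem lay_inp : lay μ E a b R (.inp : Reg Xs) = R := rfl

variable [DecidableEq V]

@[simp] theorem update_lay_ev :
    Function.update (lay μ E a b R) (.ev : Reg Xs) v = lay μ v a b R := by
  funext r; rcases r with _ | _ | _ | _ | _ <;> simp

@[simp] theorem update_lay_aux :
    Function.update (lay μ E a b R) (.aux : Reg Xs) v = lay μ E v b R := by
  funext r; rcases r with _ | _ | _ | _ | _ <;> simp

@[simp] theorem update_lay_aux2 :
    Function.update (lay μ E a b R) (.aux2 : Reg Xs) v = lay μ E a v R := by
  funext r; rcases r with _ | _ | _ | _ | _ <;> simp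

@[simp] theorem update_lay_inp :
    Function.update (lay μ E a b R) (.inp : Reg Xs) v = lay μ E a b v := by
  funext r; rcases r with _ | _ | _ | _ | _ <;> simp

theorem update_lay_var (x : Xs) (w : Word A) :
    Function.update (lay μ E a b R) (.var x : Reg Xs) (w.map some) =
      lay (Function.update μ x w) E a b R := by
  funext r
  rcases r with y | _ | _ | _ | _
  · by_cases h : y = x
    · subst h; simp
    · have : (y : V) ≠ x := fun e => h (Subtype.ext e)
      simp [h, this]
  all_goals simp

end Layout

variable {A V : Type} [Alphabet A] [DecidableEq V] {Xs : Finset V} {I : Type}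
  {M : I → TM2ComputableAux (Option A) A}

/-- The control state of a compiled program: `b` is the outcome of the last test, and `k` tells
whether a break was taken. -/
def ctl (b k : Bool) : Ctl M := ⟨none, none, b, k, .eq, fun _ => (FinTM2.initialState _, none)⟩

/-- The stacks of a compiled program. -/
def mem (μ : Store A V) (E a b R : List (Option A)) : ∀ k : Stk (Reg Xs) M, List (alph k) :=
  stks [] (lay μ E a b R) fun _ _ => []

section Rules

variable {μ : Store A V} {E a a' R : List (Option A)} {b k : Bool}

omit [Alphabet A] in
theorem runs_push_ev (f : Ctl M → Option A) (s : Ctl M) :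
    (Cmd.push (.word .ev) f : WCmd (Reg Xs) M).Runs 1 s (mem μ E a a' R) s
      (mem μ (f s :: E) a a' R) := by
  have := Runs.push (.word .ev : Stk (Reg Xs) M) f s (mem μ E a a' R)
  simpa only [mem, update_stks_word, update_lay_ev, stks_word, lay_ev] using this

omit [Alphabet A] in
theorem runs_pull_aux (s : Ctl M) :
    (pull (.word .aux) id : WCmd (Reg Xs) M).Runs 1 s (mem μ E a a' R) { s with reg := a.head? }
      (mem μ E a.tail a' R) := by
  have := runs_pull (.word .aux : Stk (Reg Xs) M) id s (mem μ E a a' R) a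
  simpa only [mem, update_stks_word, update_lay_aux, stks_word, lay_aux, Option.map_id,
      id_eq] using this

omit [Alphabet A] in
theorem runs_pull_aux2 (s : Ctl M) :
    (pull (.word .aux2) id : WCmd (Reg Xs) M).Runs 1 s (mem μ E a a' R) { s with reg := a'.head? }
      (mem μ E a a'.tail R) := by
  have := runs_pull (.word .aux2 : Stk (Reg Xs) M) id s (mem μ E a a' R) a'
  simpa only [mem, update_stks_word, update_lay_aux2, stks_word, lay_aux2, Option.map_id,
      id_eq] using this

omit [Alphabet A] in
theorem runs_xfer_ev_aux (w : Word A) :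
    (xfer .ev .aux : WCmd (Reg Xs) M).Runs (3 * w.length + 3) (ctl b k : Ctl M)
      (mem μ (w.map some ++ none :: E) a a' R) (ctl b k)
      (mem μ E (w.reverse.map some ++ a) a' R) := by
  have := runs_xfer (M := M) (X := Reg Xs) (x := .ev) (y := .aux) (by simp) (ctl b k) []
    (lay μ (w.map some ++ none :: E) a a' R) (fun _ _ => []) w (none :: E) (by simp) (by simp)
  simpa [mem, ctl] using this

omit [Alphabet A] in
theorem runs_xfer_ev_aux2 (w : Word A) :
    (xfer .ev .aux2 : WCmd (Reg Xs) M).Runs (3 * w.length + 3) (ctl b k : Ctl M)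
      (mem μ (w.map some ++ none :: E) a a' R) (ctl b k)
      (mem μ E a (w.reverse.map some ++ a') R) := by
  have := runs_xfer (M := M) (X := Reg Xs) (x := .ev) (y := .aux2) (by simp) (ctl b k) []
    (lay μ (w.map some ++ none :: E) a a' R) (fun _ _ => []) w (none :: E) (by simp) (by simp)
  simpa [mem, ctl] using this

omit [Alphabet A] in
theorem runs_clear_aux (w : Word A) :
    (clear .aux : WCmd (Reg Xs) M).Runs (3 * w.length + 3) (ctl b k : Ctl M)
      (mem μ E (w.map some) a' R) (ctl b k) (mem μ E [] a' R) := by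
  have := runs_clear (M := M) (X := Reg Xs) .aux (ctl b k) []
    (lay μ E (w.map some) a' R) (fun _ _ => []) w [] (by simp) (by simp)
  simpa [mem, ctl] using this

omit [Alphabet A] in
theorem runs_clear_aux2 (w : Word A) :
    (clear .aux2 : WCmd (Reg Xs) M).Runs (3 * w.length + 3) (ctl b k : Ctl M)
      (mem μ E a (w.map some) R) (ctl b k) (mem μ E a [] R) := by
  have := runs_clear (M := M) (X := Reg Xs) .aux2 (ctl b k) []
    (lay μ E a (w.map some) R) (fun _ _ => []) w [] (by simp) (by simp)
  simpa [mem, ctl] using this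

omit [Alphabet A] in
theorem runs_clear_var (x : Xs) :
    (clear (.var x) : WCmd (Reg Xs) M).Runs (3 * (μ x).length + 3) (ctl b k : Ctl M)
      (mem μ E a a' R) (ctl b k) (mem (Function.update μ x []) E a a' R) := by
  have := runs_clear (M := M) (X := Reg Xs) (.var x) (ctl b k) []
    (lay μ E a a' R) (fun _ _ => []) (μ x) [] (by simp) (by simp)
  rw [List.tail_nil, ← List.map_nil (f := some), update_lay_var] at this
  exact this

omit [Alphabet A] in
theorem runs_xfer_aux_var (x : Xs) (w : Word A) (hx : μ x = []) :
    (xfer .aux (.var x) : WCmd (Reg Xs) M).Runs (3 * w.length + 3) (ctl b k : Ctl M)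
      (mem μ E (w.reverse.map some) a' R) (ctl b k)
      (mem (Function.update μ x w) E [] a' R) := by
  have := runs_xfer (M := M) (X := Reg Xs) (x := .aux) (y := .var x) (by simp) (ctl b k) []
    (lay μ E (w.reverse.map some) a' R) (fun _ _ => []) w.reverse [] (by simp) (by simp)
  rw [lay_var, hx, List.map_nil, List.append_nil, List.reverse_reverse, List.tail_nil,
    update_lay_aux, update_lay_var, List.length_reverse] at this
  exact this

omit [Alphabet A] in
theorem runs_xfer_var_aux (x : Xs) :
    (xfer (.var x) .aux : WCmd (Reg Xs) M).Runs (3 * (μ x).length + 3) (ctl b k : Ctl M)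
      (mem μ E [] a' R) (ctl b k)
      (mem (Function.update μ x []) E ((μ x).reverse.map some) a' R) := by
  have := runs_xfer (M := M) (X := Reg Xs) (x := .var x) (y := .aux) (by simp) (ctl b k) []
    (lay μ E [] a' R) (fun _ _ => []) (μ x) [] (by simp) (by simp)
  rw [List.tail_nil, ← List.map_nil (f := some), update_lay_var, update_lay_aux, lay_aux,
    List.map_nil, List.append_nil] at this
  exact this

omit [Alphabet A] in
theorem runs_xfer_inp_aux (w : Word A) :
    (xfer .inp .aux : WCmd (Reg Xs) M).Runs (3 * w.length + 3) (ctl b k : Ctl M)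
      (mem μ E [] a' (w.map some ++ none :: R)) (ctl b k)
      (mem μ E (w.reverse.map some) a' R) := by
  have := runs_xfer (M := M) (X := Reg Xs) (x := .inp) (y := .aux) (by simp) (ctl b k) []
    (lay μ E [] a' (w.map some ++ none :: R)) (fun _ _ => []) w (none :: R) (by simp) (by simp)
  simpa [mem, ctl] using this

/-- Push the value of the variable `x` on the stack of values. -/
def fetch (x : Xs) : WCmd (Reg Xs) M :=
  .seq (.push (.word .ev) fun _ => none) (.seq (xfer (.var x) .aux) (xferTwo .aux (.var x) .ev))

omit [Alphabet A] in
theorem runs_fetch (x : Xs) :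
    (fetch x : WCmd (Reg Xs) M).Runs (7 * (μ x).length + 7) (ctl b k : Ctl M)
      (mem (Xs := Xs) μ E [] a' R) (ctl b k)
      (mem μ ((μ x).map some ++ none :: E) [] a' R) := by
  have h := runs_xferTwo (M := M) (X := Reg Xs) (x := .aux) (y := .var x) (z := .ev) (by simp)
    (by simp) (by simp) (ctl b k) [] (lay (Function.update μ x []) (none :: E)
      ((μ x).reverse.map some) a' R) (fun _ _ => []) (μ x).reverse [] (by simp) (by simp)
  rw [List.tail_nil, update_lay_aux, lay_var, Function.update_self, List.map_nil, List.append_nil,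
    List.reverse_reverse, update_lay_var, Function.update_idem, Function.update_eq_self, lay_ev,
    update_lay_ev, List.length_reverse] at h
  refine Runs.mono (Runs.seq (runs_push_ev _ _) (Runs.seq (runs_xfer_var_aux x) h)) ?_
  omega

/-- Replace the two words on top of the stack of values by the unary number of their common
length. -/
def minLength : WCmd (Reg Xs) M :=
  .seq (xfer .ev .aux) <| .seq (xfer .ev .aux2) <| .seq (.push (.word .ev) fun _ => none) <|
  .seq (pull (.word .aux) id) <| .seq (.load fun s => { s with reg2 := s.reg }) <|
  .seq (pull (.word .aux2) id) <|
  .seq (.loop (fun s => s.reg.isSome && s.reg2.isSome) <|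
    .seq (.push (.word .ev) fun _ => some Alphabet.one) <|
    .seq (pull (.word .aux) id) <| .seq (.load fun s => { s with reg2 := s.reg }) <|
    pull (.word .aux2) id) <|
  .seq (.load fun s => { s with reg := none, reg2 := none }) <| .seq (clear .aux) (clear .aux2)

theorem runs_minLength (u v : Word A) :
    (minLength : WCmd (Reg Xs) M).Runs (11 * u.length + 11 * v.length + 30) (ctl b k : Ctl M)
      (mem (Xs := Xs) μ (u.map some ++ none :: (v.map some ++ none :: E)) [] [] R) (ctl b k)
      (mem μ ((unary (min u.length v.length)).map some ++ none :: E) [] [] R) := by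
  have key : ∀ (u v : Word A) (E : List (Option A)), ∃ (r r' : Option (Option A)) (u' v' : Word A),
      u'.length ≤ u.length ∧ v'.length ≤ v.length ∧
      (Cmd.loop (fun s : Ctl M => s.reg.isSome && s.reg2.isSome) <|
        .seq (.push (.word .ev) fun _ => some Alphabet.one) <|
        .seq (pull (.word .aux) id) <| .seq (.load fun s => { s with reg2 := s.reg }) <|
        pull (.word .aux2) id : WCmd (Reg Xs) M).Runs (5 * u.length + 1)
        { (ctl b k : Ctl M) with reg := (v.map some).head?, reg2 := (u.map some).head? }
        (mem (Xs := Xs) μ E (u.map some).tail (v.map some).tail R)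
        { (ctl b k : Ctl M) with reg := r, reg2 := r' }
        (mem μ ((unary (min u.length v.length)).map some ++ E) (u'.map some) (v'.map some) R) := by
    intro u
    induction u with
    | nil =>
      intro v E
      refine ⟨(v.map some).head?, none, [], v.tail, by simp, by simp, ?_⟩
      have := Runs.loop_done (c := fun s : Ctl M => s.reg.isSome && s.reg2.isSome)
        (.seq (.push (.word .ev) fun _ => some Alphabet.one) <|
        .seq (pull (.word .aux) id) <| .seq (.load fun s => { s with reg2 := s.reg }) <|
        pull (.word .aux2) id)
        (s := { (ctl b k : Ctl M) with reg := (v.map some).head?, reg2 := none })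
        (mem (Xs := Xs) μ E [] (v.map some).tail R) (by simp)
      simpa [unary] using this
    | cons c u ih =>
      intro v E
      rcases v with _ | ⟨d, v⟩
      · refine ⟨none, some (some c), u, [], by simp, by simp, ?_⟩
        have := Runs.loop_done (c := fun s : Ctl M => s.reg.isSome && s.reg2.isSome)
          (.seq (.push (.word .ev) fun _ => some Alphabet.one) <|
          .seq (pull (.word .aux) id) <| .seq (.load fun s => { s with reg2 := s.reg }) <|
          pull (.word .aux2) id)
          (s := { (ctl b k : Ctl M) with reg := none, reg2 := some (some c) })
          (mem (Xs := Xs) μ E (u.map some) [] R) (by simp)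
        refine Runs.mono (by simpa [unary] using this) (by omega)
      · obtain ⟨r, r', u', v', hu, hv, h⟩ := ih v (some Alphabet.one :: E)
        refine ⟨r, r', u', v', by simp; omega, by simp; omega, ?_⟩
        have e : (unary (min (c :: u).length (d :: v).length)).map some ++ E =
            (unary (min u.length v.length)).map some ++ some (Alphabet.one : A) :: E := by
          simp only [unary, List.length_cons, Nat.succ_min_succ, List.replicate_succ',
              List.map_append]
          simp
        rw [e]
        refine Runs.mono (Runs.loop_step ?_ (Runs.seq (runs_push_ev _ _) (Runs.seq
          (runs_pull_aux _) (Runs.seq (Runs.load _ _ _) (runs_pull_aux2 _)))) h) ?_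
        · simp
        · simp; omega
  obtain ⟨r, r', u', v', hu, hv, h⟩ := key u.reverse v.reverse (none :: E)
  simp only [List.length_reverse] at hu hv h
  have h1 := runs_xfer_ev_aux (M := M) (Xs := Xs) (μ := μ) (b := b) (k := k) (a := []) (a' := [])
    (R := R) (E := v.map some ++ none :: E) u
  have h2 := runs_xfer_ev_aux2 (M := M) (Xs := Xs) (μ := μ) (b := b) (k := k)
    (a := u.reverse.map some ++ []) (a' := []) (R := R) (E := E) v
  rw [List.append_nil] at h1 h2
  rw [List.append_nil] at h2
  refine Runs.mono (Runs.seq h1 (Runs.seq h2 (Runs.seq (runs_push_ev _ _) (Runs.seq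
    (runs_pull_aux _) (Runs.seq (Runs.load _ _ _) (Runs.seq (runs_pull_aux2 _) (Runs.seq h
    (Runs.seq (Runs.load _ _ _) (Runs.seq (runs_clear_aux _) (runs_clear_aux2 _)))))))))) ?_
  omega

end Rules

end WordMachine

/-! ### Compiling programs to word machines -/

namespace WordMachine

open Cmd Turing

section Compile

variable {A V : Type} [Alphabet A] [DecidableEq V] {O : ExtraOps A} {F : Set O.Op}

variable (Xs : Finset V) (M : F → TM2ComputableAux (Option A) A)

/-- Run programs for the arguments of an operator, the last one first, so that the values end up on
the stack in the order of the arguments. -/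
def evalArgs : (n : ℕ) → (Fin n → WCmd (Reg Xs) M) → WCmd (Reg Xs) M
  | 0, _ => .load id
  | n + 1, c => .seq (evalArgs n fun i => c i.succ) (c 0)

open Classical in
/-- Push the value of an expression on the stack of values. -/
noncomputable def compExpr : Expr O V → WCmd (Reg Xs) M
  | .var x => if h : x ∈ Xs then fetch ⟨x, h⟩ else .load id
  | .op o args => .seq (evalArgs Xs M (O.arity o) fun i => compExpr (args i))
      (if h : o ∈ F then call (O.arity o) ⟨o, h⟩ .ev .aux else .load id)
  | .declass e₁ e₂ => .seq (compExpr e₂) (.seq (compExpr e₁) minLength)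

open Classical in
/-- Evaluate a guard and keep its truth value in the control state. -/
noncomputable def compTest (e : Expr O V) : WCmd (Reg Xs) M :=
  .seq (compExpr Xs M e) <| .seq (xfer .ev .aux) <| .seq (pull (.word .aux) id) <|
  .seq (.load fun s => { s with reg2 := s.reg }) <| .seq (pull (.word .aux) id) <|
  .seq (.load fun s => { s with
    reg := none, reg2 := none, bit :=
      decide (s.reg2 = some (some Alphabet.one) ∧ s.reg = none) }) <|
  clear .aux

/-- The program for a statement. The flag `brk` of the control state is set while a break is on its
way to the enclosing loop. -/
noncomputable def compStmt : Stmt O V → WCmd (Reg Xs) M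
  | .skip => .load id
  | .assign x e => .seq (compExpr Xs M e) (if h : x ∈ Xs then .seq (clear (.var ⟨x, h⟩))
      (.seq (xfer .ev .aux) (xfer .aux (.var ⟨x, h⟩))) else .load id)
  | .seq s₁ s₂ => .seq (compStmt s₁) (.ite Ctl.brk (.load id) (compStmt s₂))
  | .ite e s₁ s₀ => .seq (compTest Xs M e) (.ite Ctl.bit
      (.seq (.load fun s => { s with bit := false }) (compStmt s₁)) (compStmt s₀))
  | .loop e s => .seq (compTest Xs M e) (.seq (.loop Ctl.bit
      (.seq (.load fun s => { s with bit := false }) (.seq (compStmt s)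
        (.ite Ctl.brk (.load id) (compTest Xs M e))))) (.load fun s => { s with brk := false }))
  | .brk e => .seq (compTest Xs M e) (.load fun s => { s with bit := false, brk := s.bit })

variable {Xs M}

/-- The machine `M i` computes the operator `i` in polynomial time. -/
def Implements (M : F → TM2ComputableAux (Option A) A) : Prop :=
  ∀ i : F, ∃ T : Polynomial ℕ, ∀ w, Nonempty (TM2OutputsInTime (M i).tm
    ((encodeTuple w).map (M i).inputAlphabet.symm)
    (some ((O.denote i w).map (M i).outputAlphabet.symm)) (T.eval (encodeTuple w).length))

omit [Alphabet A] in
theorem length_encodeTuple {n : ℕ} (w : Fin n → Word A) :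
    (encodeTuple w).length = ∑ i, ((w i).length + 1) := by
  simp [encodeTuple, List.length_flatMap, List.map_ofFn, List.sum_ofFn]

omit [Alphabet A] [DecidableEq V] in
theorem runs_evalArgs {n : ℕ} {c : Fin n → WCmd (Reg Xs) M} {t : Fin n → ℕ} {v : Fin n → Word A}
    {μ : Store A V} {R : List (Option A)} {b k : Bool}
    (h : ∀ i E, (c i).Runs (t i) (ctl b k) (mem μ E [] [] R) (ctl b k)
      (mem μ ((v i).map some ++ none :: E) [] [] R)) (E : List (Option A)) :
    (evalArgs Xs M n c).Runs (∑ i, t i + 1) (ctl b k) (mem μ E [] [] R) (ctl b k)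
      (mem μ (encodeTuple v ++ E) [] [] R) := by
  induction n generalizing E with
  | zero =>
    rw [show encodeTuple v ++ E = E by simp [encodeTuple]]
    exact Runs.mono (Runs.load id _ _) (by simp)
  | succ n ih =>
    have e : encodeTuple v ++ E =
        (v 0).map some ++ none :: (encodeTuple (fun i => v i.succ) ++ E) := by
      simp [encodeTuple, List.ofFn_succ]
    rw [e]
    refine Runs.mono (Runs.seq (ih (fun i E => h i.succ E) E) (h 0 _)) ?_
    rw [Fin.sum_univ_succ]
    omega

/-- The operators occurring in an expression. -/
def _root_.Expr.ops : Expr O V → Set O.Op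
  | .var _ => ∅
  | .op o args => {o} ∪ ⋃ i, (args i).ops
  | .declass e₁ e₂ => e₁.ops ∪ e₂.ops

/-- The operators occurring in a statement. -/
def _root_.Stmt.ops : Stmt O V → Set O.Op
  | .skip => ∅
  | .assign _ e => e.ops
  | .seq s₁ s₂ => s₁.ops ∪ s₂.ops
  | .ite e s₁ s₀ => e.ops ∪ s₁.ops ∪ s₀.ops
  | .loop e s => e.ops ∪ s.ops
  | .brk e => e.ops

omit [Alphabet A] [DecidableEq V] in
theorem _root_.Expr.finite_ops (e : Expr O V) : e.ops.Finite := by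
  induction e with
  | var x => exact Set.finite_empty
  | op o args ih => exact (Set.finite_singleton o).union (Set.finite_iUnion ih)
  | declass e₁ e₂ ih₁ ih₂ => exact ih₁.union ih₂

omit [Alphabet A] [DecidableEq V] in
theorem _root_.Stmt.finite_ops (s : Stmt O V) : s.ops.Finite := by
  induction s with
  | skip => exact Set.finite_empty
  | assign x e => exact e.finite_ops
  | seq s₁ s₂ ih₁ ih₂ => exact ih₁.union ih₂
  | ite e s₁ s₀ ih₁ ih₂ => exact (e.finite_ops.union ih₁).union ih₂
  | loop e s ih => exact e.finite_ops.union ih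
  | brk e => exact e.finite_ops

variable {Γ : VarEnv V} {Δ : OpEnv O}

theorem runs_compExpr (hΔ : Δ.Safe) (hM : Implements M) {l m τ : ℕ} {e : Expr O V}
    (he : ExprTy Γ Δ l m e τ) (hX : e.vars ⊆ Xs) (hF : e.ops ⊆ F) :
    ∃ P : Polynomial ℕ, ∀ (μ : Store A V) (E R : List (Option A)) (b k : Bool),
      (compExpr Xs M e).Runs (P.eval (Γ.size 0 μ)) (ctl b k) (mem μ E [] [] R) (ctl b k)
        (mem μ ((e.eval μ).map some ++ none :: E) [] [] R) := by
  induction he with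
  | @var x τ hx =>
    refine ⟨7 * Polynomial.X + 7, fun μ E R b k => ?_⟩
    have hxX : x ∈ Xs := hX (by simp [Expr.vars])
    rw [compExpr, dif_pos hxX]
    refine Runs.mono (runs_fetch ⟨x, hxX⟩) ?_
    have := VarEnv.length_le_size (μ := μ) hx (Nat.zero_le τ)
    simp
    omega
  | @op o args a τ ho hargs ih =>
    obtain ⟨Q, hQ⟩ := (ExprTy.op ho hargs).exists_length_le hΔ
    have hoF : o ∈ F := hF (by simp [Expr.ops])
    obtain ⟨T, hT⟩ := hM ⟨o, hoF⟩
    choose P hP using fun i => ih i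
      ((Finset.subset_biUnion_of_mem (fun i => (args i).vars) (Finset.mem_univ i)).trans hX)
      ((Set.subset_iUnion (fun i => (args i).ops) i).trans (Set.subset_union_right.trans hF))
    choose L hL using fun i => (hargs i).exists_length_le hΔ
    refine ⟨∑ i, P i + 1 + (7 * (∑ i, (L i + 1)) + Polynomial.C (stepCost M ⟨o, hoF⟩ + 2) *
      T.comp (∑ i, (L i + 1)) + 6 * Q + 20), fun μ E R b k => ?_⟩
    have h1 := runs_evalArgs (Xs := Xs) (M := M) (fun i E => hP i μ E R b k) E
    have h2 := runs_call (M := M) (X := Reg Xs) (x := .ev) (y := .aux) (by simp) ⟨o, hoF⟩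
      (List.ofFn fun i => (args i).eval μ) (O.denote o fun i => (args i).eval μ) _
      (hT fun i => (args i).eval μ) (ctl b k) ⟨rfl, fun _ => rfl⟩ []
      (lay μ (encodeTuple (fun i => (args i).eval μ) ++ E) [] [] R) E rfl rfl
    rw [← encodeTuple_eq, update_lay_ev, List.length_ofFn] at h2
    have h3 : (encodeTuple fun i => (args i).eval μ).length ≤
        (∑ i, (L i + 1)).eval (Γ.size 0 μ) := by
      rw [length_encodeTuple, Polynomial.eval_finsetSum]
      refine Finset.sum_le_sum fun i _ => ?_
      rw [Polynomial.eval_add, Polynomial.eval_one]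
      exact Nat.add_le_add_right (hL i μ) 1
    have h4 := T.eval_le_eval h3
    have h5 := hQ μ
    rw [compExpr, dif_pos hoF]
    refine Runs.mono (Runs.seq h1 h2) ?_
    have h6 := Nat.mul_le_mul_left (stepCost M ⟨o, hoF⟩ + 2) h4
    simp only [Polynomial.eval_add, Polynomial.eval_mul, Polynomial.eval_C, Polynomial.eval_comp,
      Polynomial.eval_one, Polynomial.eval_ofNat] at h6 ⊢
    rw [Polynomial.eval_finsetSum Finset.univ P]
    simp only [Expr.eval] at h5
    omega
  | @declass e₁ e₂ τ₁ τ he₁ he₂ _ _ ih₁ ih₂ =>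
    obtain ⟨P₁, h₁⟩ := ih₁ (Finset.subset_union_left.trans hX) (Set.subset_union_left.trans hF)
    obtain ⟨P₂, h₂⟩ := ih₂ (Finset.subset_union_right.trans hX) (Set.subset_union_right.trans hF)
    obtain ⟨L₁, hL₁⟩ := he₁.exists_length_le hΔ
    obtain ⟨L₂, hL₂⟩ := he₂.exists_length_le hΔ
    refine ⟨P₁ + P₂ + 11 * L₁ + 11 * L₂ + 30, fun μ E R b k => ?_⟩
    refine Runs.mono (Runs.seq (h₂ μ E R b k) (Runs.seq (h₁ μ _ R b k) (runs_minLength _ _))) ?_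
    have := hL₁ μ
    have := hL₂ μ
    simp
    omega

open Classical in
theorem runs_compTest (hΔ : Δ.Safe) (hM : Implements M) {l m τ : ℕ} {e : Expr O V}
    (he : ExprTy Γ Δ l m e τ) (hX : e.vars ⊆ Xs) (hF : e.ops ⊆ F) :
    ∃ P : Polynomial ℕ, ∀ (μ : Store A V) (R : List (Option A)) (b k : Bool),
      ∃ b' : Bool, (b' = true ↔ e.eval μ = tt1) ∧
      (compTest Xs M e).Runs (P.eval (Γ.size 0 μ)) (ctl b k) (mem μ [] [] [] R) (ctl b' k)
        (mem μ [] [] [] R) := by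
  obtain ⟨P, hP⟩ := runs_compExpr hΔ hM he hX hF
  obtain ⟨L, hL⟩ := he.exists_length_le hΔ
  refine ⟨P + 6 * L + 20, fun μ R b k => ?_⟩
  set w := e.eval μ
  have h0 : ∀ (b k : Bool),
      ({ (ctl b k : Ctl M) with reg := none } : Ctl M) = ctl b k := fun _ _ => rfl
  have h1 := runs_xfer_ev_aux (M := M) (Xs := Xs) (μ := μ) (b := b) (k := k) (a := []) (a' := [])
    (R := R) (E := []) w
  rw [List.append_nil] at h1
  have h2 := runs_clear_aux (M := M) (Xs := Xs) (μ := μ) (b := decide ((w.reverse.map some).head? =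
    some (some Alphabet.one) ∧ (w.reverse.map some).tail.head? = none)) (k := k) (a' := [])
    (R := R) (E := []) w.reverse.tail.tail
  rw [List.map_tail, List.map_tail] at h2
  refine ⟨_, ?_, Runs.mono (Runs.seq (hP μ [] R b k) (Runs.seq h1 (Runs.seq (runs_pull_aux _)
    (Runs.seq (Runs.load _ _ _) (Runs.seq (runs_pull_aux _) (Runs.seq (Runs.load _ _ _) h2)))))) ?_⟩
  rotate_left
  · have : w.length ≤ _ := hL μ
    simp
    omega
  · have h2 : w = tt1 ↔ w.reverse = [Alphabet.one] := by
      rw [List.reverse_eq_iff]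
      rfl
    rw [h2]
    rcases w.reverse with _ | ⟨a, _ | ⟨b, v⟩⟩ <;> simp

/-- The execution of `s` terminates and is carried out by the compiled program in time polynomial in
the size of the initial store; the size of the final store is polynomial, too. -/
def GoodStmt (Γ : VarEnv V) (Xs : Finset V) (M : F → TM2ComputableAux (Option A) A)
    (s : Stmt O V) : Prop :=
  ∃ P : Polynomial ℕ, ∀ μ : Store A V, ∃ (b : ExitFlag) (μ' : Store A V) (k : Bool),
    Exec μ s b μ' ∧ (k = true ↔ b = .broken) ∧ Γ.size 0 μ' ≤ P.eval (Γ.size 0 μ) ∧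
    (compStmt Xs M s).Runs (P.eval (Γ.size 0 μ)) (ctl false false) (mem μ [] [] [] [])
      (ctl false k) (mem μ' [] [] [] [])

/-- The number of rounds of a for loop is at most the length of its counter, and all stores on the
way have polynomial size in that of the initial store, so that a round takes polynomial time. -/
theorem goodStmt_loop (hΔ : Δ.Safe) (hM : Implements M) {B : Set (Expr O V)}
    (hB : ∀ e ∈ B, ∀ μ : Store A V, e.eval μ ≠ []) {m τ : ℕ} {e : Expr O V} {s : Stmt O V}
    (hL : (Stmt.loop e s).ForLoops B) (he : ExprTy Γ Δ τ m e τ) (hs : StmtTy Γ Δ τ m s τ)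
    (hτ : 1 ≤ τ) (hτm : τ ≤ m) (hX : (Stmt.loop e s).vars ⊆ Xs) (hF : (Stmt.loop e s).ops ⊆ F)
    (hgood : GoodStmt Γ Xs M s) : GoodStmt Γ Xs M (.loop e s) := by
  obtain ⟨G, hG⟩ := exists_size_le_of_loop hB hΔ hL he hs hτ hτm
    (hs.exists_size_le hB hΔ hL.1 hτ hτm) 0
  obtain ⟨T, hT⟩ := runs_compTest (Xs := Xs) hΔ hM he (Finset.subset_union_left.trans hX)
    (Set.subset_union_left.trans hF)
  obtain ⟨P, hP⟩ := hgood
  obtain ⟨x, hxs, τ', hx, -⟩ : ∃ x, (∀ μ ν : Store A V, LoopStep e s μ ν →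
      (ν x).length < (μ x).length) ∧ ∃ τ', Γ.level x = some τ' ∧ τ ≤ τ' := by
    obtain ⟨-, x, e', s', he', hx', rfl, rfl⟩ := hL
    exact ⟨x, fun μ ν h => length_lt_of_forStep (hB e' he' μ) hx' h, he.le_level_of_geExpr hΔ⟩
  -- all stores on the way have size at most `Q`
  let Q : Polynomial ℕ := Polynomial.X + G
  have hQ : ∀ μ : Store A V, Γ.size 0 μ + G.eval (Γ.size 1 μ) ≤ Q.eval (Γ.size 0 μ) := fun μ => by
    simp only [Q, Polynomial.eval_add, Polynomial.eval_X]
    exact Nat.add_le_add_left (G.eval_le_eval (VarEnv.size_anti (Nat.zero_le _))) _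
  refine ⟨Q + T + (Polynomial.X + 1) * (P.comp Q + T.comp Q + 5) + 5, fun μ => ?_⟩
  set N := P.eval (Q.eval (Γ.size 0 μ)) + T.eval (Q.eval (Γ.size 0 μ)) + 5 with hN
  -- the machine code of the rounds of the loop
  set p : WCmd (Reg Xs) M := .seq (.load fun s => { s with bit := false }) (.seq (compStmt Xs M s)
        (.ite Ctl.brk (.load id) (compTest Xs M e))) with hp
  have key : ∀ (n : ℕ) (ν : Store A V) (b : Bool), (ν x).length < n → (b = true ↔ e.eval ν = tt1) →
      Relation.ReflTransGen (LoopStep e s) μ ν → ∃ (μ' : Store A V) (k : Bool),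
        Exec ν (.loop e s) .go μ' ∧ (Cmd.loop Ctl.bit p).Runs (n * N + 1) (ctl b false)
          (mem ν [] [] [] []) (ctl false k) (mem μ' [] [] [] []) := by
    intro n
    induction n with
    | zero => exact fun ν b hn => absurd hn (Nat.not_lt_zero _)
    | succ n ih =>
      intro ν b hn hb hν
      cases b with
      | false =>
        refine ⟨ν, false, .loop_false fun h => by simpa using hb.2 h, ?_⟩
        exact Runs.mono (Runs.loop_done p _ rfl) (by omega)
      | true =>
        have he := hb.1 rfl
        have hsize : Γ.size 0 ν ≤ Q.eval (Γ.size 0 μ) := (hG μ ν hν).1.trans (hQ μ)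
        have h1 := P.eval_le_eval hsize
        obtain ⟨f, ν', k, h2, hk, h3, h4⟩ := hP ν
        rw [Nat.succ_mul]
        cases f with
        | broken =>
          obtain rfl : k = true := by simpa using hk
          refine ⟨ν', true, .loop_true he (.seq_broken h2), ?_⟩
          have h5 : p.Runs (1 + (P.eval (Γ.size 0 ν) + 2)) (ctl true false) (mem ν [] [] [] [])
              (ctl false true) (mem ν' [] [] [] []) :=
            Runs.seq (Runs.load _ _ _) (Runs.seq h4 (Runs.ite (t := 1) (Runs.load id _ _)))
          exact Runs.mono (Runs.loop_step rfl h5 (Runs.loop_done p _ rfl)) (by omega)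
        | go =>
          obtain rfl : k = false := by simpa using hk
          have hν' := hν.tail ⟨he, h2⟩
          obtain ⟨b, hb, hb'⟩ := hT ν' [] false false
          have h5 := T.eval_le_eval ((hG μ ν' hν').1.trans (hQ μ))
          obtain ⟨μ', k, h6, h7⟩ := ih ν' b (by have := hxs ν ν' ⟨he, h2⟩; omega) hb hν'
          refine ⟨μ', k, .loop_true he (.seq_go h2 h6), ?_⟩
          have h8 : p.Runs (1 + (P.eval (Γ.size 0 ν) + (T.eval (Γ.size 0 ν') + 1))) (ctl true false)
              (mem ν [] [] [] []) (ctl b false) (mem ν' [] [] [] []) :=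
            Runs.seq (Runs.load _ _ _) (Runs.seq h4 (Runs.ite hb'))
          exact Runs.mono (Runs.loop_step rfl h8 h7) (by omega)
  obtain ⟨b, hb, hb'⟩ := hT μ [] false false
  obtain ⟨μ', k, h1, h2⟩ := key ((μ x).length + 1) μ b (Nat.lt_succ_self _) hb .refl
  refine ⟨.go, μ', false, h1, by simp, ?_, ?_⟩
  · obtain ⟨-, ν, hν, h⟩ := exec_loop_iff.1 h1
    have h3 : Γ.size 0 μ' ≤ Q.eval (Γ.size 0 μ) := by
      rcases h with ⟨-, rfl⟩ | ⟨-, h⟩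
      · exact (hG _ _ hν).1.trans (hQ μ)
      · exact ((hG _ _ hν).2 _ h).trans (hQ μ)
    simp only [Polynomial.eval_add]
    omega
  · refine Runs.mono (Runs.seq hb' (Runs.seq h2 (Runs.load _ _ _))) ?_
    have h3 := Nat.mul_le_mul_right N
      (Nat.add_le_add_right (VarEnv.length_le_size (μ := μ) hx (Nat.zero_le _)) 1)
    simp only [Polynomial.eval_add, Polynomial.eval_mul, Polynomial.eval_comp, Polynomial.eval_X,
      Polynomial.eval_one, Polynomial.eval_ofNat, ← hN]
    omega

/-- Statements of safe for-programs terminate and are carried out in polynomial time. -/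
theorem _root_.StmtTy.goodStmt (hΔ : Δ.Safe) (hM : Implements M) {B : Set (Expr O V)}
    (hB : ∀ e ∈ B, ∀ μ : Store A V, e.eval μ ≠ []) {l m τ : ℕ} {s : Stmt O V}
    (hL : s.ForLoops B) (hs : StmtTy Γ Δ l m s τ) (hlm : l = 0 ∧ m = 0 ∨ 1 ≤ l ∧ l ≤ m)
    (hX : s.vars ⊆ Xs) (hF : s.ops ⊆ F) : GoodStmt Γ Xs M s := by
  induction hs with
  | sub _ _ ih => exact ih hL hlm hX hF
  | skip =>
    refine ⟨Polynomial.X + 1, fun μ => ⟨.go, μ, false, .skip μ, by simp, by simp, ?_⟩⟩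
    exact Runs.mono (Runs.load id _ _) (by simp)
  | @assign l m x e τ₁ τ₂ hx he h1 =>
    obtain ⟨P, hP⟩ := runs_compExpr hΔ hM he (Finset.subset_union_right.trans hX) hF
    obtain ⟨L, hL⟩ := he.exists_length_le hΔ
    have hxX : x ∈ Xs := hX (by simp [Stmt.vars])
    refine ⟨P + 6 * L + 3 * Polynomial.X + 10, fun μ => ⟨.go, _, false, .assign μ x e, by simp,
        ?_, ?_⟩⟩
    · have := hL μ
      refine VarEnv.size_update_le ?_ fun _ _ _ => ?_ <;> simp <;> omega
    · have h1 := runs_xfer_ev_aux (M := M) (Xs := Xs) (μ := Function.update μ x []) (b := false)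
        (k := false) (a := []) (a' := []) (R := []) (E := []) (e.eval μ)
      rw [List.append_nil] at h1
      have h2 := runs_xfer_aux_var (M := M) (Xs := Xs) (μ := Function.update μ x []) (b := false)
        (k := false) (a' := []) (R := []) (E := []) ⟨x, hxX⟩ (e.eval μ) (by simp)
      rw [Function.update_idem] at h2
      rw [compStmt, dif_pos hxX]
      refine Runs.mono (Runs.seq (hP μ [] [] _ _) (Runs.seq (runs_clear_var ⟨x, hxX⟩)
        (Runs.seq h1 h2))) ?_
      have := hL μ
      have := VarEnv.length_le_size (μ := μ) hx (Nat.zero_le _)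
      simp
      omega
  | @seq l m s₁ s₂ τ _ _ ih₁ ih₂ =>
    obtain ⟨P₁, h₁⟩ := ih₁ hL.1 hlm (Finset.subset_union_left.trans hX)
      (Set.subset_union_left.trans hF)
    obtain ⟨P₂, h₂⟩ := ih₂ hL.2 hlm (Finset.subset_union_right.trans hX)
      (Set.subset_union_right.trans hF)
    refine ⟨P₁ + P₂.comp P₁ + 2, fun μ => ?_⟩
    simp only [Polynomial.eval_add, Polynomial.eval_comp, Polynomial.eval_ofNat]
    obtain ⟨b, μ', k, hb, hk, h3, h4⟩ := h₁ μ
    cases b with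
    | broken =>
      obtain rfl : k = true := by simpa using hk
      refine ⟨.broken, μ', true, .seq_broken hb, hk, by omega, ?_⟩
      refine Runs.mono (Runs.seq h4 (Runs.ite (t := 1) ?_)) (by omega)
      exact Runs.load id _ _
    | go =>
      obtain rfl : k = false := by simpa using hk
      obtain ⟨b, μ'', k, hb', hk', h5, h6⟩ := h₂ μ'
      have h7 := P₂.eval_le_eval h3
      refine ⟨b, μ'', k, .seq_go hb hb', hk', by omega, ?_⟩
      exact Runs.mono (Runs.seq h4 (Runs.ite h6)) (by omega)
  | @ite l m e s₁ s₀ τ he _ _ ih₁ ih₂ =>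
    have hX₁ := Finset.union_subset_iff.1 hX
    have hX₂ := Finset.union_subset_iff.1 hX₁.1
    have hF₁ := Set.union_subset_iff.1 hF
    have hF₂ := Set.union_subset_iff.1 hF₁.1
    obtain ⟨P₁, h₁⟩ := ih₁ hL.1 hlm hX₂.2 hF₂.2
    obtain ⟨P₂, h₂⟩ := ih₂ hL.2 hlm hX₁.2 hF₁.2
    obtain ⟨T, hT⟩ := runs_compTest hΔ hM he hX₂.1 hF₂.1
    refine ⟨T + P₁ + P₂ + 3, fun μ => ?_⟩
    simp only [Polynomial.eval_add, Polynomial.eval_ofNat]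
    obtain ⟨b, hb, hb'⟩ := hT μ [] false false
    cases b with
    | true =>
      obtain ⟨f, μ', k, h3, hk, h4, h5⟩ := h₁ μ
      refine ⟨f, μ', k, .ite_true (hb.1 rfl) h3, hk, by omega, ?_⟩
      refine Runs.mono (Runs.seq hb' (Runs.ite (t := 1 + P₁.eval (Γ.size 0 μ)) ?_)) (by omega)
      exact Runs.seq (Runs.load _ _ _) h5
    | false =>
      obtain ⟨f, μ', k, h3, hk, h4, h5⟩ := h₂ μ
      refine ⟨f, μ', k, .ite_false (fun h => by simpa using hb.2 h) h3, hk, by omega, ?_⟩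
      exact Runs.mono (Runs.seq hb' (Runs.ite h5)) (by omega)
  | @inner_loop l m e s τ he hs h1 h2 ih =>
    exact goodStmt_loop hΔ hM hB hL he hs h1 h2 hX hF (ih hL.1 (.inr ⟨h1, h2⟩)
      (Finset.subset_union_right.trans hX) (Set.subset_union_right.trans hF))
  | @outer_loop e s τ he hs h1 ih =>
    exact goodStmt_loop hΔ hM hB hL he hs h1 le_rfl hX hF (ih hL.1 (.inr ⟨h1, le_rfl⟩)
      (Finset.subset_union_right.trans hX) (Set.subset_union_right.trans hF))
  | @brk l m e τ he _ =>
    obtain ⟨T, hT⟩ := runs_compTest hΔ hM he hX hF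
    refine ⟨Polynomial.X + T + 1, fun μ => ?_⟩
    simp only [Polynomial.eval_add, Polynomial.eval_X, Polynomial.eval_one]
    obtain ⟨b, hb, hb'⟩ := hT μ [] false false
    refine ⟨if b then .broken else .go, μ, b, ?_, by cases b <;> simp, by omega,
      Runs.mono (Runs.seq hb' (Runs.load _ _ _)) (by omega)⟩
    cases b with
    | true => exact .brk_true (hb.1 rfl)
    | false => exact .brk_false (fun h => by simpa using hb.2 h)

end Compile

end WordMachine

/-! ### Safe for-programs compute functions in polynomial time -/

namespace WordMachine

open Cmd Turing

section Frame

variable {A V : Type} [DecidableEq V] {Xs : Finset V} {I : Type}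
  {M : I → TM2ComputableAux (Option A) A} {b k : Bool}

/-- Read the arguments of a function into variables. -/
def loadArgs (M : I → TM2ComputableAux (Option A) A) : (n : ℕ) → (Fin n → Xs) → WCmd (Reg Xs) M
  | 0, _ => .load id
  | n + 1, c => .seq (xfer .inp .aux) (.seq (xfer .aux (.var (c 0)))
      (loadArgs M n fun i => c i.succ))

theorem runs_loadArgs {n : ℕ} {c : Fin n → Xs} (hc : Function.Injective c) (w : Fin n → Word A)
    {μ ν : Store A V} (hμ : ∀ i, μ (c i) = []) (hν : ∀ i, ν (c i) = w i)
    (hμν : ∀ x, (∀ i, (c i : V) ≠ x) → ν x = μ x) :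
    (loadArgs M n c).Runs (6 * (encodeTuple w).length + 1) (ctl b k) (mem μ [] [] []
        (encodeTuple w))
      (ctl b k) (mem ν [] [] [] []) := by
  induction n generalizing μ with
  | zero =>
    have : ν = μ := funext fun x => hμν x fun i => i.elim0
    rw [this, show encodeTuple w = [] by simp [encodeTuple]]
    exact Runs.load id _ _
  | succ n ih =>
    have e : encodeTuple w = (w 0).map some ++ none :: encodeTuple (fun i => w i.succ) := by
      simp [encodeTuple, List.ofFn_succ]
    have hc' : ∀ i : Fin n, (c i.succ : V) ≠ c 0 := fun i h => by
      have := hc (Subtype.ext h)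
      simp at this
    have h := ih (c := fun i => c i.succ) (fun i j h => Fin.succ_injective _ (hc h))
      (fun i => w i.succ) (μ := Function.update μ (c 0) (w 0))
      (fun i => by rw [Function.update_of_ne (hc' i)]; exact hμ _) (fun i => hν _) fun x hx => by
        by_cases h : x = c 0
        · subst h
          rw [Function.update_self]
          exact hν 0
        · rw [Function.update_of_ne h]
          refine hμν x fun i => ?_
          rcases Fin.eq_zero_or_eq_succ i with rfl | ⟨j, rfl⟩
          · exact fun e => h e.symm
          · exact hx j
    rw [e]
    refine Runs.mono (Runs.seq (runs_xfer_inp_aux _) (Runs.seq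
      (runs_xfer_aux_var (c 0) (w 0) (hμ 0)) h)) ?_
    simp
    omega

/-- Erase variables. -/
def clearVars (M : I → TM2ComputableAux (Option A) A) : List Xs → WCmd (Reg Xs) M
  | [] => .load id
  | x :: l => .seq (clear (.var x)) (clearVars M l)

theorem runs_clearVars {a : List (Option A)} {N : ℕ} (l : List Xs) (μ : Store A V)
    (hN : ∀ x ∈ l, (μ x).length ≤ N) :
    ∃ ν : Store A V, (∀ x ∈ l, ν x = []) ∧ (∀ x : V, μ x = [] → ν x = []) ∧
      (clearVars M l).Runs ((3 * N + 3) * l.length + 1) (ctl b k) (mem μ [] a [] []) (ctl b k)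
        (mem ν [] a [] []) := by
  induction l generalizing μ with
  | nil => exact ⟨μ, by simp, by simp, Runs.load id _ _⟩
  | cons x l ih =>
    obtain ⟨ν, h1, h2, h3⟩ := ih (Function.update μ x []) fun y hy => by
      by_cases h : (y : V) = x
      · rw [h, Function.update_self]; simp
      · rw [Function.update_of_ne h]
        exact hN y (by simp [hy])
    have hx : ν x = [] := h2 x (by simp)
    refine ⟨ν, ?_, fun y hy => h2 y ?_, Runs.mono (Runs.seq (runs_clear_var x) h3) ?_⟩
    · intro y hy
      rcases List.mem_cons.1 hy with rfl | hy
      exacts [hx, h1 y hy]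
    · by_cases h : y = x
      · rw [h, Function.update_self]
      · rwa [Function.update_of_ne h]
    · have := hN x (by simp)
      rw [List.length_cons, Nat.mul_succ]
      omega

end Frame

section Soundness

variable {A V : Type} [Alphabet A] [DecidableEq V] {O : ExtraOps A} {Γ : VarEnv V} {Δ : OpEnv O}

omit [Alphabet A] in
theorem _root_.ExprTy.level_ne_none {l m τ : ℕ} {e : Expr O V} (he : ExprTy Γ Δ l m e τ) {x : V}
    (hx : x ∈ e.vars) : Γ.level x ≠ none := by
  induction he with
  | var h =>
    simp only [Expr.vars, Finset.mem_singleton] at hx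
    simp [hx, h]
  | op _ _ ih =>
    simp only [Expr.vars, Finset.mem_biUnion] at hx
    obtain ⟨i, -, hi⟩ := hx
    exact ih i hi
  | declass _ _ _ _ ih₁ ih₂ =>
    simp only [Expr.vars, Finset.mem_union] at hx
    exact hx.elim ih₁ ih₂

omit [Alphabet A] in
theorem _root_.StmtTy.level_ne_none {l m τ : ℕ} {s : Stmt O V} (hs : StmtTy Γ Δ l m s τ) {x : V}
    (hx : x ∈ s.vars) : Γ.level x ≠ none := by
  induction hs with
  | sub _ _ ih => exact ih hx
  | skip => simp [Stmt.vars] at hx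
  | assign h he _ =>
    simp only [Stmt.vars, Finset.mem_union, Finset.mem_singleton] at hx
    rcases hx with rfl | hx
    · simp [h]
    · exact he.level_ne_none hx
  | seq _ _ ih₁ ih₂ =>
    simp only [Stmt.vars, Finset.mem_union] at hx
    exact hx.elim ih₁ ih₂
  | ite he _ _ ih₁ ih₂ =>
    simp only [Stmt.vars, Finset.mem_union] at hx
    rcases hx with (hx | hx) | hx
    exacts [he.level_ne_none hx, ih₁ hx, ih₂ hx]
  | inner_loop he _ _ _ ih =>
    simp only [Stmt.vars, Finset.mem_union] at hx
    exact hx.elim he.level_ne_none ih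
  | outer_loop he _ _ ih =>
    simp only [Stmt.vars, Finset.mem_union] at hx
    exact hx.elim he.level_ne_none ih
  | brk he _ => exact he.level_ne_none hx

omit [Alphabet A] [DecidableEq V] in
theorem _root_.StmtTy.ops_subset_dom {l m τ : ℕ} {s : Stmt O V} (hs : StmtTy Γ Δ l m s τ) :
    s.ops ⊆ Δ.dom := by
  have hE : ∀ {l m τ : ℕ} {e : Expr O V}, ExprTy Γ Δ l m e τ → e.ops ⊆ Δ.dom := by
    intro l m τ e he
    induction he with
    | var h => exact Set.empty_subset _
    | op ho _ ih =>
      exact Set.union_subset (Set.singleton_subset_iff.2 (OpEnv.mem_dom ho)) (Set.iUnion_subset ih)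
    | declass _ _ _ _ ih₁ ih₂ => exact Set.union_subset ih₁ ih₂
  induction hs with
  | sub _ _ ih => exact ih
  | skip => exact Set.empty_subset _
  | assign _ he _ => exact hE he
  | seq _ _ ih₁ ih₂ => exact Set.union_subset ih₁ ih₂
  | ite he _ _ ih₁ ih₂ => exact Set.union_subset (Set.union_subset (hE he) ih₁) ih₂
  | inner_loop he _ _ _ ih => exact Set.union_subset (hE he) ih
  | outer_loop he _ _ ih => exact Set.union_subset (hE he) ih
  | brk he _ => exact hE he

theorem _root_.Exec.eq_go_of_breaksInLoops {s : Stmt O V} {μ μ' : Store A V} {b : ExitFlag}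
    (h : Exec μ s b μ') (hs : s.BreaksInLoops) : b = .go := by
  induction h with
  | skip | assign | loop_false | loop_true | brk_false => rfl
  | seq_go _ _ _ ih => exact ih hs.2
  | seq_broken _ ih => exact ih hs.1
  | ite_true _ _ ih => exact ih hs.1
  | ite_false _ _ ih => exact ih hs.2
  | brk_true => exact hs.elim

/-- Safe for-programs compute total functions computable in polynomial time. -/
theorem _root_.Program.Safe.mem_FP {B : Set (Expr O V)}
    (hB : ∀ e ∈ B, ∀ μ : Store A V, e.eval μ ≠ []) {n : ℕ} {P : Program O V n} (hs : P.Safe)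
    (hP : P.IsFor B) {f : (Fin n → Word A) →. Word A} (hf : P.Computes f) : f ∈ FP A n := by
  obtain ⟨Δ, hΔ, τ, Γ, hty⟩ := hs
  -- the subroutines
  let F : Set O.Op := P.body.ops
  have : Finite F := P.body.finite_ops
  have hM (i : F) : Nonempty (TM2ComputableInPolyTime encodeTuple (id : Word A → List A)
      (O.denote i)) :=
    (hΔ i (hty.ops_subset_dom i.2)).2.1
  let C i := (hM i).some
  let M : F → TM2ComputableAux (Option A) A := fun i => (C i).toTM2ComputableAux
  have hM : Implements M := fun i => ⟨(C i).time, fun w => ⟨(C i).outputsFun w⟩⟩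
  -- the variables
  let Xs : Finset V := P.body.vars ∪ Finset.univ.image P.params ∪ {P.ret}
  have hXp (i : Fin n) : P.params i ∈ Xs := by simp [Xs]
  have hXr : P.ret ∈ Xs := by simp [Xs]
  obtain ⟨T, hT⟩ := hty.goodStmt (Xs := Xs) hΔ hM hB (Stmt.IsFor.forLoops hP) (.inl ⟨rfl, rfl⟩)
    (fun x hx => by simp [Xs, hx]) (F := F) subset_rfl
  have hT (w : Fin n → Word A) : ∃ μ' : Store A V, Exec (P.initStore w) P.body .go μ' ∧
      Γ.size 0 μ' ≤ T.eval (Γ.size 0 (P.initStore w)) ∧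
      (compStmt Xs M P.body).Runs (T.eval (Γ.size 0 (P.initStore w))) (ctl false false)
        (mem (P.initStore w) [] [] [] []) (ctl false false) (mem μ' [] [] [] []) := by
    obtain ⟨b, μ', k, h1, h2, h3, h4⟩ := hT (P.initStore w)
    obtain rfl := h1.eq_go_of_breaksInLoops P.body_breaks
    obtain rfl : k = false := by simpa using h2
    exact ⟨μ', h1, h3, h4⟩
  choose μ' hexec hsize hruns using hT
  refine ⟨fun w => μ' w P.ret, ?_, ?_⟩
  swap
  · funext w
    exact Part.eq_some_iff.2 ((hf w _).2 ⟨μ' w, hexec w, rfl⟩)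
  let l : List Xs := Finset.univ.toList
  let N : Polynomial ℕ := Polynomial.X + T.comp (Polynomial.X + 1)
  -- a machine has to halt with all its stacks empty except for the output
  refine polyTime_of_wordMachine (M := M) (X := Reg Xs) _
    (.seq (loadArgs M n fun i => ⟨P.params i, hXp i⟩) <| .seq (compStmt Xs M P.body) <|
      .seq (xfer (.var ⟨P.ret, hXr⟩) .aux) <| .seq (clearVars M l) (emit .aux))
    (ctl false false) .inp (6 * Polynomial.X + T.comp (Polynomial.X + 1) + 6 * N +
      (3 * N + 3) * Polynomial.C l.length + 10) fun w => ?_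
  set L := (encodeTuple w).length with hLdef
  have hinit (x : V) : (P.initStore w x).length ≤ L := by
    by_cases hx : ∃ i, P.params i = x
    · obtain ⟨i, rfl⟩ := hx
      rw [Program.initStore, P.params_injective.extend_apply, hLdef, length_encodeTuple]
      exact (Nat.le_succ _).trans (Finset.single_le_sum (f := fun i => (w i).length + 1)
        (fun _ _ => Nat.zero_le _) (Finset.mem_univ i))
    · rw [Program.initStore, Function.extend_apply' _ _ _ hx]
      simp
  have hL : Γ.size 0 (P.initStore w) ≤ L + 1 :=
    VarEnv.size_le_iff.2 ⟨by omega, fun x _ _ _ => (hinit x).trans (Nat.le_succ _)⟩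
  have hL' := T.eval_le_eval hL
  have hfin (x : V) : (μ' w x).length ≤ N.eval L := by
    simp only [N, Polynomial.eval_add, Polynomial.eval_comp, Polynomial.eval_X, Polynomial.eval_one]
    by_cases hx : x ∈ P.body.vars
    · obtain ⟨τ, hτ⟩ := Option.ne_none_iff_exists'.1 (hty.level_ne_none hx)
      have := VarEnv.length_le_size (μ := μ' w) hτ (Nat.zero_le _)
      have := hsize w
      omega
    · rw [(hexec w).eq_of_notMem_vars hx]
      exact (hinit x).trans (Nat.le_add_right _ _)
  have h1 := runs_loadArgs (M := M) (b := false) (k := false) (Xs := Xs)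
    (c := fun i => ⟨P.params i, hXp i⟩) (fun i j h => P.params_injective (Subtype.ext_iff.1 h)) w
    (μ := fun _ => []) (ν := P.initStore w) (fun _ => rfl)
    (fun i => P.params_injective.extend_apply _ _ i)
    (fun x hx => Function.extend_apply' _ _ _ (by simpa using hx))
  have e : mem (Xs := Xs) (M := M) (fun _ => []) [] [] [] (encodeTuple w) =
      stks [] (Function.update (fun _ => []) .inp (encodeTuple w)) fun _ _ => [] := by
    have : (fun _ => [] : Reg Xs → List (Option A)) = lay (fun _ => []) [] [] [] [] := by
      funext r; rcases r with _ | _ | _ | _ | _ <;> rfl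
    rw [this, update_lay_inp]
    rfl
  rw [e] at h1
  have h2 := runs_xfer_var_aux (M := M) (Xs := Xs) (μ := μ' w) (E := []) (a' := []) (R := [])
    (b := false) (k := false) ⟨P.ret, hXr⟩
  obtain ⟨ν, hν, -, h3⟩ := runs_clearVars (M := M) (b := false) (k := false)
    (a := (μ' w P.ret).reverse.map some) (N := N.eval L) l (Function.update (μ' w) P.ret [])
    (fun x _ => by
      by_cases hx : (x : V) = P.ret
      · rw [hx, Function.update_self]; simp
      · rw [Function.update_of_ne hx]; exact hfin x)
  have h4 := runs_emit (M := M) (X := Reg Xs) .aux (ctl false false) []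
    (lay ν [] ((μ' w P.ret).reverse.map some) [] []) (fun _ _ => []) (μ' w P.ret).reverse rfl
  have e' : lay (Xs := Xs) ν [] [] [] [] = fun _ => [] := by
    funext r
    rcases r with x | _ | _ | _ | _
    · simp [hν x (by simp [l])]
    all_goals rfl
  rw [List.reverse_reverse, List.append_nil, update_lay_aux, e', List.length_reverse] at h4
  refine Runs.mono (Runs.seq h1 (Runs.seq (hruns w) (Runs.seq h2 (Runs.seq h3 h4)))) ?_
  have h5 := hfin P.ret
  simp only [Polynomial.eval_add, Polynomial.eval_mul, Polynomial.eval_comp, Polynomial.eval_X,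
    Polynomial.eval_one, Polynomial.eval_ofNat, Polynomial.eval_C] at hL' ⊢
  omega

end Soundness

end WordMachine

/-! ### Elementary steps of multi-stack machines -/

namespace Elementary

open Turing.TM2 (Stmt)

variable {K Λ σ : Type} {Γ : K → Type} [DecidableEq K]

/-- A configuration in the middle of a machine step: the statement still to be executed (`none` when
the machine has halted), the internal state and the stacks. -/
structure Conf (Γ : K → Type) (Λ σ : Type) where
  stmt : Option (Stmt Γ Λ σ)
  var : σ
  stk : ∀ k, List (Γ k)

/-- Execution of a single instruction. -/
def step (M : Λ → Stmt Γ Λ σ) : Conf Γ Λ σ → Conf Γ Λ σ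
  | ⟨none, v, S⟩ => ⟨none, v, S⟩
  | ⟨some (.push k f q), v, S⟩ => ⟨some q, v, Function.update S k (f v :: S k)⟩
  | ⟨some (.peek k f q), v, S⟩ => ⟨some q, f v (S k).head?, S⟩
  | ⟨some (.pop k f q), v, S⟩ => ⟨some q, f v (S k).head?, Function.update S k (S k).tail⟩
  | ⟨some (.load f q), v, S⟩ => ⟨some q, f v, S⟩
  | ⟨some (.branch p q q'), v, S⟩ => ⟨some (if p v then q else q'), v, S⟩
  | ⟨some (.goto l), v, S⟩ => ⟨some (M (l v)), v, S⟩
  | ⟨some .halt, v, S⟩ => ⟨none, v, S⟩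

/-- A configuration of the machine as an intermediate configuration. -/
def ofCfg (M : Λ → Stmt Γ Λ σ) (c : Turing.TM2.Cfg Γ Λ σ) : Conf Γ Λ σ := ⟨c.l.map M, c.var, c.stk⟩

theorem exists_iterate_stepAux (M : Λ → Stmt Γ Λ σ) (q : Stmt Γ Λ σ) (v : σ) (S : ∀ k, List (Γ k)) :
    ∃ j ≤ WordMachine.stmtCost q, (step M)^[j] ⟨some q, v, S⟩ =
      ofCfg M (Turing.TM2.stepAux q v S) := by
  induction q generalizing v S with
  | push k f q ih =>
    obtain ⟨j, hj, h⟩ := ih v (Function.update S k (f v :: S k))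
    exact ⟨j + 1, Nat.succ_le_succ hj, h⟩
  | peek k f q ih =>
    obtain ⟨j, hj, h⟩ := ih (f v (S k).head?) S
    exact ⟨j + 1, Nat.succ_le_succ hj, h⟩
  | pop k f q ih =>
    obtain ⟨j, hj, h⟩ := ih (f v (S k).head?) (Function.update S k (S k).tail)
    exact ⟨j + 1, Nat.succ_le_succ hj, h⟩
  | load f q ih =>
    obtain ⟨j, hj, h⟩ := ih (f v) S
    exact ⟨j + 1, Nat.succ_le_succ hj, h⟩
  | branch p q q' ih ih' =>
    by_cases hp : p v
    · obtain ⟨j, hj, h⟩ := ih v S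
      refine ⟨j + 1, by simp only [WordMachine.stmtCost]; omega, ?_⟩
      simpa [step, hp, Turing.TM2.stepAux] using h
    · obtain ⟨j, hj, h⟩ := ih' v S
      refine ⟨j + 1, by simp only [WordMachine.stmtCost]; omega, ?_⟩
      simpa [step, hp, Turing.TM2.stepAux] using h
  | goto l => exact ⟨1, le_rfl, rfl⟩
  | halt => exact ⟨1, le_rfl, rfl⟩

theorem exists_iterate_step {M : Λ → Stmt Γ Λ σ} {b : ℕ} (hb : ∀ l, WordMachine.stmtCost (M l) ≤ b)
    {n : ℕ} {c c' : Turing.TM2.Cfg Γ Λ σ}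
    (h : (flip bind (Turing.TM2.step M))^[n] (some c) = some c') :
    ∃ j ≤ n * b, (step M)^[j] (ofCfg M c) = ofCfg M c' := by
  induction n generalizing c with
  | zero =>
    simp only [Function.iterate_zero, id_eq, Option.some.injEq] at h
    exact ⟨0, Nat.zero_le _, by rw [h]; rfl⟩
  | succ n ih =>
    rw [Function.iterate_succ_apply] at h
    obtain ⟨l, v, S⟩ := c
    cases l with
    | none =>
      have e : ∀ n, (flip bind (Turing.TM2.step M))^[n] none = none := fun n => by
        induction n with
        | zero => rfl
        | succ n ih => rw [Function.iterate_succ_apply]; exact ih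
      have : flip bind (Turing.TM2.step M) (some ⟨none, v, S⟩) = none := rfl
      rw [this, e] at h
      cases h
    | some l =>
      obtain ⟨j, hj, h1⟩ := exists_iterate_stepAux M (M l) v S
      obtain ⟨i, hi, h2⟩ := ih h
      refine ⟨i + j, ?_, ?_⟩
      · have := hb l
        rw [Nat.succ_mul]
        omega
      · rw [Function.iterate_add_apply, ← h2, ← h1]
        rfl

/-- The symbol pushed by an instruction. -/
def pushed : Option (Stmt Γ Λ σ) × σ → Option (Σ k, Γ k)
  | (some (.push k f _), v) => some ⟨k, f v⟩
  | _ => none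

/-- The states of the control: the statements to be executed with an internal state. -/
def states [Fintype Λ] (M : Λ → Stmt Γ Λ σ) : Set (Option (Stmt Γ Λ σ) × σ) :=
  {c | c.1 ∈ Turing.TM2.stmts M Finset.univ}

omit [DecidableEq K] in
theorem finite_states [Fintype Λ] [Finite σ] (M : Λ → Stmt Γ Λ σ) : (states M).Finite := by
  refine ((Turing.TM2.stmts M Finset.univ).finite_toSet.prod Set.finite_univ).subset ?_
  exact fun c hc => ⟨hc, Set.mem_univ _⟩

/-- The control of the configuration is one of the states of the machine, and the symbols on its
stacks belong to `G`. -/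
def Conf.Within [Fintype Λ] (M : Λ → Stmt Γ Λ σ) (G : Set (Σ k, Γ k)) (c : Conf Γ Λ σ) : Prop :=
  (c.stmt, c.var) ∈ states M ∧ ∀ k, ∀ γ ∈ c.stk k, (⟨k, γ⟩ : Σ k, Γ k) ∈ G

theorem Conf.Within.step [Fintype Λ] {M : Λ → Stmt Γ Λ σ} {G : Set (Σ k, Γ k)}
    (hG : ∀ s ∈ states M, ∀ γ, pushed s = some γ → γ ∈ G) {c : Conf Γ Λ σ} (hc : c.Within M G) :
    (Elementary.step M c).Within M G := by
  obtain ⟨q, v, S⟩ := c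
  obtain ⟨h1, h2⟩ := hc
  have sub {q q' : Stmt Γ Λ σ} (h : some q ∈ Turing.TM2.stmts M Finset.univ)
      (h' : q' ∈ Turing.TM2.stmts₁ q) : some q' ∈ Turing.TM2.stmts M Finset.univ :=
    Turing.TM2.stmts_trans h' h
  have self (q : Stmt Γ Λ σ) : q ∈ Turing.TM2.stmts₁ q := Turing.TM2.stmts₁_self
  rcases q with _ | (_ | _ | _ | _ | ⟨p, q, q'⟩ | l | _)
  · exact ⟨h1, h2⟩
  · rename_i k f q
    refine ⟨sub h1 (by simp [Turing.TM2.stmts₁, self]), fun k' γ hγ => ?_⟩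
    simp only [Elementary.step] at hγ
    by_cases hk : k' = k
    · subst hk
      rw [Function.update_self] at hγ
      rcases List.mem_cons.1 hγ with rfl | hγ
      exacts [hG _ h1 _ rfl, h2 _ _ hγ]
    · rw [Function.update_of_ne hk] at hγ
      exact h2 _ _ hγ
  · exact ⟨sub h1 (by simp [Turing.TM2.stmts₁, self]), h2⟩
  · rename_i k f q
    refine ⟨sub h1 (by simp [Turing.TM2.stmts₁, self]), fun k' γ hγ => ?_⟩
    simp only [Elementary.step] at hγ
    by_cases hk : k' = k
    · subst hk
      rw [Function.update_self] at hγ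
      exact h2 _ _ (List.mem_of_mem_tail hγ)
    · rw [Function.update_of_ne hk] at hγ
      exact h2 _ _ hγ
  · exact ⟨sub h1 (by simp [Turing.TM2.stmts₁, self]), h2⟩
  · refine ⟨?_, h2⟩
    simp only [Elementary.step]
    split_ifs
    · exact sub h1 (by simp [Turing.TM2.stmts₁, self])
    · exact sub h1 (by simp [Turing.TM2.stmts₁, self])
  · refine ⟨?_, h2⟩
    simp only [Elementary.step, states, Turing.TM2.stmts, Set.mem_ofPred_eq,
      Finset.some_mem_insertNone, Finset.mem_biUnion]
    exact ⟨l v, Finset.mem_univ _, self _⟩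
  · refine ⟨?_, h2⟩
    simp only [Elementary.step, states, Turing.TM2.stmts, Set.mem_ofPred_eq]
    exact Finset.none_mem_insertNone

theorem length_step_le (M : Λ → Stmt Γ Λ σ) (c : Conf Γ Λ σ) (k : K) :
    ((step M c).stk k).length ≤ (c.stk k).length + 1 := by
  obtain ⟨q, v, S⟩ := c
  rcases q with _ | (⟨k', f, q⟩ | _ | ⟨k', f, q⟩ | _ | _ | _ | _) <;> simp only [step] <;>
    try exact Nat.le_succ _
  · by_cases hk : k = k'
    · subst hk; simp
    · simp [hk]
  · by_cases hk : k = k'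
    · subst hk
      simp
      omega
    · simp [hk]

theorem length_iterate_step_le (M : Λ → Stmt Γ Λ σ) (c : Conf Γ Λ σ) (k : K) (j : ℕ) :
    (((step M)^[j] c).stk k).length ≤ (c.stk k).length + j := by
  induction j with
  | zero => rfl
  | succ j ih =>
    rw [Function.iterate_succ_apply']
    exact (length_step_le M _ k).trans (by omega)

theorem iterate_step_of_halted (M : Λ → Stmt Γ Λ σ) {c : Conf Γ Λ σ} (hc : c.stmt = none) (j : ℕ) :
    (step M)^[j] c = c := by
  obtain ⟨q, v, S⟩ := c
  obtain rfl : q = none := hc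
  exact Function.iterate_fixed rfl j

end Elementary

/-- Finitely many objects can be encoded by words of the same length. -/
theorem exists_encoding {A α : Type} [Alphabet A] {s : Set α} (hs : s.Finite) :
    ∃ (d : ℕ) (c : α → Word A), 1 ≤ d ∧ (∀ a, (c a).length = d) ∧ Set.InjOn c s := by
  have := hs.to_subtype
  have := Fintype.ofFinite s
  let d := Fintype.card s + 1
  have h2 : 2 ≤ Fintype.card A :=
    Fintype.one_lt_card_iff.2 ⟨Alphabet.zero, Alphabet.one, Alphabet.zero_ne_one⟩
  have hd : Fintype.card s ≤ Fintype.card (Fin d → A) := by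
    rw [Fintype.card_fun, Fintype.card_fin]
    calc Fintype.card s ≤ d := Nat.le_succ _
      _ ≤ 2 ^ d := Nat.lt_two_pow_self.le
      _ ≤ Fintype.card A ^ d := Nat.pow_le_pow_left h2 d
  obtain ⟨f⟩ := Function.Embedding.nonempty_of_card_le hd
  classical
  refine ⟨d, fun a => if h : a ∈ s then List.ofFn (f ⟨a, h⟩) else List.replicate d Alphabet.one,
    by omega, fun a => ?_, fun a ha b hb hab => ?_⟩
  · dsimp only
    split_ifs
    exacts [List.length_ofFn, List.length_replicate]
  · simp only [ha, hb, dif_pos] at hab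
    simpa using f.injective (List.ofFn_injective hab)

/-- Polynomials are bounded by shifted powers. -/
theorem Polynomial.exists_eval_le_pow (P : Polynomial ℕ) :
    ∃ D, ∀ x, P.eval x ≤ (x + D) ^ D := by
  induction P using Polynomial.induction_on' with
  | add p q hp hq =>
    obtain ⟨D₁, h₁⟩ := hp
    obtain ⟨D₂, h₂⟩ := hq
    refine ⟨D₁ + D₂ + 2, fun x => ?_⟩
    have key : ∀ D, D ≤ D₁ + D₂ → (x + D) ^ D ≤ (x + (D₁ + D₂ + 2)) ^ (D₁ + D₂ + 1) :=
      fun D hD => calc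
        (x + D) ^ D ≤ (x + (D₁ + D₂ + 2)) ^ D := Nat.pow_le_pow_left (by omega) _
        _ ≤ _ := Nat.pow_le_pow_right (by omega) (by omega)
    have k₁ := (h₁ x).trans (key D₁ (by omega))
    have k₂ := (h₂ x).trans (key D₂ (by omega))
    rw [Polynomial.eval_add, pow_succ]
    calc _ ≤ (x + (D₁ + D₂ + 2)) ^ (D₁ + D₂ + 1) * 2 := by omega
      _ ≤ _ := Nat.mul_le_mul_left _ (by omega)
  | monomial n c =>
    refine ⟨c + n + 1, fun x => ?_⟩
    rw [Polynomial.eval_monomial, pow_succ', pow_add]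
    calc c * x ^ n ≤ (x + (c + n + 1)) * (x + (c + n + 1)) ^ n :=
          Nat.mul_le_mul (by omega) (Nat.pow_le_pow_left (by omega) n)
      _ ≤ (x + (c + n + 1)) * ((x + (c + n + 1)) ^ c * (x + (c + n + 1)) ^ n) := by
          gcongr
          exact Nat.le_mul_of_pos_left _ (by positivity)

/-! ### A typing discipline for for-programs -/

namespace Simulation

section Vars

/-- The variables of the simulating program: the parameters, the state of the machine, for each
stack its content and a word to be pushed, an accumulator, two clocks and two counters. -/
inductive Name (n : ℕ) (K : Type) : Type
  | par (i : Fin n)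
  | pc
  | stk (k : K)
  | pre (k : K)
  | acc
  | a
  | b
  | c₁
  | c₂
  deriving DecidableEq

instance {n : ℕ} {K : Type} [Finite K] : Finite (Name n K) := by
  refine Finite.of_surjective (fun p : Fin n ⊕ (K ⊕ K) ⊕ Fin 6 => match p with
    | .inl i => Name.par i
    | .inr (.inl (.inl k)) => .stk k
    | .inr (.inl (.inr k)) => .pre k
    | .inr (.inr j) => (![.pc, .acc, .a, .b, .c₁, .c₂] : Fin 6 → Name n K) j) ?_
  rintro (i | _ | k | k | _ | _ | _ | _ | _)
  exacts [⟨.inl i, rfl⟩, ⟨.inr (.inr 0), rfl⟩, ⟨.inr (.inl (.inl k)), rfl⟩,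
    ⟨.inr (.inl (.inr k)), rfl⟩, ⟨.inr (.inr 1), rfl⟩, ⟨.inr (.inr 2), rfl⟩, ⟨.inr (.inr 3), rfl⟩,
    ⟨.inr (.inr 4), rfl⟩, ⟨.inr (.inr 5), rfl⟩]

/-- The levels of the variables: clocks and counters have level `1`, data level `0`. -/
def Name.level {n : ℕ} {K : Type} : Name n K → ℕ
  | .a | .b | .c₁ | .c₂ => 1
  | _ => 0

end Vars

section Typing

variable {A : Type} [Alphabet A] {O : ExtraOps A}

/-- The operator environment of simulating programs: data at level `0`, and the guards and
decrements of for loops at level `1`. Constants are positive in general, and so have level `0` in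
loops of level `1`, but the lower bound `1` of the for loops is neutral. -/
def opEnv (O : ExtraOps A) : OpEnv O where
  typ o l m := match o with
    | .inl .eq | .inl .hd | .inl .tl | .inl .app => {p | p = (fun _ => 0, 0) ∧ l = m ∧ l ≤ 1}
    | .inl .le | .inl .decr => {p | p = (fun _ => 1, 1) ∧ l = m ∧ l = 1}
    | .inl (.const w) => {p | (p.2 = 0 ∨ p.2 = 1 ∧ w = tt1) ∧ l = m ∧ l ≤ 1}
    | _ => ∅
  finite_map o := by
    have : {p : ℕ × ℕ | p.1 = p.2 ∧ p.1 ≤ 1}.Finite :=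
      ((Set.finite_Iic 1).prod (Set.finite_Iic 1)).subset fun p hp =>
        ⟨hp.2, show p.2 ≤ 1 from hp.1 ▸ hp.2⟩
    refine this.subset ?_
    rintro ⟨l, m⟩ ⟨p, hp⟩
    rcases o with (_ | _ | _ | _ | _ | _ | _ | _ | _ | _ | _ | _) | _
    all_goals first
      | exact hp.elim
      | exact hp.2
      | exact ⟨hp.2.1, hp.2.2.le⟩

omit [Alphabet A] in
theorem isPositive_of_length_le {k : ℕ} {f : (Fin k → Word A) → Word A} (c : ℕ) (i : Fin k)
    (h : ∀ w, (f w).length ≤ (w i).length + c) : IsPositive f :=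
  ⟨c, fun w => (h w).trans (Nat.add_le_add_right
    (Finset.le_sup (f := fun i => (w i).length) (Finset.mem_univ i)) c)⟩

theorem length_ofProp (p : Prop) : (ofProp p : Word A).length = 1 := by
  classical
  unfold ofProp
  split_ifs <;> rfl

theorem decr_infix (w : Word A) : decr w <:+: w := by
  unfold decr
  split_ifs with h
  · rw [h]
    refine ⟨[], [Alphabet.one].take w.length, ?_⟩
    rcases hn : w.length with _ | n
    · simp [unary]
    · simp [unary, List.replicate_succ']
  · exact List.nil_infix

theorem opEnv_safe (O : ExtraOps A) : (opEnv O).Safe := by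
  -- the requirements on the types of an operator that increases lengths by a constant at most
  have key : ∀ o : O.Op, IsPositive (O.denote o) → PolyTime (O.denote o) →
      (∀ l m a r, (a, r) ∈ (opEnv O).typ o l m →
        (∀ i, r ≤ a i) ∧ (¬ IsNeutral (O.denote o) → r = 0)) →
      (IsNeutral (O.denote o) ∨ IsPositive (O.denote o) ∨ IsPolynomial (O.denote o)) ∧
      PolyTime (O.denote o) ∧ ∀ l m a r, (a, r) ∈ (opEnv O).typ o l m →
        (IsNeutral (O.denote o) → ∀ i, r ≤ a i) ∧
        (IsPositive (O.denote o) → ¬ IsNeutral (O.denote o) →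
          (∀ i, r ≤ a i) ∧ (r < l ∨ r = 0)) ∧
        (IsPolynomial (O.denote o) → ¬ IsPositive (O.denote o) → m = 0) :=
    fun o h1 h2 h3 => ⟨.inr (.inl h1), h2, fun l m a r h => ⟨fun _ => (h3 l m a r h).1,
      fun _ hn => ⟨(h3 l m a r h).1, .inr ((h3 l m a r h).2 hn)⟩, fun _ h => absurd h1 h⟩⟩
  have le0 : ∀ {k : ℕ} {a : Fin k → ℕ} {r : ℕ} {l m : ℕ} {N : Prop},
      (a, r) = (fun _ => 0, 0) ∧ l = m ∧ l ≤ 1 → (∀ i, r ≤ a i) ∧ (N → r = 0) := by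
    rintro k a r l m N ⟨h, -⟩
    simp only [Prod.mk.injEq] at h
    exact ⟨fun i => by omega, fun _ => h.2⟩
  rintro o ⟨l₀, m₀, p, hp⟩
  rcases o with (_ | _ | _ | w | _ | _ | _ | _ | _ | _ | _ | _) | _
  case inr => exact hp.elim
  case inl.lt => exact hp.elim
  case inl.incr => exact hp.elim
  case inl.not => exact hp.elim
  case inl.and => exact hp.elim
  case inl.or => exact hp.elim
  case inl.eq =>
    refine key _ ⟨1, fun w => ?_⟩ WordMachine.polyTime_eq fun l m a r h => le0 h
    exact (length_ofProp _).le.trans (Nat.le_add_left _ _)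
  case inl.hd =>
    refine key _ (isPositive_of_length_le 0 (0 : Fin 1) fun w => ?_) WordMachine.polyTime_hd
      fun l m a r h => le0 h
    exact (List.length_take_le' _ _)
  case inl.tl =>
    refine key _ (isPositive_of_length_le 0 (0 : Fin 1) fun w => ?_) WordMachine.polyTime_tl
      fun l m a r h => le0 h
    exact (List.length_tail.trans_le (Nat.sub_le _ _))
  case inl.app =>
    refine key _ (isPositive_of_length_le 1 (0 : Fin 2) fun w => ?_) WordMachine.polyTime_app
      fun l m a r h => le0 h
    change (appendChar (w (0 : Fin 2)) (w (1 : Fin 2))).length ≤ _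
    unfold appendChar
    split_ifs with h
    · rw [List.length_append, h]
    · simp
  case inl.const =>
    refine key _ ⟨w.length, fun _ => Nat.le_add_left _ _⟩ (WordMachine.polyTime_const w)
      fun l m a r h => ⟨fun i => i.elim0, fun hn => ?_⟩
    rcases h.1 with h | ⟨-, h⟩
    · exact h
    · exact absurd (.inl fun _ => .inr h) hn
  case inl.le =>
    refine key _ ⟨1, fun w => ?_⟩ WordMachine.polyTime_le fun l m a r h => ?_
    · exact (length_ofProp _).le.trans (Nat.le_add_left _ _)
    · obtain ⟨h, -⟩ := h
      simp only [Prod.mk.injEq] at h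
      exact ⟨fun i => by rw [h.1, h.2], fun hn => absurd isNeutral_le hn⟩
  case inl.decr =>
    refine key _ (isPositive_of_length_le 0 (0 : Fin 1) fun w => (decr_infix _).length_le)
      WordMachine.polyTime_decr fun l m a r h => ?_
    obtain ⟨h, -⟩ := h
    simp only [Prod.mk.injEq] at h
    exact ⟨fun i => by rw [h.1, h.2], fun hn =>
      absurd (.inr ⟨(0 : Fin 1), fun w => decr_infix _⟩) hn⟩

variable {V : Type} {n : ℕ} {K : Type} (v : Name n K → V)

/-- The variable environment of simulating programs, where `v` assigns variables to names. -/
noncomputable def varEnv [Finite K] : VarEnv V where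
  level := Function.extend v (fun x => some x.level) fun _ => none
  finite_dom := by
    refine (Set.finite_range v).subset fun x hx => ?_
    by_contra h
    exact hx (Function.extend_apply' _ _ _ h)

variable {v}

theorem level_varEnv [Finite K] (hv : Function.Injective v) (x : Name n K) :
    (varEnv v).level (v x) = some x.level :=
  hv.extend_apply (fun x : Name n K => some x.level) (fun _ => none) x

/-- The test `e₁ = e₂`. -/
def eqE (e₁ e₂ : Expr O V) : Expr O V := .op (.inl .eq) (![e₁, e₂] : Fin 2 → Expr O V)

/-- The first letter of a word. -/
def hdE (e : Expr O V) : Expr O V := .op (.inl .hd) (![e] : Fin 1 → Expr O V)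

/-- The word without its first letter. -/
def tlE (e : Expr O V) : Expr O V := .op (.inl .tl) (![e] : Fin 1 → Expr O V)

/-- The word `e₁` extended by the letter `e₂`. -/
def appE (e₁ e₂ : Expr O V) : Expr O V := .op (.inl .app) (![e₁, e₂] : Fin 2 → Expr O V)

/-- The word without its first `d` letters. -/
def dropE (e : Expr O V) : ℕ → Expr O V
  | 0 => e
  | d + 1 => tlE (dropE e d)

/-- The first `d` letters of a word. -/
def takeE (e : Expr O V) : ℕ → Expr O V
  | 0 => constExpr []
  | d + 1 => appE (takeE e d) (hdE (dropE e d))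

/-- The word extended by the word `u`. -/
def extE (e : Expr O V) : Word A → Expr O V
  | [] => e
  | c :: u => extE (appE e (constExpr [c])) u

section Eval

variable {μ : Store A V} {e e₁ e₂ : Expr O V}

@[simp] theorem eval_constExpr (w : Word A) : (constExpr w : Expr O V).eval μ = w := rfl

theorem eval_eqE : (eqE e₁ e₂).eval μ = tt1 ↔ e₁.eval μ = e₂.eval μ := ofProp_eq_tt1

@[simp] theorem eval_hdE : (hdE e).eval μ = (e.eval μ).take 1 := rfl

@[simp] theorem eval_tlE : (tlE e).eval μ = (e.eval μ).tail := rfl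

@[simp] theorem eval_appE : (appE e₁ e₂).eval μ = appendChar (e₁.eval μ) (e₂.eval μ) := rfl

@[simp] theorem eval_dropE (d : ℕ) : (dropE e d).eval μ = (e.eval μ).drop d := by
  induction d with
  | zero => rfl
  | succ d ih => simp [dropE, ih]

theorem eval_takeE {d : ℕ} (hd : d ≤ (e.eval μ).length) :
    (takeE e d).eval μ = (e.eval μ).take d := by
  induction d with
  | zero => rfl
  | succ d ih =>
    have h1 : ((e.eval μ).drop d).take 1 = [(e.eval μ)[d]] := by
      rw [List.drop_eq_getElem_cons (by omega)]
      rfl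
    simp only [takeE, eval_appE, ih (by omega), eval_hdE, eval_dropE, h1, appendChar,
      List.length_singleton, if_true]
    rw [List.take_append_getElem]

theorem eval_takeE_nil {d : ℕ} (h : e.eval μ = []) : (takeE e d).eval μ = [] := by
  cases d with
  | zero => rfl
  | succ d => simp [takeE, h, appendChar]

@[simp] theorem eval_extE (u : Word A) : (extE e u).eval μ = e.eval μ ++ u := by
  induction u generalizing e with
  | nil => simp [extE]
  | cons c u ih => simp [extE, ih, appendChar]

end Eval

/-- `Low v e`: the expression is built from data variables by data operators. -/
def Low [Finite K] (v : Name n K → V) (e : Expr O V) : Prop :=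
  ∀ l ≤ 1, ExprTy (varEnv v) (opEnv O) l l e 0

section Low

variable [Finite K] {e e₁ e₂ : Expr O V}

theorem low_var (hv : Function.Injective v) {x : Name n K} (hx : x.level = 0) :
    Low (O := O) v (.var (v x)) :=
  fun _ _ => .var (by rw [level_varEnv hv, hx])

theorem low_const (w : Word A) : Low (O := O) v (constExpr w) :=
  fun _ hl => .op (a := Fin.elim0) ⟨.inl rfl, rfl, hl⟩ fun i => i.elim0

theorem low_eqE (h₁ : Low v e₁) (h₂ : Low v e₂) : Low v (eqE e₁ e₂) := fun l hl =>
  .op (a := fun _ => 0) ⟨rfl, rfl, hl⟩ fun (i : Fin 2) => by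
    fin_cases i
    exacts [h₁ l hl, h₂ l hl]

theorem low_appE (h₁ : Low v e₁) (h₂ : Low v e₂) : Low v (appE e₁ e₂) := fun l hl =>
  .op (a := fun _ => 0) ⟨rfl, rfl, hl⟩ fun (i : Fin 2) => by
    fin_cases i
    exacts [h₁ l hl, h₂ l hl]

theorem low_hdE (h : Low v e) : Low v (hdE e) := fun l hl =>
  .op (a := fun _ => 0) ⟨rfl, rfl, hl⟩ fun (i : Fin 1) => by
    fin_cases i
    exact h l hl

theorem low_tlE (h : Low v e) : Low v (tlE e) := fun l hl =>
  .op (a := fun _ => 0) ⟨rfl, rfl, hl⟩ fun (i : Fin 1) => by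
    fin_cases i
    exact h l hl

theorem low_dropE (h : Low v e) (d : ℕ) : Low v (dropE e d) := by
  induction d with
  | zero => exact h
  | succ d ih => exact low_tlE ih

theorem low_takeE (h : Low v e) (d : ℕ) : Low v (takeE e d) := by
  induction d with
  | zero => exact low_const _
  | succ d ih => exact low_appE ih (low_hdE (low_dropE h d))

theorem low_extE (h : Low v e) (u : Word A) : Low v (extE e u) := by
  induction u generalizing e with
  | nil => exact h
  | cons c u ih => exact ih (low_appE h (low_const _))

end Low

variable [DecidableEq V] {B : Set (Expr O V)}

/-- Statements of for-programs that are typable at level `τ` for the innermost and outermost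
level `l`. -/
structure Ok [Finite K] (v : Name n K → V) (B : Set (Expr O V)) (l τ : ℕ) (s : Stmt O V) :
    Prop where
  ty : StmtTy (varEnv v) (opEnv O) l l s τ
  isFor : s.IsFor B
  breaks : s.BreaksInLoops

namespace Ok

variable [Finite K] {l τ : ℕ} {s s₁ s₂ : Stmt O V}

theorem mono {τ' : ℕ} (h : Ok v B l τ s) (hτ : τ ≤ τ') : Ok v B l τ' s :=
  ⟨.sub h.ty hτ, h.isFor, h.breaks⟩

theorem skip : Ok v B l τ (.skip : Stmt O V) :=
  ⟨.sub .skip (Nat.zero_le _), .skip, trivial⟩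

theorem seq (h₁ : Ok v B l τ s₁) (h₂ : Ok v B l τ s₂) : Ok v B l τ (.seq s₁ s₂) :=
  ⟨.seq h₁.ty h₂.ty, .seq h₁.isFor h₂.isFor, h₁.breaks, h₂.breaks⟩

/-- Outside all loops, data may be moved to variables of level `1`. -/
theorem assign_top (hv : Function.Injective v) {x : Name n K} {e : Expr O V} {τ : ℕ}
    (he : ExprTy (varEnv v) (opEnv O) 0 0 e τ) : Ok v B 0 1 (.assign (v x) e) :=
  ⟨.sub (.assign (level_varEnv hv x) he (.inl rfl)) (by cases x <;> simp [Name.level]),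
    .assign _ _, trivial⟩

omit [DecidableEq V] in
theorem guard (hv : Function.Injective v) {x : Name n K} (hx : x.level = 1) :
    ExprTy (varEnv v) (opEnv O) 1 1 (geExpr (v x) (constExpr [Alphabet.one])) 1 :=
  .op (a := fun _ => 1) ⟨rfl, rfl, rfl⟩ fun (i : Fin 2) => by
    fin_cases i
    · exact .op (a := Fin.elim0) ⟨.inr ⟨rfl, rfl⟩, rfl, le_rfl⟩ fun i => i.elim0
    · exact .var (by rw [level_varEnv hv, hx])

omit [DecidableEq V] in
theorem decr (hv : Function.Injective v) {x : Name n K} (hx : x.level = 1) :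
    StmtTy (varEnv v) (opEnv O) 1 1 (decrStmt (v x)) 1 := by
  have h : (varEnv v).level (v x) = some 1 := by rw [level_varEnv hv, hx]
  refine .assign (τ₂ := 1) h (.op (a := fun _ => 1) ⟨rfl, rfl, rfl⟩ fun (i : Fin 1) => ?_)
    (.inr le_rfl)
  fin_cases i
  exact .var h

/-- For loops outside all loops. -/
theorem for_top (hB : constExpr [Alphabet.one] ∈ B) (hv : Function.Injective v) {x : Name n K}
    (hx : x.level = 1) {d : Expr O V} {τ : ℕ} (hd : ExprTy (varEnv v) (opEnv O) 0 0 d τ)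
    (hs : Ok v B 1 1 s) (hxs : v x ∉ s.vars) :
    Ok v B 0 1 (forStmt (v x) (constExpr [Alphabet.one]) d s) :=
  ⟨.seq (assign_top (B := B) hv hd).ty (.outer_loop (guard hv hx) (.seq hs.ty (decr hv hx)) le_rfl),
    .for_loop hB hxs hs.isFor, trivial, trivial⟩

/-- For loops inside loops. -/
theorem for_inner (hB : constExpr [Alphabet.one] ∈ B) (hv : Function.Injective v) {x y : Name n K}
    (hx : x.level = 1) (hy : y.level = 1) (hs : Ok v B 1 1 s) (hxs : v x ∉ s.vars) :
    Ok v B 1 1 (forStmt (v x) (constExpr [Alphabet.one]) (.var (v y)) s) :=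
  ⟨.seq (.assign (τ₂ := 1) (by rw [level_varEnv hv, hx]) (.var (by rw [level_varEnv hv, hy]))
    (.inr le_rfl)) (.inner_loop (guard hv hx) (.seq hs.ty (decr hv hx)) le_rfl le_rfl),
    .for_loop hB hxs hs.isFor, trivial, trivial⟩

end Ok

/-- Statements that contain no loops and work on data only. -/
structure Data [Finite K] (v : Name n K → V) (B : Set (Expr O V)) (s : Stmt O V) : Prop where
  typable : ∀ l ≤ 1, Ok v B l 0 s
  level_eq_zero : ∀ x, v x ∈ s.vars → x.level = 0

section Data

variable [Finite K] {s s₁ s₂ : Stmt O V}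

theorem level_eq_zero_of_exprTy (hv : Function.Injective v) {e : Expr O V}
    (he : ExprTy (varEnv v) (opEnv O) 0 0 e 0) {x : Name n K} (hx : v x ∈ e.vars) :
    x.level = 0 := by
  have key : ∀ {e : Expr O V} {l m τ : ℕ}, ExprTy (varEnv v) (opEnv O) l m e τ → l = 0 → m = 0 →
      τ = 0 → v x ∈ e.vars → x.level = 0 := by
    intro e l m τ he
    induction he with
    | var h =>
      rintro - - rfl hx
      simp only [Expr.vars, Finset.mem_singleton] at hx
      rwa [← hx, level_varEnv hv, Option.some.injEq] at h
    | @op o args a r ho hargs ih =>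
      rintro rfl rfl rfl hx
      simp only [Expr.vars, Finset.mem_biUnion] at hx
      obtain ⟨i, -, hi⟩ := hx
      refine ih i rfl rfl ?_ hi
      rcases o with (_ | _ | _ | w | _ | _ | _ | _ | _ | _ | _ | _) | _
      all_goals first
        | exact ho.elim
        | exact i.elim0
        | exact absurd ho.2.2 (by omega)
        | exact congrFun (congrArg Prod.fst ho.1) i
    | declass _ _ h _ ih₁ ih₂ =>
      rintro rfl rfl rfl hx
      simp only [Expr.vars, Finset.mem_union] at hx
      exact hx.elim (ih₁ rfl rfl (by omega)) (ih₂ rfl rfl rfl)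
  exact key he rfl rfl rfl hx

theorem Data.ok (h : Data v B s) {l τ : ℕ} (hl : l ≤ 1) : Ok v B l τ s :=
  (h.typable l hl).mono (Nat.zero_le _)

theorem data_skip : Data v B (.skip : Stmt O V) :=
  ⟨fun _ _ => .skip, by simp [Stmt.vars]⟩

theorem Data.seq (h₁ : Data v B s₁) (h₂ : Data v B s₂) : Data v B (.seq s₁ s₂) :=
  ⟨fun l hl => (h₁.ok hl).seq (h₂.ok hl), fun x hx => by
    simp only [Stmt.vars, Finset.mem_union] at hx
    exact hx.elim (h₁.2 x) (h₂.2 x)⟩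

theorem Data.ite (hv : Function.Injective v) {e : Expr O V} (he : Low v e) (h₁ : Data v B s₁)
    (h₂ : Data v B s₂) : Data v B (.ite e s₁ s₂) :=
  ⟨fun l hl => ⟨.ite (he l hl) (h₁.1 l hl).ty (h₂.1 l hl).ty,
    .ite e (h₁.1 l hl).isFor (h₂.1 l hl).isFor, (h₁.1 l hl).breaks, (h₂.1 l hl).breaks⟩,
    fun x hx => by
      simp only [Stmt.vars, Finset.mem_union] at hx
      rcases hx with (hx | hx) | hx
      exacts [level_eq_zero_of_exprTy hv (he 0 zero_le_one) hx, h₁.2 x hx, h₂.2 x hx]⟩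

theorem data_assign (hv : Function.Injective v) {x : Name n K} {e : Expr O V} (hx : x.level = 0)
    (he : Low v e) : Data v B (.assign (v x) e) :=
  ⟨fun l hl => ⟨.assign (by rw [level_varEnv hv, hx]) (he l hl) (.inr le_rfl), .assign _ _,
      trivial⟩,
    fun y hy => by
      simp only [Stmt.vars, Finset.mem_union, Finset.mem_singleton] at hy
      rcases hy with hy | hy
      · rwa [hv hy]
      · exact level_eq_zero_of_exprTy hv (he 0 zero_le_one) hy⟩

end Data

end Typing

end Simulation

/-! ### Execution of simulating programs -/

namespace Simulation

variable {A : Type} [Alphabet A] {O : ExtraOps A} {V : Type} {n : ℕ} {K : Type}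
  {v : Name n K → V}

/-- The store with given values of the variables of the simulating program. -/
noncomputable def sto (v : Name n K → V) (S : Name n K → Word A) : Store A V :=
  Function.extend v S fun _ => []

omit [Alphabet A] in
theorem sto_apply (hv : Function.Injective v) (S : Name n K → Word A) (x : Name n K) :
    sto v S (v x) = S x :=
  hv.extend_apply S (fun _ => []) x

variable [DecidableEq V] [DecidableEq K]

omit [Alphabet A] in
theorem update_sto (hv : Function.Injective v) (S : Name n K → Word A) (x : Name n K)
    (w : Word A) : Function.update (sto v S) (v x) w = sto v (Function.update S x w) := by
  funext y
  by_cases hy : ∃ z, v z = y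
  · obtain ⟨z, rfl⟩ := hy
    rw [sto_apply hv]
    by_cases h : z = x
    · subst h; simp
    · rw [Function.update_of_ne h, Function.update_of_ne (fun e => h (hv e)), sto_apply hv]
  · have : y ≠ v x := fun e => hy ⟨x, e.symm⟩
    rw [Function.update_of_ne this, sto, sto, Function.extend_apply' _ _ _ hy,
      Function.extend_apply' _ _ _ hy]

/-- Normal termination of a statement on stores of the simulating program. -/
def Does (v : Name n K → V) (s : Stmt O V) (S S' : Name n K → Word A) : Prop :=
  Exec (sto v S) s .go (sto v S')

omit [DecidableEq K] in
theorem Does.seq {s₁ s₂ : Stmt O V} {S S' S'' : Name n K → Word A} (h₁ : Does v s₁ S S')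
    (h₂ : Does v s₂ S' S'') : Does v (.seq s₁ s₂) S S'' :=
  .seq_go h₁ h₂

omit [DecidableEq K] in
theorem does_skip (S : Name n K → Word A) : Does (O := O) v .skip S S := .skip _

theorem does_assign (hv : Function.Injective v) {x : Name n K} {e : Expr O V}
    {S : Name n K → Word A} {w : Word A} (he : e.eval (sto v S) = w) :
    Does v (.assign (v x) e) S (Function.update S x w) := by
  have := Exec.assign (sto v S) (v x) e
  rwa [update_sto hv, he] at this

omit [DecidableEq V] in
theorem decr_unary (m : ℕ) : decr (unary m : Word A) = unary (m - 1) := by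
  simp [decr, unary]

omit [DecidableEq V] in
theorem one_le_unary_succ (m : ℕ) : ShortlexLE ([Alphabet.one] : Word A) (unary (m + 1)) := by
  rcases m with _ | m
  · exact .inl rfl
  · refine .inr (List.Shortlex.of_length_lt ?_)
    simp [unary]

/-- The rule for for loops: `M j` describes the store after `j` iterations, up to the value of the
counter. -/
theorem does_for (hv : Function.Injective v) {x : Name n K} {d : Expr O V} {s : Stmt O V} {N : ℕ}
    {S : Name n K → Word A} (M : ℕ → Name n K → Word A) (hd : d.eval (sto v S) = unary N)
    (h0 : M 0 = S) (hs : ∀ j < N, ∀ c, Does v s (Function.update (M j) x c)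
      (Function.update (M (j + 1)) x c)) :
    Does v (forStmt (v x) (constExpr [Alphabet.one]) d s) S (Function.update (M N) x []) := by
  have key : ∀ m j, m + j = N → Does v (.loop (geExpr (v x) (constExpr [Alphabet.one]))
      (.seq s (decrStmt (v x)))) (Function.update (M j) x (unary m))
        (Function.update (M N) x []) := by
    intro m
    induction m with
    | zero =>
      intro j hj
      obtain rfl : j = N := by omega
      refine .loop_false fun h => ?_
      refine ne_nil_of_geExpr (by simp) h ?_
      rw [sto_apply hv]
      simp [unary]
    | succ m ih =>
      intro j hj
      refine .loop_true ?_ (.seq_go (.seq_go (hs j (by omega) _) ?_) (ih (j + 1) (by omega)))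
      · rw [eval_geExpr, sto_apply hv, Function.update_self]
        exact one_le_unary_succ m
      · have := does_assign (O := O) hv (x := x) (e := .op (.inl .decr) (![.var (v x)] :
          Fin 1 → Expr O V)) (S := Function.update (M (j + 1)) x (unary (m + 1))) (w := unary m) (by
            change decr (sto v _ (v x)) = _
            rw [sto_apply hv, Function.update_self, decr_unary]
            rfl)
        rw [Function.update_idem] at this
        exact this
  subst h0
  exact .seq_go (does_assign hv hd) (key N 0 rfl)

/-- A case distinction: the first alternative whose guard is true is executed, or `s` if there is
none. -/
def chain {ι : Type} (g : ι → Expr O V) (t : ι → Stmt O V) (s : Stmt O V) : List ι → Stmt O V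
  | [] => s
  | i :: l => .ite (g i) (t i) (chain g t s l)

omit [DecidableEq K] in
theorem does_chain {ι : Type} {g : ι → Expr O V} {t : ι → Stmt O V} {s : Stmt O V} {l : List ι}
    {S S' : Name n K → Word A} {i : ι} (hi : i ∈ l) (hg : (g i).eval (sto v S) = tt1)
    (hu : ∀ j ∈ l, (g j).eval (sto v S) = tt1 → j = i) (h : Does v (t i) S S') :
    Does v (chain g t s l) S S' := by
  induction l with
  | nil => simp at hi
  | cons j l ih =>
    by_cases hj : (g j).eval (sto v S) = tt1
    · obtain rfl := hu j (by simp) hj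
      exact .ite_true hj h
    · refine .ite_false hj (ih ?_ fun j hj => hu j (by simp [hj]))
      rcases List.mem_cons.1 hi with rfl | hi
      exacts [absurd hg hj, hi]

omit [DecidableEq K] in
theorem does_chain_default {ι : Type} {g : ι → Expr O V} {t : ι → Stmt O V} {s : Stmt O V}
    {l : List ι} {S S' : Name n K → Word A} (hg : ∀ j ∈ l, (g j).eval (sto v S) ≠ tt1)
    (h : Does v s S S') : Does v (chain g t s l) S S' := by
  induction l with
  | nil => exact h
  | cons j l ih => exact .ite_false (hg j (by simp)) (ih fun j hj => hg j (by simp [hj]))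

omit [DecidableEq K] in
theorem data_chain [Finite K] {B : Set (Expr O V)} (hv : Function.Injective v) {ι : Type}
    {g : ι → Expr O V} {t : ι → Stmt O V} {s : Stmt O V} {l : List ι} (hg : ∀ i, Low v (g i))
    (ht : ∀ i, Data v B (t i)) (hs : Data v B s) : Data v B (chain g t s l) := by
  induction l with
  | nil => exact hs
  | cons i l ih => exact .ite hv (hg i) (ht i) ih

/-- A sequence of statements. -/
def seqs {ι : Type} (t : ι → Stmt O V) : List ι → Stmt O V
  | [] => .skip
  | i :: l => .seq (t i) (seqs t l)

omit [DecidableEq K] in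
theorem ok_seqs [Finite K] {B : Set (Expr O V)} {ι : Type} {t : ι → Stmt O V} {l : List ι}
    {m τ : ℕ} (ht : ∀ i, Ok v B m τ (t i)) : Ok v B m τ (seqs t l) := by
  induction l with
  | nil => exact .skip
  | cons i l ih => exact (ht i).seq ih

omit [Alphabet A] [DecidableEq K] in
theorem notMem_vars_seqs {ι : Type} {t : ι → Stmt O V} {l : List ι} {x : V}
    (h : ∀ i, x ∉ (t i).vars) : x ∉ (seqs t l).vars := by
  induction l with
  | nil => simp [seqs, Stmt.vars]
  | cons i l ih => simp [seqs, Stmt.vars, h i, ih]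

section Transfer

variable {ι : Type} (d : ℕ) (c u : ι → Word A) (l : List ι)

/-- Replace the block `c i` at the front of `x` by the word `u i` at the end of `y`. -/
def transferStep (x y : V) : Stmt O V :=
  .seq (chain (fun i => eqE (takeE (.var x) d) (constExpr (c i)))
    (fun i => .assign y (extE (.var y) (u i))) .skip l) (.assign x (dropE (.var x) d))

/-- Replace all the blocks on `x`. The clock `t` bounds the number of the blocks, and `z` is a
counter. -/
def transfer (z t x y : V) : Stmt O V :=
  forStmt z (constExpr [Alphabet.one]) (.var t) (transferStep d c u l x y)

variable {d c u l}

omit [DecidableEq K] in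
theorem data_transferStep [Finite K] {B : Set (Expr O V)} (hv : Function.Injective v)
    {x y : Name n K} (hx : x.level = 0) (hy : y.level = 0) :
    Data v B (transferStep d c u l (v x) (v y)) :=
  .seq (data_chain hv (fun _ => low_eqE (low_takeE (low_var hv hx) _) (low_const _))
    (fun _ => data_assign hv hy (low_extE (low_var hv hy) _)) data_skip)
    (data_assign hv hx (low_dropE (low_var hv hx) _))

theorem does_transferStep_cons (hv : Function.Injective v) {x y : Name n K} (hxy : x ≠ y)
    (hc : ∀ i ∈ l, (c i).length = d) (hinj : ∀ i ∈ l, ∀ j ∈ l, c i = c j → i = j) {i : ι}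
    (hi : i ∈ l) {w : Word A} {S : Name n K → Word A} (hS : S x = c i ++ w) :
    Does (O := O) v (transferStep d c u l (v x) (v y)) S
      (Function.update (Function.update S x w) y (S y ++ u i)) := by
  have h1 : (takeE (.var (v x)) d : Expr O V).eval (sto v S) = c i := by
    have e : (Expr.var (v x) : Expr O V).eval (sto v S) = c i ++ w := by
      rw [Expr.eval, sto_apply hv, hS]
    rw [eval_takeE (by rw [e, List.length_append, hc i hi]; omega), e, ← hc i hi, List.take_left]
  refine Does.seq (does_chain hi ?_ (fun j hj hg => ?_) (does_assign (w := S y ++ u i) hv ?_)) ?_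
  · rw [eval_eqE, h1]; rfl
  · rw [eval_eqE, h1] at hg
    exact (hinj i hi j hj hg).symm
  · rw [eval_extE, Expr.eval, sto_apply hv]
  · rw [Function.update_comm hxy]
    refine does_assign (O := O) hv ?_
    rw [eval_dropE, Expr.eval, sto_apply hv, Function.update_of_ne hxy, hS, ← hc i hi,
      List.drop_left]

theorem does_transferStep_nil (hv : Function.Injective v) {x y : Name n K}
    (hd : 1 ≤ d) (hc : ∀ i ∈ l, (c i).length = d) {S : Name n K → Word A} (hS : S x = []) :
    Does (O := O) v (transferStep d c u l (v x) (v y)) S S := by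
  have e : (Expr.var (v x) : Expr O V).eval (sto v S) = [] := by
    rw [Expr.eval, sto_apply hv, hS]
  refine Does.seq (does_chain_default (fun j hj hg => ?_) (does_skip S)) ?_
  · rw [eval_eqE, eval_takeE_nil e] at hg
    have hg : [] = c j := hg
    have := hc j hj
    rw [← hg, List.length_nil] at this
    omega
  · have := does_assign (O := O) hv (x := x) (e := dropE (.var (v x)) d) (S := S) (w := [])
      (by rw [eval_dropE, e, List.drop_nil])
    rwa [← hS, Function.update_eq_self] at this

theorem does_transfer (hv : Function.Injective v) {x y z t : Name n K} (hxy : x ≠ y) (hzx : z ≠ x)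
    (hzy : z ≠ y) (hd : 1 ≤ d) (hc : ∀ i ∈ l, (c i).length = d)
    (hinj : ∀ i ∈ l, ∀ j ∈ l, c i = c j → i = j) {s : List ι} (hs : ∀ i ∈ s, i ∈ l) {N : ℕ}
    {S : Name n K → Word A} (ht : S t = unary N) (hN : s.length ≤ N) (hS : S x = s.flatMap c) :
    Does (O := O) v (transfer d c u l (v z) (v t) (v x) (v y)) S
      (Function.update (Function.update (Function.update S x []) y (S y ++ s.flatMap u)) z []) := by
  have := does_for (O := O) hv (x := z) (d := .var (v t)) (s := transferStep d c u l (v x) (v y))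
    (N := N) (S := S) (fun j => Function.update (Function.update S x ((s.drop j).flatMap c)) y
      (S y ++ (s.take j).flatMap u)) (by rw [Expr.eval, sto_apply hv, ht]) (by simp [← hS]) ?_
  · rw [List.drop_of_length_le hN, List.take_of_length_le hN] at this
    exact this
  · intro j hj w
    by_cases hjs : j < s.length
    · have h1 : s.drop j = s[j] :: s.drop (j + 1) := List.drop_eq_getElem_cons hjs
      have h2 : s.take (j + 1) = s.take j ++ [s[j]] := (List.take_append_getElem hjs).symm
      have h3 := does_transferStep_cons (O := O) (u := u) hv hxy hc hinj (hs _
          (List.getElem_mem hjs))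
        (w := (s.drop (j + 1)).flatMap c) (S := Function.update
          (Function.update (Function.update S x
          ((s.drop j).flatMap c)) y (S y ++ (s.take j).flatMap u)) z w)
        (by rw [Function.update_of_ne hzx.symm, Function.update_of_ne hxy, Function.update_self, h1,
          List.flatMap_cons])
      convert h3 using 1
      funext r
      by_cases hr : r = z
      · subst hr; simp [hzx, hzy]
      by_cases hr' : r = y
      · subst hr'
        rw [Function.update_of_ne hr, Function.update_self, Function.update_self,
          Function.update_of_ne hr, Function.update_self, h2, List.flatMap_append,
          List.flatMap_singleton, List.append_assoc]
      by_cases hr'' : r = x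
      · subst hr''; simp [hxy, hr]
      · simp [hr, hr', hr'']
    · rw [List.drop_of_length_le (by omega), List.drop_of_length_le (by omega),
        List.take_of_length_le (by omega), List.take_of_length_le (by omega)]
      refine does_transferStep_nil hv hd hc ?_
      rw [Function.update_of_ne hzx.symm, Function.update_of_ne hxy, Function.update_self]
      rfl

end Transfer

end Simulation

/-! ### A polynomial clock -/

namespace Simulation

/-- The values of the variables of the simulating program. -/
structure Vals (A : Type) (n : ℕ) (K : Type) where
  par : Fin n → Word A
  pc : Word A
  stk : K → Word A
  pre : K → Word A
  acc : Word A
  a : Word A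
  b : Word A
  c₁ : Word A
  c₂ : Word A

namespace Vals

variable {A : Type} {n : ℕ} {K : Type}

/-- The values as a function of the names. -/
def get (r : Vals A n K) : Name n K → Word A
  | .par i => r.par i
  | .pc => r.pc
  | .stk k => r.stk k
  | .pre k => r.pre k
  | .acc => r.acc
  | .a => r.a
  | .b => r.b
  | .c₁ => r.c₁
  | .c₂ => r.c₂

@[simp] theorem get_par (r : Vals A n K) (i : Fin n) : r.get (.par i) = r.par i := rfl
@[simp] theorem get_stk (r : Vals A n K) (k : K) : r.get (.stk k) = r.stk k := rfl
@[simp] theorem get_pre (r : Vals A n K) (k : K) : r.get (.pre k) = r.pre k := rfl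
@[simp] theorem get_acc (r : Vals A n K) : r.get .acc = r.acc := rfl

variable [DecidableEq K] (r : Vals A n K) (w : Word A)

@[simp] theorem update_par (i : Fin n) : Function.update r.get (.par i) w =
    { r with par := Function.update r.par i w }.get := by
  funext x
  rcases x with j | _ | _ | _ | _ | _ | _ | _ | _
  · by_cases h : j = i
    · subst h; simp
    · simp [h]
  all_goals rfl

@[simp] theorem update_pc : Function.update r.get .pc w = { r with pc := w }.get := by
  funext x; cases x <;> rfl

@[simp] theorem update_stk (k : K) : Function.update r.get (.stk k) w =
    { r with stk := Function.update r.stk k w }.get := by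
  funext x
  rcases x with _ | _ | j | _ | _ | _ | _ | _ | _
  case stk =>
    by_cases h : j = k
    · subst h; simp
    · simp [h]
  all_goals rfl

@[simp] theorem update_pre (k : K) : Function.update r.get (.pre k) w =
    { r with pre := Function.update r.pre k w }.get := by
  funext x
  rcases x with _ | _ | _ | j | _ | _ | _ | _ | _
  case pre =>
    by_cases h : j = k
    · subst h; simp
    · simp [h]
  all_goals rfl

@[simp] theorem update_acc : Function.update r.get .acc w = { r with acc := w }.get := by
  funext x; cases x <;> rfl

@[simp] theorem update_a : Function.update r.get .a w = { r with a := w }.get := by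
  funext x; cases x <;> rfl

@[simp] theorem update_b : Function.update r.get .b w = { r with b := w }.get := by
  funext x; cases x <;> rfl

@[simp] theorem update_c₁ : Function.update r.get .c₁ w = { r with c₁ := w }.get := by
  funext x; cases x <;> rfl

@[simp] theorem update_c₂ : Function.update r.get .c₂ w = { r with c₂ := w }.get := by
  funext x; cases x <;> rfl

end Vals

variable {A : Type} [Alphabet A] {O : ExtraOps A} {V : Type} [DecidableEq V] {n : ℕ} {K : Type}
  [DecidableEq K]

section Clock

variable (O) (v : Name n K → V)

/-- Add `1` to the accumulator. -/
def tick : Stmt O V := .assign (v .acc) (extE (.var (v .acc)) [Alphabet.one])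

/-- Add the lengths of the parameters to the accumulator. -/
def addLengths : Stmt O V :=
  seqs (fun i => forStmt (v .c₂) (constExpr [Alphabet.one])
    (.declass (.var (v (.par i))) (.var (v (.par i)))) (tick O v)) (List.finRange n)

/-- Multiply the clock `b` by `a`. -/
def multiply : Stmt O V :=
  .seq (.assign (v .acc) (constExpr [])) <|
  .seq (forStmt (v .c₁) (constExpr [Alphabet.one]) (.var (v .a))
    (forStmt (v .c₂) (constExpr [Alphabet.one]) (.var (v .b)) (tick O v)))
  (.assign (v .b) (.var (v .acc)))

/-- Set the clock to the power `D` of the total length of the parameters and `D`. -/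
def setClock (D : ℕ) : Stmt O V :=
  .seq (.assign (v .acc) (constExpr (unary D))) <| .seq (addLengths O v) <|
  .seq (.assign (v .a) (.var (v .acc))) <| .seq (.assign (v .b) (constExpr (unary 1)))
  (seqs (fun _ => multiply O v) (List.range D))

variable {O v}

theorem unary_add (i j : ℕ) : (unary i : Word A) ++ unary j = unary (i + j) := by
  simp [unary]

omit [DecidableEq K] [DecidableEq V] in
theorem eval_var {μ : Store A V} {x : V} : (.var x : Expr O V).eval μ = μ x := rfl

theorem does_ticks (hv : Function.Injective v) {x : Name n K} (hx : x ≠ .acc)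
    {e : Expr O V} {m N : ℕ}
    {S : Name n K → Word A} (he : e.eval (sto v S) = unary N) (hS : S .acc = unary m) :
    Does v (forStmt (v x) (constExpr [Alphabet.one]) e (tick O v)) S
      (Function.update (Function.update S .acc (unary (m + N))) x []) := by
  refine does_for hv (fun j => Function.update S .acc (unary (m + j))) he (by simp [← hS])
    fun j hj c => ?_
  have := does_assign (O := O) hv (x := .acc) (e := extE (.var (v .acc)) [Alphabet.one])
    (S := Function.update (Function.update S .acc (unary (m + j))) x c) (w := unary (m + (j + 1)))
    (by rw [eval_extE, eval_var, sto_apply hv, Function.update_of_ne hx.symm, Function.update_self,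
      ← add_assoc]; exact unary_add _ 1)
  rw [Function.update_comm hx.symm, Function.update_idem] at this
  rw [Function.update_comm hx.symm, Function.update_comm hx.symm]
  exact this

theorem does_addLengths (hv : Function.Injective v) (l : List (Fin n)) {m : ℕ} (r : Vals A n K)
    (hr : r.acc = unary m) (hc : r.c₂ = []) :
    Does v (seqs (fun i => forStmt (v .c₂) (constExpr [Alphabet.one])
      (.declass (.var (v (.par i))) (.var (v (.par i)))) (tick O v)) l) r.get
      { r with acc := unary (m + (l.map fun i => (r.par i).length).sum), c₂ := [] }.get := by
  induction l generalizing m r with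
  | nil =>
    obtain ⟨par, pc, stk, pre, acc, a, b, c₁, c₂⟩ := r
    obtain rfl : acc = unary m := hr
    obtain rfl : c₂ = [] := hc
    exact does_skip _
  | cons i l ih =>
    have h1 := does_ticks (O := O) hv (x := .c₂) (by simp) (m := m) (N := (r.par i).length)
      (S := r.get) (e := .declass (.var (v (.par i))) (.var (v (.par i)))) (by
        simp [Expr.eval, sto_apply hv]) hr
    have h2 := ih { r with acc := unary (m + (r.par i).length), c₂ := [] } rfl rfl
    rw [Vals.update_acc, Vals.update_c₂] at h1
    simpa [seqs, add_assoc] using h1.seq h2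

theorem does_multiply (hv : Function.Injective v) {p q : ℕ} (r : Vals A n K) (ha : r.a = unary p)
    (hb : r.b = unary q) (hc : r.c₂ = []) : Does v (multiply O v) r.get
      { r with b := unary (p * q), acc := unary (p * q), c₁ := [], c₂ := [] }.get := by
  obtain ⟨par, pc, stk, pre, acc, a, b, c₁, c₂⟩ := r
  obtain rfl : c₂ = [] := hc
  set r : Vals A n K := ⟨par, pc, stk, pre, acc, a, b, c₁, []⟩
  have h1 := does_assign (O := O) hv (x := .acc) (S := r.get) (e := constExpr []) rfl
  have h2 := does_for (O := O) hv (x := .c₁) (d := .var (v .a)) (N := p)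
    (s := forStmt (v .c₂) (constExpr [Alphabet.one]) (.var (v .b)) (tick O v))
    (S := { r with acc := [] }.get) (fun j => { r with acc := unary (j * q) }.get)
    (by rw [eval_var, sto_apply hv]; exact ha) (by simp [unary]) fun j hj c => by
      have := does_ticks (O := O) hv (x := .c₂) (by simp) (m := j * q) (N := q)
        (S := { r with acc := unary (j * q), c₁ := c }.get) (e := .var (v .b))
        (by rw [eval_var, sto_apply hv]; exact hb) rfl
      simpa [add_mul] using this
  have h3 := does_assign (O := O) hv (x := .b) (S := { r with acc := unary (p * q), c₁ := [] }.get)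
    (e := .var (v .acc)) (w := unary (p * q)) (by rw [eval_var, sto_apply hv]; rfl)
  rw [Vals.update_acc] at h1
  rw [Vals.update_c₁] at h2
  rw [Vals.update_b] at h3
  exact h1.seq (h2.seq h3)

theorem does_powers (hv : Function.Injective v) {ι : Type} (l : List ι) {p q : ℕ} (r : Vals A n K)
    (ha : r.a = unary p) (hb : r.b = unary q) (hc : r.c₂ = []) :
    ∃ w w', Does v (seqs (fun _ : ι => multiply O v) l) r.get
      { r with b := unary (p ^ l.length * q), acc := w, c₁ := w', c₂ := [] }.get := by
  induction l generalizing q r with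
  | nil =>
    obtain ⟨par, pc, stk, pre, acc, a, b, c₁, c₂⟩ := r
    obtain rfl : b = unary q := hb
    obtain rfl : c₂ = [] := hc
    refine ⟨acc, c₁, ?_⟩
    rw [List.length_nil, pow_zero, one_mul]
    exact does_skip _
  | cons i l ih =>
    have h1 := does_multiply (O := O) hv r ha hb hc
    obtain ⟨w, w', h2⟩ := ih { r with b := unary (p * q), acc := unary (p * q), c₁ := [], c₂ := [] }
      (q := p * q) ha rfl rfl
    refine ⟨w, w', ?_⟩
    have e : p ^ (i :: l).length * q = p ^ l.length * (p * q) := by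
      rw [List.length_cons, pow_succ, mul_assoc]
    rw [e]
    exact h1.seq h2

/-- The clock can be given a length above any fixed polynomial in the total length of the
parameters, cf. `Polynomial.exists_eval_le_pow`. -/
theorem does_setClock (hv : Function.Injective v) (D : ℕ) (r : Vals A n K) (hc : r.c₂ = []) :
    ∃ w w' w'', Does v (setClock O v D) r.get { r with
      b := unary ((∑ i, (r.par i).length + D) ^ D), a := w, acc := w', c₁ := w'',
          c₂ := [] }.get := by
  have h1 := does_assign (O := O) hv (x := .acc) (S := r.get) (e := constExpr (unary D)) rfl
  rw [Vals.update_acc] at h1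
  have h2 := does_addLengths (O := O) hv (List.finRange n) { r with acc := unary D } rfl hc
  set m := D + ((List.finRange n).map fun i => (r.par i).length).sum with hm
  have h3 := does_assign (O := O) hv (x := .a) (S := { r with acc := unary m, c₂ := [] }.get)
    (e := .var (v .acc)) (w := unary m) (by rw [eval_var, sto_apply hv]; rfl)
  rw [Vals.update_a] at h3
  have h4 := does_assign (O := O) hv (x := .b)
    (S := { r with acc := unary m, c₂ := [], a := unary m }.get) (e := constExpr (unary 1)) rfl
  rw [Vals.update_b] at h4
  obtain ⟨w, w', h5⟩ := does_powers (O := O) hv (List.range D) (p := m) (q := 1)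
    { r with acc := unary m, c₂ := [], a := unary m, b := unary 1 } rfl rfl rfl
  have e : m = ∑ i, (r.par i).length + D := by
    rw [hm, add_comm, ← List.ofFn_eq_map, List.sum_ofFn]
  rw [List.length_range, mul_one, e] at h5
  rw [e] at h2 h3 h4
  exact ⟨_, w, w', h1.seq (h2.seq (h3.seq (h4.seq h5)))⟩

section

variable [Finite K] {B : Set (Expr O V)}

omit [DecidableEq K] in
theorem data_tick (hv : Function.Injective v) : Data v B (tick O v) :=
  data_assign hv rfl (low_extE (low_var hv rfl) _)

omit [DecidableEq K] in
theorem Data.notMem_vars {s : Stmt O V} (h : Data v B s) {x : Name n K} (hx : x.level = 1) :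
    v x ∉ s.vars := fun h' => by
  have := h.level_eq_zero x h'
  omega

omit [DecidableEq K] [Finite K] in
theorem notMem_vars_forStmt (hv : Function.Injective v) {x y z : Name n K} {s : Stmt O V}
    (hxy : x ≠ y) (hxz : x ≠ z) (hs : v x ∉ s.vars) :
    v x ∉ (forStmt (v y) (constExpr [Alphabet.one]) (.var (v z)) s).vars := by
  have h1 : ∀ i : Fin 2, v x ∉ ((![constExpr [Alphabet.one], .var (v y)] :
      Fin 2 → Expr O V) i).vars := fun i => by
    fin_cases i
    · exact fun h => by
        obtain ⟨i, -⟩ := Finset.mem_biUnion.1 h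
        exact i.elim0
    · simpa [Expr.vars] using hv.ne hxy
  have h2 : v x ∉ (geExpr (v y) (constExpr [Alphabet.one]) : Expr O V).vars := fun h => by
    obtain ⟨i, -, hi⟩ := Finset.mem_biUnion.1 h
    exact h1 i hi
  have h3 : v x ∉ (decrStmt (v y) : Stmt O V).vars := fun h => by
    rcases Finset.mem_union.1 h with h | h
    · exact hv.ne hxy (Finset.mem_singleton.1 h)
    · obtain ⟨(i : Fin 1), -, hi⟩ := Finset.mem_biUnion.1 h
      fin_cases i
      exact hv.ne hxy (Finset.mem_singleton.1 hi)
  simp [forStmt, Stmt.vars, Expr.vars, h2, h3, hs, hv.ne hxy, hv.ne hxz]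

omit [DecidableEq K] in
theorem ok_setClock (hB : constExpr [Alphabet.one] ∈ B) (hv : Function.Injective v) (D : ℕ) :
    Ok v B 0 1 (setClock O v D) := by
  have acc : ∀ e : Expr O V, Low v e → Ok v B 0 1 (.assign (v .acc) e) := fun e he =>
    (data_assign hv rfl he).ok (Nat.zero_le _)
  have htick := data_tick (B := B) hv
  have hvar : ExprTy (varEnv v) (opEnv O) 0 0 (.var (v .acc)) 0 := low_var hv rfl 0 (Nat.zero_le _)
  refine .seq (acc _ (low_const _)) (.seq (ok_seqs fun i => ?_) (.seq (.assign_top hv hvar)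
    (.seq (.assign_top hv (low_const _ 0 (Nat.zero_le _))) (ok_seqs fun _ => ?_))))
  · have h : ExprTy (varEnv v) (opEnv O) 0 0 (.var (v (.par i))) 0 :=
      low_var hv rfl 0 (Nat.zero_le _)
    exact .for_top hB hv rfl (.declass h h le_rfl le_rfl) (htick.ok le_rfl)
      (htick.notMem_vars rfl)
  · refine .seq (acc _ (low_const _)) (.seq (.for_top hB hv rfl (.var (level_varEnv hv .a))
      (.for_inner hB hv rfl rfl (htick.ok le_rfl) (htick.notMem_vars rfl)) ?_)
          (.assign_top hv hvar))
    exact notMem_vars_forStmt hv (by simp) (by simp) (htick.notMem_vars rfl)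

end

end Clock

end Simulation

/-! ### Simulation of machine steps -/

namespace Simulation

open Elementary

variable {A : Type} [Alphabet A] {O : ExtraOps A} {V : Type} [DecidableEq V] {n : ℕ} {K : Type}
  [DecidableEq K] {Λ σ : Type} {Γ : K → Type} [Fintype Λ]

/-- An encoding of the states of a machine by words, and of the symbols on its stacks by words of
the same length. -/
structure Coding (A : Type) [Alphabet A] (M : Λ → Turing.TM2.Stmt Γ Λ σ) where
  d : ℕ
  enc : (Σ k, Γ k) → Word A
  code : Option (Turing.TM2.Stmt Γ Λ σ) × σ → Word A
  symbols : ∀ k, List (Γ k)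
  controls : List (Option (Turing.TM2.Stmt Γ Λ σ) × σ)
  one_le : 1 ≤ d
  length_enc : ∀ γ, (enc γ).length = d
  enc_inj : ∀ k, ∀ γ ∈ symbols k, ∀ γ' ∈ symbols k, enc ⟨k, γ⟩ = enc ⟨k, γ'⟩ → γ = γ'
  mem_controls : ∀ s, s ∈ controls ↔ s ∈ states M
  code_inj : Set.InjOn code (states M)
  pushed_mem : ∀ s ∈ states M, ∀ γ, pushed s = some γ → γ.2 ∈ symbols γ.1

omit [DecidableEq K] in
theorem exists_coding [Finite σ] (M : Λ → Turing.TM2.Stmt Γ Λ σ) (E : Set (Σ k, Γ k))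
    (hE : E.Finite) : ∃ T : Coding A M, ∀ γ ∈ E, γ.2 ∈ T.symbols γ.1 := by
  classical
  obtain ⟨d', code, -, -, hcode⟩ := exists_encoding (A := A) (finite_states M)
  let G : Set (Σ k, Γ k) := E ∪ {γ | ∃ s ∈ states M, pushed s = some γ}
  have hG : G.Finite := by
    refine hE.union ?_
    have : {γ | ∃ s ∈ states M, pushed s = some γ} ⊆ Option.some ⁻¹' (pushed '' states M) := by
      rintro γ ⟨s, hs, h⟩
      exact ⟨s, hs, h⟩
    exact Set.Finite.subset (((finite_states M).image _).preimage
      (Option.some_injective _).injOn) this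
  obtain ⟨d, enc, hd, henc, hinj⟩ := exists_encoding (A := A) hG
  have hk (k : K) : (Sigma.mk k ⁻¹' G).Finite := hG.preimage sigma_mk_injective.injOn
  refine ⟨⟨d, enc, code, fun k => (hk k).toFinset.toList, (finite_states M).toFinset.toList, hd,
      henc,
    ?_, by simp, hcode, ?_⟩, ?_⟩
  · intro k γ hγ γ' hγ' h
    simp only [Finset.mem_toList, Set.Finite.mem_toFinset, Set.mem_preimage] at hγ hγ'
    exact sigma_mk_injective (hinj hγ hγ' h)
  · rintro s hs ⟨k, γ⟩ h
    simp only [Finset.mem_toList, Set.Finite.mem_toFinset, Set.mem_preimage]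
    exact .inr ⟨s, hs, h⟩
  · rintro ⟨k, γ⟩ h
    simp only [Finset.mem_toList, Set.Finite.mem_toFinset, Set.mem_preimage]
    exact .inl h

variable {M : Λ → Turing.TM2.Stmt Γ Λ σ} (T : Coding A M)

/-- The words that represent the stacks. -/
def Coding.words (S : ∀ k, List (Γ k)) (k : K) : Word A := (S k).flatMap fun γ => T.enc ⟨k, γ⟩

/-- The values of the variables that represent a configuration; the other values are taken from
`r`. -/
def Coding.rep (r : Vals A n K) (c : Conf Γ Λ σ) : Vals A n K :=
  { r with pc := T.code (c.stmt, c.var), stk := T.words c.stk, pre := fun _ => [] }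

section Programs

variable (O) (v : Name n K → V)

/-- Set the state of the control. -/
def setPc (s : Option (Turing.TM2.Stmt Γ Λ σ) × σ) : Stmt O V :=
  .assign (v .pc) (constExpr (T.code s))

/-- A case distinction on the top of the stack `k`. -/
def topCase (k : K) (t : Option (Γ k) → Stmt O V) : Stmt O V :=
  chain (fun γ => eqE (takeE (.var (v (.stk k))) T.d) (constExpr (T.enc ⟨k, γ⟩)))
    (fun γ => t (some γ)) (t none) (T.symbols k)

/-- The effect of an instruction. A symbol to be pushed is put aside. -/
def instr : Option (Turing.TM2.Stmt Γ Λ σ) × σ → Stmt O V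
  | (none, _) => .skip
  | (some (.push k f q), s) =>
      .seq (.assign (v (.pre k)) (constExpr (T.enc ⟨k, f s⟩))) (setPc O T v (some q, s))
  | (some (.peek k f q), s) => topCase O T v k fun o => setPc O T v (some q, f s o)
  | (some (.pop k f q), s) => .seq (topCase O T v k fun o => setPc O T v (some q, f s o))
      (.assign (v (.stk k)) (dropE (.var (v (.stk k))) T.d))
  | (some (.load f q), s) => setPc O T v (some q, f s)
  | (some (.branch p q q'), s) => setPc O T v (some (if p s then q else q'), s)
  | (some (.goto l), s) => setPc O T v (some (M (l s)), s)
  | (some .halt, s) => setPc O T v (none, s)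

/-- Put the symbol set aside on top of the stack `k`, by moving the stack letter by letter. -/
noncomputable def drain (k : K) : Stmt O V :=
  .seq (transfer 1 (fun a => [a]) (fun a => [a]) (Finset.univ : Finset A).toList (v .c₂) (v .b)
    (v (.stk k)) (v (.pre k))) <|
  .seq (.assign (v (.stk k)) (.var (v (.pre k)))) (.assign (v (.pre k)) (constExpr []))

/-- A step of the machine. -/
noncomputable def round [Fintype K] : Stmt O V :=
  .seq (chain (fun s => eqE (.var (v .pc)) (constExpr (T.code s))) (instr O T v) .skip T.controls)
    (seqs (drain O v) (Finset.univ : Finset K).toList)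

end Programs

section Typing

variable {v : Name n K → V} {B : Set (Expr O V)} [Finite K]

omit [DecidableEq K] in
theorem data_setPc (hv : Function.Injective v) (s : Option (Turing.TM2.Stmt Γ Λ σ) × σ) :
    Data v B (setPc O T v s) :=
  data_assign hv rfl (low_const _)

omit [DecidableEq K] in
theorem data_topCase (hv : Function.Injective v) {k : K} {t : Option (Γ k) → Stmt O V}
    (ht : ∀ o, Data v B (t o)) : Data v B (topCase O T v k t) :=
  data_chain hv (fun _ => low_eqE (low_takeE (low_var hv rfl) _) (low_const _)) (fun _ => ht _)
    (ht _)

omit [DecidableEq K] in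
theorem data_instr (hv : Function.Injective v) (s : Option (Turing.TM2.Stmt Γ Λ σ) × σ) :
    Data v B (instr O T v s) := by
  obtain ⟨q, s⟩ := s
  rcases q with _ | (_ | _ | _ | _ | _ | _ | _)
  · exact data_skip
  · exact (data_assign hv rfl (low_const _)).seq (data_setPc T hv _)
  · rw [instr]
    exact data_topCase T hv fun _ => data_setPc T hv _
  · exact (data_topCase T hv fun _ => data_setPc T hv _).seq
      (data_assign hv rfl (low_dropE (low_var hv rfl) _))
  all_goals exact data_setPc T hv _

omit [DecidableEq K] in
theorem ok_transfer_inner (hB : constExpr [Alphabet.one] ∈ B) (hv : Function.Injective v) {ι : Type}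
    {d : ℕ} {c u : ι → Word A} {l : List ι} {x y : Name n K} (hx : x.level = 0) (hy : y.level = 0) :
    Ok v B 1 1 (transfer d c u l (v .c₂) (v .b) (v x) (v y)) :=
  have h := data_transferStep (O := O) (B := B) hv hx hy
  .for_inner hB hv rfl rfl (h.ok le_rfl) (h.notMem_vars rfl)

omit [DecidableEq K] in
theorem ok_transfer_top (hB : constExpr [Alphabet.one] ∈ B) (hv : Function.Injective v) {ι : Type}
    {d : ℕ} {c u : ι → Word A} {l : List ι} {x y : Name n K} (hx : x.level = 0) (hy : y.level = 0) :
    Ok v B 0 1 (transfer d c u l (v .c₂) (v .b) (v x) (v y)) :=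
  have h := data_transferStep (O := O) (B := B) hv hx hy
  .for_top hB hv rfl (.var (level_varEnv hv .b)) (h.ok le_rfl) (h.notMem_vars rfl)

end Typing

omit [DecidableEq K] in
/-- A round may be repeated in a loop with the counter `c₁`. -/
theorem ok_round [Fintype K] {v : Name n K → V} {B : Set (Expr O V)}
    (hB : constExpr [Alphabet.one] ∈ B) (hv : Function.Injective v) :
    Ok v B 1 1 (round O T v) ∧ v .c₁ ∉ (round O T v).vars := by
  have h1 : Data v B (chain (fun s => eqE (.var (v .pc)) (constExpr (T.code s))) (instr O T v) .skip
      T.controls) :=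
    data_chain hv (fun _ => low_eqE (low_var hv rfl) (low_const _)) (data_instr T hv) data_skip
  have h2 (k : K) : Data v B (.seq (.assign (v (.stk k)) (.var (v (.pre k))))
      (.assign (v (.pre k)) (constExpr []))) :=
    (data_assign hv rfl (low_var hv rfl)).seq (data_assign hv rfl (low_const _))
  refine ⟨(h1.ok le_rfl).seq (ok_seqs fun k => (ok_transfer_inner hB hv rfl rfl).seq
    ((h2 k).ok le_rfl)), ?_⟩
  rw [round, Stmt.vars, Finset.mem_union, not_or]
  refine ⟨h1.notMem_vars rfl, notMem_vars_seqs fun k => ?_⟩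
  rw [drain, Stmt.vars, Finset.mem_union, not_or]
  exact ⟨notMem_vars_forStmt hv (by simp) (by simp)
    ((data_transferStep (B := B) hv rfl rfl).notMem_vars rfl), (h2 k).notMem_vars rfl⟩

section Steps

variable {T} {v : Name n K → V}

theorem does_setPc (hv : Function.Injective v) (s : Option (Turing.TM2.Stmt Γ Λ σ) × σ)
    (r : Vals A n K) : Does v (setPc O T v s) r.get { r with pc := T.code s }.get := by
  have := does_assign (O := O) hv (x := .pc) (e := constExpr (T.code s)) (S := r.get) rfl
  rwa [Vals.update_pc] at this

omit [DecidableEq K] in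
theorem does_topCase (hv : Function.Injective v) {k : K} {t : Option (Γ k) → Stmt O V}
    {r : Vals A n K} {S : ∀ k, List (Γ k)} (hr : r.stk = T.words S)
    (hS : ∀ γ ∈ S k, γ ∈ T.symbols k) {R : Name n K → Word A}
    (h : Does v (t (S k).head?) r.get R) : Does v (topCase O T v k t) r.get R := by
  have e : (Expr.var (v (.stk k)) : Expr O V).eval (sto v r.get) = T.words S k := by
    rw [eval_var, sto_apply hv, Vals.get_stk, hr]
  rcases hk : S k with _ | ⟨γ, l⟩
  · rw [hk] at h
    refine does_chain_default (fun γ _ hg => ?_) h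
    rw [eval_eqE, eval_takeE_nil (by rw [e, Coding.words, hk]; rfl)] at hg
    have hg : [] = T.enc ⟨k, γ⟩ := hg
    have h1 := T.length_enc ⟨k, γ⟩
    have h2 := T.one_le
    rw [← hg, List.length_nil] at h1
    omega
  · rw [hk] at h
    have e' : T.words S k = T.enc ⟨k, γ⟩ ++ l.flatMap fun γ => T.enc ⟨k, γ⟩ := by
      rw [Coding.words, hk, List.flatMap_cons]
    have h1 : (takeE (.var (v (.stk k))) T.d : Expr O V).eval (sto v r.get) = T.enc ⟨k, γ⟩ := by
      rw [e'] at e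
      rw [eval_takeE (by rw [e, List.length_append, T.length_enc]; omega), e,
        ← T.length_enc ⟨k, γ⟩, List.take_left]
    have hγ := hS γ (by simp [hk])
    refine does_chain hγ (by rw [eval_eqE, h1]; rfl) (fun γ' hγ' hg => ?_) h
    rw [eval_eqE, h1] at hg
    exact (T.enc_inj k γ hγ γ' hγ' hg).symm

theorem words_update (S : ∀ k, List (Γ k)) (k : K) (l : List (Γ k)) :
    T.words (Function.update S k l) =
      Function.update (T.words S) k (l.flatMap fun γ => T.enc ⟨k, γ⟩) := by
  funext k'
  by_cases h : k' = k
  · subst h; simp [Coding.words]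
  · simp [Coding.words, h]

/-- An instruction of the machine, up to the symbol to be pushed: the stacks are the words `W k`
with the words `N k`, which have been put aside, in front of them. -/
theorem does_instr (hv : Function.Injective v) (r : Vals A n K) (c : Conf Γ Λ σ)
    (hc : ∀ k, ∀ γ ∈ c.stk k, γ ∈ T.symbols k) :
    ∃ W N : K → Word A, Does v (instr O T v (c.stmt, c.var)) (T.rep r c).get
      { r with
        pc := T.code ((step M c).stmt, (step M c).var)
        stk := W
        pre := N }.get ∧
      (∀ k, N k ++ W k = T.words (step M c).stk k) ∧
      ∀ k, (W k).length ≤ (T.words c.stk k).length := by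
  obtain ⟨q, s, S⟩ := c
  rcases q with _ | (⟨k, f, q⟩ | ⟨k, f, q⟩ | ⟨k, f, q⟩ | ⟨f, q⟩ | ⟨p, q, q'⟩ | l | _)
  · exact ⟨T.words S, fun _ => [], does_skip _, fun _ => rfl, fun _ => le_rfl⟩
  · refine ⟨T.words S, Function.update (fun _ => []) k (T.enc ⟨k, f s⟩), ?_, fun k' => ?_,
      fun _ => le_rfl⟩
    · have := does_assign (O := O) hv (x := .pre k) (e := constExpr (T.enc ⟨k, f s⟩))
        (S := (T.rep r ⟨some (.push k f q), s, S⟩).get) rfl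
      rw [Vals.update_pre] at this
      exact this.seq (does_setPc hv _ _)
    · simp only [step]
      rw [words_update]
      by_cases h : k' = k
      · subst h; simp [Coding.words]
      · simp [h]
  · refine ⟨T.words S, fun _ => [], ?_, fun _ => rfl, fun _ => le_rfl⟩
    rw [instr]
    exact does_topCase hv rfl (hc k) (does_setPc hv _ _)
  · have h1 : (T.words S k).drop T.d = ((S k).tail).flatMap fun γ => T.enc ⟨k, γ⟩ := by
      rw [Coding.words]
      rcases S k with _ | ⟨γ, l⟩
      · simp
      · rw [List.flatMap_cons, ← T.length_enc ⟨k, γ⟩, List.drop_left]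
        rfl
    refine ⟨Function.update (T.words S) k ((T.words S k).drop T.d), fun _ => [], ?_, fun k' => ?_,
      fun k' => ?_⟩
    · have h2 : Does v (topCase O T v k fun o => setPc O T v (some q, f s o))
          (T.rep r ⟨some (.pop k f q), s, S⟩).get _ :=
        does_topCase hv rfl (hc k) (does_setPc hv _ _)
      refine h2.seq ?_
      have := does_assign (O := O) hv (x := .stk k) (e := dropE (.var (v (.stk k))) T.d)
        (S := { T.rep r ⟨some (.pop k f q), s, S⟩ with pc := T.code (some q, f s (S k).head?) }.get)
        (w := (T.words S k).drop T.d) (by rw [eval_dropE, eval_var, sto_apply hv]; rfl)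
      rw [Vals.update_stk] at this
      exact this
    · simp only [step]
      rw [words_update, h1]
      rfl
    · by_cases h : k' = k
      · subst h; simp
      · simp [h]
  all_goals exact ⟨T.words S, fun _ => [], does_setPc hv _ _, fun _ => rfl, fun _ => le_rfl⟩

theorem does_drain (hv : Function.Injective v) (r : Vals A n K) (k : K) {N : ℕ}
    (hb : r.b = unary N) (hN : (r.stk k).length ≤ N) : Does (O := O) v (drain O v k) r.get { r with
      stk := Function.update r.stk k (r.pre k ++ r.stk k)
      pre := Function.update r.pre k []
      c₂ := [] }.get := by
  have h1 := does_transfer (O := O) hv (x := .stk k) (y := .pre k) (z := .c₂) (t := .b) (d := 1)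
    (c := fun a : A => [a]) (u := fun a => [a]) (l := Finset.univ.toList) (s := r.stk k) (N := N)
    (S := r.get) (by simp) (by simp) (by simp) le_rfl (by simp) (by simp) (by simp) hb hN
    (List.flatMap_singleton' _).symm
  rw [List.flatMap_singleton', Vals.update_stk, Vals.get_pre, Vals.update_pre, Vals.update_c₂] at h1
  have h2 := fun r : Vals A n K => does_assign (O := O) hv (x := .stk k) (e := .var (v (.pre k)))
    (S := r.get) (w := r.pre k) (by rw [eval_var, sto_apply hv]; rfl)
  have h3 := fun r : Vals A n K => does_assign (O := O) hv (x := .pre k) (e := constExpr [])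
    (S := r.get) (w := []) rfl
  simp only [Vals.update_stk, Vals.update_pre] at h2 h3
  have h4 := h1.seq ((h2 _).seq (h3 _))
  simp only [Function.update_self, Function.update_idem] at h4
  exact h4

/-- The words put aside are moved to the stacks. -/
theorem does_drains (hv : Function.Injective v) (l : List K) (r : Vals A n K) {N : ℕ}
    (hb : r.b = unary N) (hl : l.Nodup) (hN : ∀ k ∈ l, (r.stk k).length ≤ N) (h₂ : r.c₂ = []) :
    Does (O := O) v (seqs (drain O v) l) r.get { r with
      stk := fun k => if k ∈ l then r.pre k ++ r.stk k else r.stk k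
      pre := fun k => if k ∈ l then [] else r.pre k }.get := by
  induction l generalizing r with
  | nil =>
    simp only [List.not_mem_nil, if_false]
    exact does_skip _
  | cons k l ih =>
    rw [List.nodup_cons] at hl
    have h1 := does_drain (O := O) hv r k hb (hN k (by simp))
    have h2 := ih { r with
      stk := Function.update r.stk k (r.pre k ++ r.stk k)
      pre := Function.update r.pre k []
      c₂ := [] } hb hl.2 (fun k' hk' => by
        have : k' ≠ k := fun e => hl.1 (e ▸ hk')
        simpa [this] using hN k' (by simp [hk'])) rfl
    have h3 := h1.seq h2
    refine Eq.subst (motive := fun R : Vals A n K => Does v _ r.get R.get) ?_ h3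
    rw [Vals.mk.injEq]
    refine ⟨rfl, rfl, ?_, ?_, rfl, rfl, rfl, rfl, h₂.symm⟩
    · funext k'
      by_cases h : k' = k
      · subst h; simp [hl.1]
      · simp [h]
    · funext k'
      by_cases h : k' = k
      · subst h; simp
      · simp [h]

/-- A round of the simulation transforms the representation of a configuration into that of the next
one, provided that the clock bounds the lengths of the stacks. -/
theorem does_round [Fintype K] (hv : Function.Injective v) (r : Vals A n K) (c : Conf Γ Λ σ)
    (hc : ∀ k, ∀ γ ∈ c.stk k, γ ∈ T.symbols k) (hs : (c.stmt, c.var) ∈ states M) {N : ℕ}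
    (hb : r.b = unary N) (hN : ∀ k, (T.words c.stk k).length ≤ N) (h₂ : r.c₂ = []) :
    Does (O := O) v (round O T v) (T.rep r c).get (T.rep r (step M c)).get := by
  obtain ⟨W, X, h1, h2, h3⟩ := does_instr (O := O) hv r c hc
  have hpc : (Expr.var (v .pc) : Expr O V).eval (sto v (T.rep r c).get) =
      T.code (c.stmt, c.var) := by
    rw [eval_var, sto_apply hv]
    rfl
  refine .seq (does_chain ((T.mem_controls _).2 hs) ?_ (fun s' hs' h => ?_) h1) ?_
  · rw [eval_eqE, hpc]
    rfl
  · rw [eval_eqE, hpc] at h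
    exact (T.code_inj hs ((T.mem_controls _).1 hs') h).symm
  · let r' : Vals A n K :=
      { r with pc := T.code ((step M c).stmt, (step M c).var), stk := W, pre := X }
    have h4 := does_drains (O := O) hv (Finset.univ : Finset K).toList r' hb
      (Finset.nodup_toList _) (fun k _ => (h3 k).trans (hN k)) h₂
    refine Eq.subst (motive := fun R : Vals A n K => Does v
      (seqs (drain O v) (Finset.univ : Finset K).toList) r'.get R.get) ?_ h4
    rw [Coding.rep, Vals.mk.injEq]
    refine ⟨rfl, rfl, ?_, ?_, rfl, rfl, rfl, rfl, rfl⟩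
    · simp [r', h2]
    · simp

end Steps

end Simulation

/-! ### Computing the functions in `FP` -/

namespace Simulation

open Elementary

variable {A : Type} [Alphabet A] {O : ExtraOps A} {V : Type} [DecidableEq V] {n : ℕ} {K : Type}
  [DecidableEq K] {Λ σ : Type} {Γ : K → Type} [Fintype Λ] {M : Λ → Turing.TM2.Stmt Γ Λ σ}
  (T : Coding A M)

section Programs

variable (O) (v : Name n K → V)

/-- Append the codes `u` of the letters of the parameters to the stack `k`, and the code of the end
marker after every parameter. The parameters are consumed. -/
noncomputable def loadParams (k : K) (u : Option A → Word A) : List (Fin n) → Stmt O V :=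
  seqs fun i => .seq (transfer 1 (fun a => [a]) (fun a => u (some a))
      (Finset.univ : Finset A).toList
    (v .c₂) (v .b) (v (.par i)) (v (.stk k)))
    (.assign (v (.stk k)) (extE (.var (v (.stk k))) (u none)))

/-- Decode the stack `k`. -/
def storeResult (k : K) (out : Γ k → A) : Stmt O V :=
  transfer T.d (fun γ => T.enc ⟨k, γ⟩) (fun γ => [out γ]) (T.symbols k) (v .c₂) (v .b) (v (.stk k))
    (v .acc)

/-- The simulating program: the clock is set, the input is written on the stack `k₀`, the machine is
run from the state `s₀` until the clock expires, and the output is read from the stack `k₁`. -/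
noncomputable def simulation [Fintype K] (D : ℕ) (k₀ k₁ : K) (u : Option A → Γ k₀)
    (s₀ : Option (Turing.TM2.Stmt Γ Λ σ) × σ) (out : Γ k₁ → A) : Stmt O V :=
  .seq (setClock O v D) <|
  .seq (loadParams O v k₀ (fun o => T.enc ⟨k₀, u o⟩) (List.finRange n)) <|
  .seq (setPc O T v s₀) <|
  .seq (forStmt (v .c₁) (constExpr [Alphabet.one]) (.var (v .b)) (round O T v)) <|
  .seq (.assign (v .acc) (constExpr [])) (storeResult O T v k₁ out)

end Programs

variable {v : Name n K → V}

omit [DecidableEq K] in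
theorem ok_simulation [Fintype K] {B : Set (Expr O V)} (hB : constExpr [Alphabet.one] ∈ B)
    (hv : Function.Injective v) (D : ℕ) (k₀ k₁ : K) (u : Option A → Γ k₀)
    (s₀ : Option (Turing.TM2.Stmt Γ Λ σ) × σ) (out : Γ k₁ → A) :
    Ok v B 0 1 (simulation O T v D k₀ k₁ u s₀ out) := by
  have h := ok_round (O := O) (B := B) T hB hv
  refine (ok_setClock hB hv D).seq <| .seq (ok_seqs fun i => ?_) <|
    .seq ((data_setPc T hv s₀).ok zero_le_one) <|
    .seq (.for_top hB hv rfl (.var (level_varEnv hv .b)) h.1 h.2) <|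
    .seq ((data_assign hv rfl (low_const _)).ok zero_le_one) (ok_transfer_top hB hv rfl rfl)
  exact (ok_transfer_top hB hv rfl rfl).seq
    ((data_assign hv rfl (low_extE (low_var hv rfl) _)).ok zero_le_one)

theorem does_loadParams (hv : Function.Injective v) (k : K) (u : Option A → Word A)
    (l : List (Fin n)) (hl : l.Nodup) (r : Vals A n K) {N : ℕ} (hb : r.b = unary N)
    (hN : ∀ i ∈ l, (r.par i).length ≤ N) (h₂ : r.c₂ = []) :
    ∃ p, Does v (loadParams O v k u l) r.get { r with
      par := p
      stk := Function.update r.stk k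
        (r.stk k ++ l.flatMap fun i =>
          ((r.par i).flatMap fun a => u (some a)) ++ u none) }.get := by
  induction l generalizing r with
  | nil =>
    refine ⟨r.par, ?_⟩
    rw [List.flatMap_nil, List.append_nil, Function.update_eq_self]
    exact does_skip _
  | cons i l ih =>
    rw [List.nodup_cons] at hl
    have ne {j} (hj : j ∈ l) : j ≠ i := fun e => hl.1 (e ▸ hj)
    have h1 := does_transfer (O := O) hv (x := .par i) (y := .stk k) (z := .c₂) (t := .b) (d := 1)
      (c := fun a : A => [a]) (u := fun a => u (some a)) (l := Finset.univ.toList) (s := r.par i)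
      (N := N) (S := r.get) (by simp) (by simp) (by simp) le_rfl (by simp) (by simp) (by simp) hb
      (hN i (by simp)) (List.flatMap_singleton' _).symm
    rw [Vals.update_par, Vals.get_stk, Vals.update_stk, Vals.update_c₂] at h1
    have h2 := fun r : Vals A n K => does_assign (O := O) hv (x := .stk k)
      (e := extE (.var (v (.stk k))) (u none)) (S := r.get) (w := r.stk k ++ u none)
      (by rw [eval_extE, eval_var, sto_apply hv]; rfl)
    simp only [Vals.update_stk] at h2
    have h3 := h1.seq (h2 _)
    simp only [Function.update_self, Function.update_idem] at h3
    obtain ⟨p, h4⟩ := ih hl.2 { r with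
      par := Function.update r.par i []
      stk := Function.update r.stk k
        (r.stk k ++ ((r.par i).flatMap fun a => u (some a)) ++ u none)
      c₂ := [] } hb (fun j hj => by simpa [ne hj] using hN j (by simp [hj])) rfl
    refine ⟨p, ?_⟩
    have e : (l.flatMap fun j => ((Function.update r.par i [] j).flatMap fun a => u (some a)) ++
        u none) = l.flatMap fun j => ((r.par j).flatMap fun a => u (some a)) ++ u none :=
      List.flatMap_congr fun j hj => by rw [Function.update_of_ne (ne hj)]
    simp only [Function.update_self, Function.update_idem, e] at h4
    have h5 := h3.seq h4
    rw [h₂]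
    simp only [List.flatMap_cons, List.append_assoc] at h5 ⊢
    exact h5

omit [Alphabet A] in
theorem flatMap_encodeTuple {β : Type} (w : Fin n → Word A) (u : Option A → List β) :
    (encodeTuple w).flatMap u =
      (List.finRange n).flatMap fun i => ((w i).flatMap fun a => u (some a)) ++ u none := by
  simp [encodeTuple, List.ofFn_eq_map, List.flatMap_assoc, List.flatMap_map]

omit [DecidableEq K] in
theorem length_words (S : ∀ k, List (Γ k)) (k : K) :
    (T.words S k).length = (S k).length * T.d := by
  simp [Coding.words, List.length_flatMap, T.length_enc]

variable {T}

omit [DecidableEq V] in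
theorem iterate_step_within (c : Conf Γ Λ σ) (hc : ∀ k, ∀ γ ∈ c.stk k, γ ∈ T.symbols k)
    (hs : (c.stmt, c.var) ∈ states M) (j : ℕ) :
    ((step M)^[j] c).Within M {γ | γ.2 ∈ T.symbols γ.1} := by
  induction j with
  | zero => exact ⟨hs, hc⟩
  | succ j ih =>
    rw [Function.iterate_succ_apply']
    exact ih.step T.pushed_mem

/-- The simulation of as many instructions as the clock is long. -/
theorem does_rounds [Fintype K] (hv : Function.Injective v) (r : Vals A n K) (c : Conf Γ Λ σ)
    (hc : ∀ k, ∀ γ ∈ c.stk k, γ ∈ T.symbols k) (hs : (c.stmt, c.var) ∈ states M) {N : ℕ}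
    (hb : r.b = unary N) (hN : ∀ j < N, ∀ k, (T.words ((step M)^[j] c).stk k).length ≤ N)
    (h₂ : r.c₂ = []) :
    Does v (forStmt (v .c₁) (constExpr [Alphabet.one]) (.var (v .b)) (round O T v)) (T.rep r c).get
      (T.rep { r with c₁ := [] } ((step M)^[N] c)).get := by
  have h1 := does_for (O := O) hv (x := .c₁) (d := .var (v .b)) (s := round O T v) (N := N)
    (S := (T.rep r c).get) (fun j => (T.rep r ((step M)^[j] c)).get)
    (by rw [eval_var, sto_apply hv]; exact hb) rfl fun j hj w => by
      have h := iterate_step_within c hc hs j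
      rw [Vals.update_c₁, Vals.update_c₁, Function.iterate_succ_apply']
      exact does_round hv { r with c₁ := w } _ h.2 h.1 hb (hN j hj) h₂
  rw [Vals.update_c₁] at h1
  exact h1

theorem does_storeResult (hv : Function.Injective v) (k : K) (out : Γ k → A) (r : Vals A n K)
    {s : List (Γ k)} (hs : ∀ γ ∈ s, γ ∈ T.symbols k) {N : ℕ} (hb : r.b = unary N)
    (hN : s.length ≤ N) (hk : r.stk k = s.flatMap fun γ => T.enc ⟨k, γ⟩) (hr : r.acc = []) :
    ∃ r' : Vals A n K, Does v (storeResult O T v k out) r.get r'.get ∧ r'.acc = s.map out := by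
  have h1 := does_transfer (O := O) hv (x := .stk k) (y := .acc) (z := .c₂) (t := .b) (d := T.d)
    (c := fun γ => T.enc ⟨k, γ⟩) (u := fun γ => [out γ]) (l := T.symbols k) (s := s)
    (N := N) (S := r.get) (by simp) (by simp) (by simp) T.one_le (fun _ _ => T.length_enc _)
    (T.enc_inj k) hs hb hN hk
  rw [Vals.update_stk, Vals.update_acc, Vals.update_c₂] at h1
  refine ⟨_, h1, ?_⟩
  change r.acc ++ s.flatMap (fun γ => [out γ]) = s.map out
  rw [hr, List.nil_append, List.map_eq_flatMap]

/-- If the machine halts after `J` instructions on the input `w`, and the clock is large enough,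
then the simulating program computes the output of the machine. -/
theorem does_simulation [Fintype K] (hv : Function.Injective v) {D : ℕ} {k₀ k₁ : K}
    {u : Option A → Γ k₀} (hu : ∀ o, u o ∈ T.symbols k₀) {q : Turing.TM2.Stmt Γ Λ σ} {s : σ}
    (hq : (some q, s) ∈ states M) (out : Γ k₁ → A) (w : Fin n → Word A) {J : ℕ} {c : Conf Γ Λ σ}
    (hJ : (step M)^[J] ⟨some q, s, Function.update (fun _ => []) k₀ ((encodeTuple w).map u)⟩ = c)
    (hc : c.stmt = none) (hD : ((encodeTuple w).length + J) * T.d ≤ (∑ i, (w i).length + D) ^ D)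
    (r : Vals A n K) (hw : r.par = w) (hr : ∀ k, r.stk k = []) (hp : ∀ k, r.pre k = [])
    (h₂ : r.c₂ = []) :
    ∃ r' : Vals A n K, Does v (simulation O T v D k₀ k₁ u (some q, s) out) r.get r'.get ∧
      r'.acc = (c.stk k₁).map out := by
  obtain ⟨par, pc, stk, pre, acc, a, b, c₁, c₂⟩ := r
  obtain rfl : par = w := hw
  obtain rfl : stk = fun _ => [] := funext hr
  obtain rfl : pre = fun _ => [] := funext hp
  obtain rfl : c₂ = [] := h₂
  obtain ⟨x, y, z, h1⟩ := does_setClock (O := O) hv D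
    (⟨par, pc, fun _ => [], fun _ => [], acc, a, b, c₁, []⟩ : Vals A n K) rfl
  dsimp only at h1
  set N := (∑ i, (par i).length + D) ^ D
  set c₀ : Conf Γ Λ σ := ⟨some q, s, Function.update (fun _ => []) k₀ ((encodeTuple par).map u)⟩
    with hc₀
  have hd := T.one_le
  -- the input fits into the clock
  have hin : ∀ i, (par i).length ≤ N := fun i => by
    have h1 : (par i).length ≤ (encodeTuple par).length := by
      rw [WordMachine.length_encodeTuple]
      exact (Nat.le_succ _).trans (Finset.single_le_sum (f := fun i => (par i).length + 1)
        (fun _ _ => Nat.zero_le _) (Finset.mem_univ i))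
    nlinarith
  obtain ⟨p, h2⟩ := does_loadParams (O := O) hv k₀ (fun o => T.enc ⟨k₀, u o⟩) (List.finRange n)
    (List.nodup_finRange n) (⟨par, pc, fun _ => [], fun _ => [], y, x, unary N, z, []⟩ : Vals A n K)
    rfl (fun i _ => hin i) rfl
  have e : T.words c₀.stk = Function.update (fun _ => []) k₀ ([] ++
      (List.finRange n).flatMap fun i =>
      ((par i).flatMap fun a => T.enc ⟨k₀, u (some a)⟩) ++ T.enc ⟨k₀, u none⟩) := by
    rw [hc₀, words_update, List.flatMap_map, flatMap_encodeTuple]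
    rfl
  dsimp only at h2
  rw [← e] at h2
  have h3 := does_setPc (O := O) (T := T) hv (some q, s)
    (⟨p, pc, T.words c₀.stk, fun _ => [], y, x, unary N, z, []⟩ : Vals A n K)
  have hsym : ∀ k, ∀ γ ∈ c₀.stk k, γ ∈ T.symbols k := fun k γ hγ => by
    by_cases hk : k = k₀
    · subst hk
      simp only [hc₀, Function.update_self, List.mem_map] at hγ
      obtain ⟨o, -, rfl⟩ := hγ
      exact hu o
    · simp [hc₀, hk] at hγ
  have hlen : ∀ j ≤ J, ∀ k, (((step M)^[j] c₀).stk k).length * T.d ≤ N := fun j hj k => by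
    refine (Nat.mul_le_mul_right _ ?_).trans hD
    have h1 := length_iterate_step_le M c₀ k j
    have h2 : (c₀.stk k).length ≤ (encodeTuple par).length := by
      by_cases hk : k = k₀
      · subst hk; simp [hc₀]
      · simp [hc₀, hk]
    omega
  have hJN : J ≤ N := by nlinarith
  have hhalt : ∀ j, J ≤ j → (step M)^[j] c₀ = c := fun j hj => by
    obtain ⟨i, rfl⟩ := Nat.exists_eq_add_of_le' hj
    rw [Function.iterate_add_apply, hJ, iterate_step_of_halted M hc]
  have h4 := does_rounds (O := O) hv (⟨p, pc, fun _ => [], fun _ => [], y, x, unary N, z, []⟩ :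
    Vals A n K) c₀ hsym hq (N := N) rfl (fun j _ k => by
      rw [length_words]
      rcases le_total j J with hj | hj
      · exact hlen j hj k
      · rw [hhalt j hj, ← hJ]
        exact hlen J le_rfl k) rfl
  rw [hhalt N hJN] at h4
  have h5 := does_assign (O := O) hv (x := .acc) (e := constExpr []) (w := []) (S := (T.rep
    (⟨p, pc, fun _ => [], fun _ => [], y, x, unary N, [], []⟩ : Vals A n K) c).get) rfl
  rw [Vals.update_acc] at h5
  have hw := iterate_step_within c₀ hsym hq J
  rw [hJ] at hw
  have hout : (c.stk k₁).length ≤ N := by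
    have := hlen J le_rfl k₁
    rw [hJ] at this
    nlinarith
  obtain ⟨r', h6, h7⟩ := does_storeResult (O := O) (T := T) hv k₁ out (T.rep
    (⟨p, pc, fun _ => [], fun _ => [], [], x, unary N, [], []⟩ : Vals A n K) c) (hw.2 k₁) (N := N)
    rfl hout rfl rfl
  exact ⟨r', h1.seq (h2.seq (h3.seq (h4.seq (h5.seq h6)))), h7⟩

/-- Every function in `FP` is computed by a safe for-program. -/
theorem _root_.exists_program_of_mem_FP [Infinite V] {B : Set (Expr O V)}
    (hB : constExpr [Alphabet.one] ∈ B) {f : (Fin n → Word A) →. Word A} (hf : f ∈ FP A n) :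
    ∃ P : Program O V n, P.Safe ∧ P.IsFor B ∧ P.Computes f := by
  obtain ⟨g, ⟨F⟩, rfl⟩ := hf
  have := F.tm.kFin
  have := F.tm.ΛFin
  have := F.tm.σFin
  obtain ⟨T, hT⟩ := exists_coding (A := A) F.tm.m
    (Set.range fun o => ⟨F.tm.k₀, F.inputAlphabet.symm o⟩) (Set.finite_range _)
  let cost := ∑ l, WordMachine.stmtCost (F.tm.m l)
  -- the clock bounds the lengths of the words that represent the stacks during the simulation
  obtain ⟨D, hD⟩ := Polynomial.exists_eval_le_pow
    (((.X + F.time * .C cost) * .C T.d : Polynomial ℕ).comp (.X + .C n))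
  obtain ⟨v, hv⟩ : ∃ v : Name n F.tm.K → V, Function.Injective v := by
    obtain ⟨i, hi⟩ := exists_injective_nat (Name n F.tm.K)
    exact ⟨_, (Infinite.natEmbedding V).injective.comp hi⟩
  have hok := ok_simulation (O := O) T hB hv D F.tm.k₀ F.tm.k₁ F.inputAlphabet.symm
    (some (F.tm.m F.tm.main), F.tm.initialState) F.outputAlphabet
  let P : Program O V n :=
    ⟨fun i => v (.par i), fun i j h => Name.par.inj (hv h), _, hok.breaks, v .acc⟩
  have key : ∀ w, ∃ μ', Exec (P.initStore w) P.body .go μ' ∧ μ' P.ret = g w := by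
    intro w
    have hinit : P.initStore w = sto v
        (⟨w, [], fun _ => [], fun _ => [], [], [], [], [], []⟩ : Vals A n F.tm.K).get := by
      funext y
      by_cases hy : ∃ x, v x = y
      · obtain ⟨x, rfl⟩ := hy
        rw [sto_apply hv]
        rcases x with i | _ | _ | _ | _ | _ | _ | _ | _
        · exact P.params_injective.extend_apply w _ i
        all_goals exact Function.extend_apply' _ _ _ fun ⟨i, hi⟩ => by simpa using hv hi
      · rw [sto, Function.extend_apply' _ _ _ hy]
        exact Function.extend_apply' _ _ _ fun ⟨i, hi⟩ => hy ⟨_, hi⟩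
    obtain ⟨⟨t, ht⟩, htT⟩ := F.outputsFun w
    rw [initList_eq_update, Option.map_some, haltList_eq_update] at ht
    obtain ⟨J, hJ, hrun⟩ := exists_iterate_step (b := cost) (fun l => Finset.single_le_sum
      (f := fun l => WordMachine.stmtCost (F.tm.m l)) (fun _ _ => Nat.zero_le _)
          (Finset.mem_univ l))
      ht
    have hmain : (some (F.tm.m F.tm.main), F.tm.initialState) ∈ states F.tm.m := by
      simp only [states, Turing.TM2.stmts, Set.mem_ofPred_eq, Finset.some_mem_insertNone,
        Finset.mem_biUnion]
      exact ⟨F.tm.main, Finset.mem_univ _, Turing.TM2.stmts₁_self⟩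
    have hclock : ((encodeTuple w).length + J) * T.d ≤ (∑ i, (w i).length + D) ^ D := by
      refine le_trans (Nat.mul_le_mul_right _ (Nat.add_le_add_left
        (hJ.trans (Nat.mul_le_mul_right _ htT)) _)) ((Eq.le ?_).trans (hD _))
      have : (encodeTuple w).length = ∑ i, (w i).length + n := by
        rw [WordMachine.length_encodeTuple, Finset.sum_add_distrib]
        simp
      simp [this]
    have hsim := does_simulation (O := O) (T := T) (D := D) (k₀ := F.tm.k₀)
        (u := F.inputAlphabet.symm) hv
      (fun o => hT _ ⟨o, rfl⟩) hmain F.outputAlphabet w hrun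
    obtain ⟨r, hr, hacc⟩ := hsim rfl hclock
      ⟨w, [], fun _ => [], fun _ => [], [], [], [], [], []⟩ rfl (fun _ => rfl) (fun _ => rfl) rfl
    refine ⟨_, by rw [hinit]; exact hr, ?_⟩
    change sto v r.get (v .acc) = g w
    rw [sto_apply hv, Vals.get_acc, hacc]
    simp [ofCfg]
  refine ⟨P, ⟨opEnv O, opEnv_safe O, 1, varEnv v, hok.ty⟩, hok.isFor, fun w x => ?_⟩
  obtain ⟨μ, hμ, hret⟩ := key w
  rw [PFun.coe_val, Part.mem_some_iff]
  refine ⟨fun h => ⟨μ, hμ, hret.trans h.symm⟩, ?_⟩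
  rintro ⟨μ', hμ', rfl⟩
  rw [← (hμ.det hμ').2, hret]

end Simulation

theorem mainTheorem4 {A : Type} [Alphabet A] (O : ExtraOps A) {V : Type} [DecidableEq V]
    [Infinite V] (B : Set (Expr O V))
    (hB : ∀ e ∈ B, ∀ μ : Store A V, e.eval μ ≠ [])
    (hB1 : constExpr [Alphabet.one] ∈ B) :
    (∀ n : ℕ, {f : (Fin n → Word A) →. Word A |
        ∃ P : Program O V n, P.Safe ∧ P.IsFor B ∧ P.Computes f} = FP A n) ∧
    ∀ (n : ℕ) (P : Program O V n), P.IsFor B → P.Aperiodic := by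
  refine ⟨fun n => Set.Subset.antisymm ?_ fun f hf => exists_program_of_mem_FP hB1 hf,
    fun n P hP => hP.aperiodic hB⟩
  rintro f ⟨P, hs, hP, hf⟩
  exact hs.mem_FP hB hP hf
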